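/- Let $\mathcal C(D)$ be the (unnormalised) Khovanov complex of an unoriented planar link diagram $D$ whose crossings are numbered, with integer coefficients: as a bigraded module $\mathcal C(D)=\bigoplus_{D'}\mathcal A^{\otimes k(D')}[r(D')]\{r(D')\}$, where $D'$ runs over the Kauffman states of $D$, $k(D')$ is the number of circles and $r(D')$ the number of $1$-smoothings of $D'$, $\mathcal A$ is the bigraded module with $\mathcal A^{0,1}=\mathbb Z v_+$, $\mathcal A^{0,-1}=\mathbb Z v_-$ and $\mathcal A^{i,j}=0$ otherwise, and $(M[m]\{n\})^{i,j}:=M^{i-m,j-n}$. The differential, of bidegree $(1,0)$, is the signed sum of the maps which change one $0$-smoothing to a $1$-smoothing; such a map is the product $v_+v_+\mapsto v_+$, $v_+v_-,v_-v_+\mapsto v_-$, $v_-v_-\mapsto 0$ if two circles are merged, and the coproduct $v_+\mapsto v_+\otimes v_-+v_-\otimes v_+$, $v_-\mapsto v_-\otimes v_-$ if a circle is split. Let $\mathcal H(D)$ be the homology of $\mathcal C(D)$. Let $D_1$ be a planar link diagram, let $D_2$ be the standard two-crossing diagram of the Hopf link, and let $D_1\#D_2$ be the connected sum of $D_1$ and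 $D_2$ along any arc (or crossingless circle) of $D_1$ and any arc of $D_2$. Then, by maps and homotopies that preserve the secondary grading, $\mathcal C(D_1\#D_2)$ is chain equivalent to $$\bigl(\mathcal C(D_1)[-1]\{-2\}\oplus\mathcal C(D_1)[1]\{2\}\bigr)[1]\{1\}=\mathcal C(D_1)\{-1\}\oplus\mathcal C(D_1)[2]\{3\}.$$ Consequently there is an isomorphism of bigraded abelian groups $$\mathcal H(D_1\#D_2)\cong\bigl(\mathcal H(D_1)[-1]\{-2\}\oplus\mathcal H(D_1)[1]\{2\}\bigr)[1]\{1\}.$$ (The statement on homology is due to Asaeda and Przytycki.) -/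

import Mathlib

namespace Khovanov

/-! ### Link diagrams -/

/-- The ends of a four-valent planar graph with additional bivalent vertices: every crossing
has four ends, every mark (bivalent vertex) has two. -/
abbrev Ends (C M : Type) : Type := (C × Fin 4) ⊕ (M × Bool)

/-- An (unoriented) link diagram, given by its planar diagram code.  The four ends `(c, 0)`,
`(c, 1)`, `(c, 2)`, `(c, 3)` at a crossing `c` are listed counterclockwise, with `(c, 0)` and
`(c, 2)` on the lower strand.  Besides the crossings, a strand may carry marks (bivalent vertices);
in this way a component without crossings is a circle that carries at least one mark, and every arc
between consecutive vertices has exactly two ends, which are exchanged by `edge`.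
The crossings are numbered by `num`. -/
structure Diagram where
  Crossing : Type
  Mark : Type
  [fintypeCrossing : Fintype Crossing]
  [fintypeMark : Fintype Mark]
  num : Crossing → ℕ
  num_injective : Function.Injective num
  edge : Ends Crossing Mark → Ends Crossing Mark
  edge_edge : ∀ p, edge (edge p) = p
  edge_ne : ∀ p, edge p ≠ p

attribute [instance] Diagram.fintypeCrossing Diagram.fintypeMark

namespace Diagram

variable (D : Diagram)

/-- The ends of the arcs of a diagram. -/
abbrev End : Type := Ends D.Crossing D.Mark

/-- The next end, counterclockwise, around the same vertex. -/
def rotate : D.End → D.End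
  | Sum.inl (c, i) => Sum.inl (c, i + 1)
  | Sum.inr (m, b) => Sum.inr (m, !b)

/-- Two ends lie at the same vertex. -/
def vertexSetoid : Setoid D.End :=
  Relation.EqvGen.setoid fun p q => q = D.rotate p

/-- Two ends belong to the same arc. -/
def arcSetoid : Setoid D.End :=
  Relation.EqvGen.setoid fun p q => q = D.edge p

/-- The faces of the surface which carries the diagram: the boundary of a face is traversed by
going along an arc and then turning to the next arc at the vertex which is reached. -/
def faceSetoid : Setoid D.End :=
  Relation.EqvGen.setoid fun p q => q = D.rotate (D.edge p)

/-- The connected components of the underlying graph. -/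
def componentSetoid : Setoid D.End :=
  Relation.EqvGen.setoid fun p q => q = D.edge p ∨ q = D.rotate p

/-- A diagram is planar if the surface obtained from each connected component of its underlying
graph by gluing in its faces is a sphere, that is, by Euler's formula,
`V - E + F = 2 * (number of components)`. -/
def IsPlanar : Prop :=
  (Nat.card (Quotient D.vertexSetoid) : ℤ) - Nat.card (Quotient D.arcSetoid)
    + Nat.card (Quotient D.faceSetoid) = 2 * Nat.card (Quotient D.componentSetoid)

/-- The ends can be coloured with two colours such that the colours alternate around every
vertex and along every arc; equivalently, the faces have a chessboard colouring. -/
def IsCheckerboard : Prop :=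
  ∃ o : D.End → Bool, ∀ p, o (D.edge p) = !(o p) ∧ o (D.rotate p) = !(o p)

/-! ### Kauffman states -/

/-- A Kauffman state is a choice of smoothings: `false` is the `0`-smoothing, `true` is the
`1`-smoothing. -/
abbrev State : Type := D.Crossing → Bool

/-- The end to which `p` is joined by the smoothing of its vertex: the `0`-smoothing of a
crossing joins the ends `0, 1` and the ends `2, 3`, the `1`-smoothing joins `1, 2` and `3, 0`;
at a mark the strand goes on. -/
def smooth (s : D.State) : D.End → D.End
  | Sum.inl (c, i) => Sum.inl (c, if s c then ![3, 2, 1, 0] i else ![1, 0, 3, 2] i)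
  | Sum.inr (m, b) => Sum.inr (m, !b)

/-- Two ends lie on the same circle of the Kauffman state `s`. -/
def circleSetoid (s : D.State) : Setoid D.End :=
  Relation.EqvGen.setoid fun p q => q = D.edge p ∨ q = D.smooth s p

/-- The circles of a Kauffman state. -/
def Circle (s : D.State) : Type := Quotient (D.circleSetoid s)

/-- The circle through an end. -/
def circle (s : D.State) (p : D.End) : D.Circle s := Quotient.mk (D.circleSetoid s) p

/-! ### Facts on the circles of neighbouring states -/

open Classical in
/-- The state in which the smoothing of the crossing `c` is the `1`-smoothing. -/
noncomputable def State.flip {D : Diagram} (s : D.State) (c : D.Crossing) : D.State :=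
  Function.update s c true

variable {D}

/-- The end number `i` of the crossing `c`. -/
def corner (c : D.Crossing) (i : Fin 4) : D.End := Sum.inl (c, i)

theorem circle_eq {s : D.State} {p q : D.End} :
    D.circle s p = D.circle s q ↔ D.circleSetoid s p q := Quotient.eq

theorem circle_edge (s : D.State) (p : D.End) : D.circle s (D.edge p) = D.circle s p :=
  (circle_eq.2 (Relation.EqvGen.rel _ _ (Or.inl rfl))).symm

theorem circle_smooth (s : D.State) (p : D.End) : D.circle s (D.smooth s p) = D.circle s p :=
  (circle_eq.2 (Relation.EqvGen.rel _ _ (Or.inr rfl))).symm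

theorem circle_ind {s : D.State} {α : Type} (f : D.End → α)
    (h₁ : ∀ p, f (D.edge p) = f p) (h₂ : ∀ p, f (D.smooth s p) = f p) {p q : D.End}
    (h : D.circle s p = D.circle s q) : f p = f q := by
  have h' : Relation.EqvGen (fun p q => q = D.edge p ∨ q = D.smooth s p) p q := circle_eq.1 h
  induction h' with
  | rel a b hab => rcases hab with rfl | rfl <;> simp [h₁, h₂]
  | refl a => rfl
  | symm a b _ ih => exact (ih (circle_eq.2 (by assumption))).symm
  | trans a b c _ _ ih₁ ih₂ =>
    exact (ih₁ (circle_eq.2 (by assumption))).trans (ih₂ (circle_eq.2 (by assumption)))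

theorem smooth_smooth (s : D.State) (p : D.End) : D.smooth s (D.smooth s p) = p := by
  rcases p with ⟨c, i⟩ | ⟨m, b⟩
  · cases h : s c <;> fin_cases i <;> simp [smooth, h]
  · simp [smooth]

theorem circle_corner_false {s : D.State} {c : D.Crossing} (h : s c = false) :
    D.circle s (corner c 1) = D.circle s (corner c 0) ∧
    D.circle s (corner c 3) = D.circle s (corner c 2) := by
  have h0 := circle_smooth s (corner c 0)
  have h2 := circle_smooth s (corner c 2)
  simp only [smooth, corner, h] at h0 h2 ⊢
  exact ⟨h0, h2⟩

theorem circle_corner_true {s : D.State} {c : D.Crossing} (h : s c = true) :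
    D.circle s (corner c 3) = D.circle s (corner c 0) ∧
    D.circle s (corner c 1) = D.circle s (corner c 2) := by
  have h0 := circle_smooth s (corner c 0)
  have h2 := circle_smooth s (corner c 2)
  simp only [smooth, corner, h] at h0 h2 ⊢
  exact ⟨h0, h2⟩

/-- The circle of `s` through `p` passes by the crossing `c`. -/
def Touches (s : D.State) (c : D.Crossing) (p : D.End) : Prop :=
  D.circle s p = D.circle s (corner c 0) ∨ D.circle s p = D.circle s (corner c 2)

theorem touches_corner (s : D.State) (c : D.Crossing) (i : Fin 4) :
    Touches s c (corner c i) := by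
  unfold Touches
  cases h : s c
  · have := circle_corner_false h
    fin_cases i <;> simp [this]
  · have := circle_corner_true h
    fin_cases i <;> simp [this]

/-- The circle of `s` which passes by the crossing `c` meets it twice. -/
def Splits (s : D.State) (c : D.Crossing) : Prop :=
  D.circle s (corner c 0) = D.circle s (corner c 2)

theorem Touches.congr {s : D.State} {c : D.Crossing} {p q : D.End}
    (h : D.circle s p = D.circle s q) : Touches s c p ↔ Touches s c q := by
  unfold Touches; rw [h]

theorem smooth_congr {s t : D.State} {c : D.Crossing} (hst : ∀ x, x ≠ c → s x = t x) (p : D.End) :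
    D.smooth s p = D.smooth t p ∨ ∃ i j, p = corner c i ∧ D.smooth s p = corner c j := by
  rcases p with ⟨x, i⟩ | ⟨m, b⟩
  · by_cases hx : x = c
    · subst hx; exact Or.inr ⟨i, _, rfl, rfl⟩
    · left; simp [smooth, hst x hx]
  · left; rfl

/-- Changing the smoothing at `c` does not change the circles that do not pass by `c`. -/
theorem circle_change {s t : D.State} {c : D.Crossing} (hst : ∀ x, x ≠ c → s x = t x)
    {p q : D.End} (h : D.circle s p = D.circle s q) :
    D.circle t p = D.circle t q ∨ (Touches t c p ∧ Touches t c q) := by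
  have h' : Relation.EqvGen (fun p q => q = D.edge p ∨ q = D.smooth s p) p q := circle_eq.1 h
  clear h
  induction h' with
  | rel a b hab =>
    rcases hab with rfl | rfl
    · left; rw [circle_edge]
    · rcases smooth_congr hst a with h | ⟨i, j, h, h'⟩
      · left; rw [h, circle_smooth]
      · right; rw [h', h]; exact ⟨touches_corner _ _ _, touches_corner _ _ _⟩
  | refl a => left; rfl
  | symm a b _ ih =>
    rcases ih with h | h
    · exact Or.inl h.symm
    · exact Or.inr h.symm
  | trans a b x _ _ ih₁ ih₂ =>
    rcases ih₁ with h₁ | h₁ <;> rcases ih₂ with h₂ | h₂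
    · exact Or.inl (h₁.trans h₂)
    · exact Or.inr ⟨(Touches.congr h₁).2 h₂.1, h₂.2⟩
    · exact Or.inr ⟨h₁.1, (Touches.congr h₂).1 h₁.2⟩
    · exact Or.inr ⟨h₁.1, h₂.2⟩

theorem touches_change {s t : D.State} {c : D.Crossing} (hst : ∀ x, x ≠ c → s x = t x)
    {p : D.End} (h : Touches s c p) : Touches t c p := by
  rcases h with h | h <;> rcases circle_change hst h with h | h
  · exact (Touches.congr h).2 (touches_corner _ _ _)
  · exact h.1
  · exact (Touches.congr h).2 (touches_corner _ _ _)
  · exact h.1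

theorem touches_iff {s t : D.State} {c : D.Crossing} (hst : ∀ x, x ≠ c → s x = t x) (p : D.End) :
    Touches s c p ↔ Touches t c p :=
  ⟨touches_change hst, touches_change fun x hx => (hst x hx).symm⟩

theorem circle_iff {s t : D.State} {c : D.Crossing} (hst : ∀ x, x ≠ c → s x = t x) {p q : D.End}
    (hp : ¬ Touches s c p) : D.circle s p = D.circle s q ↔ D.circle t p = D.circle t q := by
  constructor
  · intro h
    rcases circle_change hst h with h | h
    · exact h
    · exact absurd ((touches_iff hst p).2 h.1) hp
  · intro h
    rcases circle_change (fun x hx => (hst x hx).symm) h with h | h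
    · exact h
    · exact absurd h.1 hp

theorem flip_same (s : D.State) (c : D.Crossing) : s.flip c c = true := by
  simp [State.flip]

theorem flip_ne (s : D.State) {c x : D.Crossing} (h : x ≠ c) : s.flip c x = s x := by
  simp [State.flip, h]

theorem flip_comm (s : D.State) (c x : D.Crossing) : (s.flip c).flip x = (s.flip x).flip c := by
  classical
  funext y
  simp only [State.flip, Function.update_apply]
  split_ifs <;> rfl

theorem flip_agree (s : D.State) (c : D.Crossing) : ∀ x, x ≠ c → s x = s.flip c x :=
  fun _ hx => (flip_ne s hx).symm

end Diagram

/-- Multiplication of a permutation by a transposition merges or splits cycles. -/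
theorem sameCycle_swap_mul {α : Type} [DecidableEq α] [Finite α] (N : Equiv.Perm α) {x y : α}
    (hxy : x ≠ y) : N.SameCycle x y ↔ ¬ (Equiv.swap x y * N).SameCycle x y := by
  have key : ∀ (N : Equiv.Perm α), ∀ n : ℕ, (∀ i, 0 < i → i ≤ n → (N ^ i) x ≠ x ∧ (N ^ i) x ≠ y) →
      ((Equiv.swap x y * N) ^ n) x = (N ^ n) x := by
    intro N n
    induction n with
    | zero => intro _; rfl
    | succ n ih =>
      intro h
      rw [pow_succ', Equiv.Perm.mul_apply, ih fun i h0 hi => h i h0 (by omega),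
        Equiv.Perm.mul_apply, ← Equiv.Perm.mul_apply N, ← pow_succ' N]
      have := h (n + 1) (by omega) le_rfl
      exact Equiv.swap_apply_of_ne_of_ne this.1 this.2
  -- the first return of `x` to `x` or `y`
  have main : ∀ N : Equiv.Perm α, ∃ n : ℕ, 0 < n ∧
      (∀ i, 0 < i → i < n → (N ^ i) x ≠ x ∧ (N ^ i) x ≠ y) ∧
      ((N ^ n) x = x ∨ (N ^ n) x = y) ∧
      ((Equiv.swap x y * N) ^ n) x = Equiv.swap x y ((N ^ n) x) := by
    intro N
    have hex : ∃ n : ℕ, 0 < n ∧ ((N ^ n) x = x ∨ (N ^ n) x = y) :=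
      ⟨orderOf N, orderOf_pos N, Or.inl (by simp [pow_orderOf_eq_one])⟩
    classical
    obtain ⟨h0, h1⟩ := Nat.find_spec hex
    have hmin : ∀ i, 0 < i → i < Nat.find hex → (N ^ i) x ≠ x ∧ (N ^ i) x ≠ y := by
      intro i hi hlt
      have := Nat.find_min hex hlt
      push Not at this
      exact this hi
    refine ⟨Nat.find hex, h0, hmin, h1, ?_⟩
    obtain ⟨m, hm⟩ : ∃ m, Nat.find hex = m + 1 := ⟨Nat.find hex - 1, by omega⟩
    rw [hm] at hmin ⊢
    rw [pow_succ', Equiv.Perm.mul_apply, key N m fun i h0 hi => hmin i h0 (by omega),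
      Equiv.Perm.mul_apply, ← Equiv.Perm.mul_apply N, ← pow_succ' N]
  -- if the first return is to `x`, then `y` is not on the cycle of `x`
  have ret : ∀ N : Equiv.Perm α, ∀ n : ℕ, 0 < n →
      (∀ i, 0 < i → i < n → (N ^ i) x ≠ x ∧ (N ^ i) x ≠ y) → (N ^ n) x = x →
      ¬ N.SameCycle x y := by
    intro N n hn hmin hx hc
    obtain ⟨m, -, hm⟩ := hc.exists_pow_eq'
    have hper : ∀ k r : ℕ, (N ^ (n * k + r)) x = (N ^ r) x := by
      intro k r
      induction k with
      | zero => simp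
      | succ k ih =>
        have : n * (k + 1) + r = (n * k + r) + n := by ring
        rw [this, pow_add, Equiv.Perm.mul_apply, hx, ih]
    have h1 : (N ^ (m % n)) x = y := by
      rw [← hper (m / n) (m % n), Nat.div_add_mod, hm]
    rcases Nat.eq_zero_or_pos (m % n) with h | h
    · rw [h] at h1; exact hxy h1
    · exact (hmin _ h (Nat.mod_lt _ hn)).2 h1
  obtain ⟨n, hn, hmin, hor, hsw⟩ := main N
  obtain ⟨n', hn', hmin', hor', hsw'⟩ := main (Equiv.swap x y * N)
  have hback : Equiv.swap x y * (Equiv.swap x y * N) = N := by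
    rw [← mul_assoc, Equiv.swap_mul_self, one_mul]
  constructor
  · intro h
    rcases hor with h1 | h1
    · exact absurd h (ret N n hn hmin h1)
    · rcases hor' with h2 | h2
      · exact ret _ n' hn' hmin' h2
      · -- then the first return of `N` is to `x`
        exfalso
        rw [hback, h2, Equiv.swap_apply_right] at hsw'
        -- compare `n` and `n'`
        rw [h1, Equiv.swap_apply_right] at hsw
        rcases lt_trichotomy n n' with hlt | heq | hgt
        · exact (hmin' n hn hlt).1 hsw
        · rw [heq] at hsw; exact hxy (hsw.symm.trans h2)
        · exact (hmin n' hn' hgt).1 hsw'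
  · intro h
    rcases hor with h1 | h1
    · rw [h1, Equiv.swap_apply_left] at hsw
      exact absurd ⟨(n : ℤ), by simpa using hsw⟩ h
    · exact ⟨(n : ℤ), by simpa using h1⟩

namespace Diagram

variable {D : Diagram}

theorem IsCheckerboard.smooth {o : D.End → Bool} (ho : ∀ p, o (D.rotate p) = !(o p))
    (s : D.State) (p : D.End) : o (D.smooth s p) = !(o p) := by
  rcases p with ⟨c, i⟩ | ⟨m, b⟩
  · have h0 := ho (corner c 0)
    have h1 := ho (corner c 1)
    have h2 := ho (corner c 2)
    have h3 := ho (corner c 3)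
    simp only [rotate, corner] at h0 h1 h2 h3
    norm_num at h0 h1 h2 h3
    cases h : s c <;> fin_cases i <;> simp [Diagram.smooth, h, h0] <;>
      simp_all
  · have h0 := ho (Sum.inr (m, b))
    simpa [Diagram.smooth, rotate] using h0

/-- The successor of an end on its circle, as a permutation. -/
def next (s : D.State) : Equiv.Perm D.End where
  toFun p := D.smooth s (D.edge p)
  invFun p := D.edge (D.smooth s p)
  left_inv p := by simp [smooth_smooth, D.edge_edge]
  right_inv p := by simp [smooth_smooth, D.edge_edge]

/-- In a diagram with a chessboard colouring, flipping a smoothing merges two circles or splits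
one circle. -/
theorem merge_or_split (hD : D.IsCheckerboard) {s : D.State} {c : D.Crossing}
    (hs : s c = false) :
    D.circle s (corner c 0) = D.circle s (corner c 2) ↔
      ¬ D.circle (s.flip c) (corner c 0) = D.circle (s.flip c) (corner c 2) := by
  classical
  obtain ⟨o, ho⟩ := hD
  have ho1 : ∀ p, o (D.edge p) = !(o p) := fun p => (ho p).1
  have ho2 : ∀ p, o (D.rotate p) = !(o p) := fun p => (ho p).2
  have hnext : ∀ (t : D.State) p, o (next t p) = o p := by
    intro t p
    simp [next, IsCheckerboard.smooth ho2, ho1]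
  let Q := {p : D.End // o p = o (corner c 0)}
  let N : D.State → Equiv.Perm Q := fun t =>
    (next t).subtypePerm fun p => by rw [hnext]
  have hc1 : o (corner c 1) = !(o (corner c 0)) := ho2 (corner c 0)
  have hc2 : o (corner c 2) = o (corner c 0) := by
    have : o (corner c 2) = !(o (corner c 1)) := ho2 (corner c 1)
    rw [this, hc1, Bool.not_not]
  have hc3 : o (corner c 3) = !(o (corner c 0)) := by
    have : o (corner c 3) = !(o (corner c 2)) := ho2 (corner c 2)
    rw [this, hc2]
  let x : Q := ⟨corner c 0, rfl⟩
  let y : Q := ⟨corner c 2, hc2⟩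
  have hxy : x ≠ y := by
    intro h
    have := congrArg Subtype.val h
    simp [x, y, corner] at this
  have hNval : ∀ t (z : Q), (N t z).1 = D.smooth t (D.edge z.1) := fun _ _ => rfl
  have hN : N (s.flip c) = Equiv.swap x y * N s := by
    ext ⟨p, hp⟩
    have hq : o (D.edge p) = !(o (corner c 0)) := by rw [ho1, hp]
    rw [Equiv.Perm.mul_apply, ← Subtype.val_injective.swap_apply, hNval, hNval]
    change D.smooth (s.flip c) (D.edge p)
      = Equiv.swap (corner c 0) (corner c 2) (D.smooth s (D.edge p))
    generalize D.edge p = q at hq ⊢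
    rcases q with ⟨d, i⟩ | ⟨m, b⟩
    · by_cases hd : d = c
      · subst hd
        fin_cases i
        · change o (corner d 0) = _ at hq
          simp at hq
        · simp [Diagram.smooth, hs, flip_same, corner]
        · change o (corner d 2) = _ at hq
          rw [hc2] at hq; simp at hq
        · simp [Diagram.smooth, hs, flip_same, corner]
      · simp [Diagram.smooth, flip_ne s hd, Equiv.swap_apply_def, corner, hd]
    · simp [Diagram.smooth, Equiv.swap_apply_def, corner]
  have hrel : ∀ t : D.State, D.circle t (corner c 0) = D.circle t (corner c 2) ↔
      (N t).SameCycle x y := by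
    intro t
    have hmem : ∀ p, o (if o p = o (corner c 0) then p else D.edge p) = o (corner c 0) := by
      intro p
      split_ifs with h
      · exact h
      · rw [ho1]; cases h1 : o p <;> cases h2 : o (corner c 0) <;> simp_all
    let out : D.End → Q := fun p => ⟨if o p = o (corner c 0) then p else D.edge p, hmem p⟩
    constructor
    · intro h
      let S : Setoid Q := ⟨(N t).SameCycle, Equiv.Perm.SameCycle.equivalence _⟩
      have := circle_ind (s := t) (fun p => (Quotient.mk S (out p))) ?_ ?_ h
      · have := Quotient.exact this
        have hx : out (corner c 0) = x := by simp [out, x]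
        have hy : out (corner c 2) = y := by simp [out, y, hc2]
        rw [hx, hy] at this
        exact this
      · intro p
        congr 1
        apply Subtype.ext
        simp only [out, ho1, D.edge_edge]
        by_cases h : o p = o (corner c 0)
        · simp [h]
        · have : (!(o p)) = o (corner c 0) := by
            cases h1 : o p <;> cases h2 : o (corner c 0) <;> simp_all
          simp [h, this]
      · intro p
        apply Quotient.sound
        change (N t).SameCycle _ _
        have hsm := IsCheckerboard.smooth ho2 t
        by_cases h : o p = o (corner c 0)
        · refine ⟨1, ?_⟩
          apply Subtype.ext
          rw [zpow_one, hNval]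
          simp [out, hsm, h, D.edge_edge, smooth_smooth]
        · have h' : (!(o p)) = o (corner c 0) := by
            cases h1 : o p <;> cases h2 : o (corner c 0) <;> simp_all
          refine Equiv.Perm.SameCycle.symm ⟨1, ?_⟩
          apply Subtype.ext
          rw [zpow_one, hNval]
          simp [out, hsm, h, h', D.edge_edge]
    · rintro ⟨k, hk⟩
      have hpow : ∀ (n : ℕ) (z : Q), D.circle t ((N t ^ n) z).1 = D.circle t z.1 := by
        intro n
        induction n with
        | zero => intro z; rfl
        | succ n ih =>
          intro z
          rw [pow_succ, Equiv.Perm.mul_apply, ih, hNval, circle_smooth, circle_edge]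
      obtain ⟨m, -, hm⟩ := Equiv.Perm.SameCycle.exists_pow_eq' (f := N t) ⟨k, hk⟩
      have := hpow m x
      rw [hm] at this
      exact this.symm
  rw [hrel, hrel, hN]
  exact sameCycle_swap_mul (N s) hxy

end Diagram

/-! ### The Khovanov complex -/

namespace Diagram

variable (D : Diagram)

noncomputable instance (s : D.State) : Fintype (D.Circle s) :=
  @Fintype.ofFinite _ (Quotient.finite (D.circleSetoid s))

/-- An enhanced Kauffman state is a Kauffman state `D'` together with a sign for each circle
(`true` for `v₊`, `false` for `v₋`).  Since `𝒜` is free on `v₊, v₋`, the enhanced states with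
underlying Kauffman state `D'` form a basis of `𝒞(D') = 𝒜 ⊗ ⋯ ⊗ 𝒜`. -/
structure EnhancedState where
  state : D.State
  label : D.Circle state → Bool

variable {D}

namespace EnhancedState

/-- The sign of the circle through an end. -/
def lab (S : D.EnhancedState) (p : D.End) : Bool := S.label (D.circle S.state p)

/-- The number of `1`-smoothings. -/
def homDegree (S : D.EnhancedState) : ℤ := Fintype.card {c : D.Crossing // S.state c = true}

/-- `v₊` and `v₋` have degree `1` and `-1`, and there is a shift by the number of
`1`-smoothings. -/
noncomputable def qDegree (S : D.EnhancedState) : ℤ :=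
  S.homDegree + ∑ k : D.Circle S.state, if S.label k then 1 else -1

end EnhancedState

/-- The coefficient of `c` in the product `a * b` of `𝒜`:
`v₊ v₊ = v₊`, `v₊ v₋ = v₋ v₊ = v₋`, `v₋ v₋ = 0`. -/
def mulCoeff : Bool → Bool → Bool → ℤ
  | true, true, true => 1
  | true, false, false => 1
  | false, true, false => 1
  | _, _, _ => 0

/-- The coefficient of `b ⊗ c` in the coproduct of `a ∈ 𝒜`:
`v₊ ↦ v₊ ⊗ v₋ + v₋ ⊗ v₊`, `v₋ ↦ v₋ ⊗ v₋`. -/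
def comulCoeff : Bool → Bool → Bool → ℤ
  | true, true, false => 1
  | true, false, true => 1
  | false, false, false => 1
  | _, _, _ => 0

/-- The enhanced state `T` may occur in the image of `S` when the smoothing of the crossing `c` is
changed: it is the `0`-smoothing in `S`, the `1`-smoothing in `T`, the other smoothings agree,
and the circles that do not pass by `c` have the same signs. -/
def IsEdge (c : D.Crossing) (S T : D.EnhancedState) : Prop :=
  S.state c = false ∧ T.state = S.state.flip c ∧
    ∀ p, ¬ Touches S.state c p → T.lab p = S.lab p

open Classical in
/-- The coefficient of `T` in the image of `S` under the map which is induced by changing the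
`0`-smoothing of the crossing `c` to the `1`-smoothing: it is the coproduct if this splits the
circle at `c` in two, and the product if it merges the two circles at `c`. -/
noncomputable def edgeCoeff (c : D.Crossing) (S T : D.EnhancedState) : ℤ :=
  if IsEdge c S T then
    if Splits S.state c then
      comulCoeff (S.lab (corner c 0)) (T.lab (corner c 0)) (T.lab (corner c 2))
    else
      mulCoeff (S.lab (corner c 0)) (S.lab (corner c 2)) (T.lab (corner c 0))
  else 0

/-- The sign `(-1)^k`, where `k` is the number of `1`-smoothings at crossings before `c`. -/
def edgeSign (c : D.Crossing) (s : D.State) : ℤ :=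
  (-1) ^ Fintype.card {x : D.Crossing // D.num x < D.num c ∧ s x = true}

/-- The matrix of the differential in the basis of enhanced states. -/
noncomputable def incidence (S T : D.EnhancedState) : ℤ :=
  ∑ c : D.Crossing, edgeSign c S.state * edgeCoeff c S T

/-! ### The differential has bidegree `(1, 0)` and square zero -/

namespace EnhancedState

theorem ext_lab {S T : D.EnhancedState} (h : S.state = T.state) (h' : ∀ p, S.lab p = T.lab p) :
    S = T := by
  obtain ⟨s, l⟩ := S
  obtain ⟨t, m⟩ := T
  obtain rfl : s = t := h
  congr 1
  funext k
  obtain ⟨p, rfl⟩ := Quotient.exists_rep k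
  exact h' p

theorem lab_congr (S : D.EnhancedState) {p q : D.End}
    (h : D.circle S.state p = D.circle S.state q) : S.lab p = S.lab q := by
  unfold lab; rw [h]

instance : Finite D.EnhancedState := by
  classical
  exact Finite.of_injective (fun S : D.EnhancedState => (S.state, S.lab)) fun S T h =>
    ext_lab (congrArg Prod.fst h) fun p => congrFun (congrArg Prod.snd h) p

noncomputable instance : Fintype D.EnhancedState := Fintype.ofFinite _

open Classical in
/-- Replace the sign of the circle through `p`. -/
noncomputable def set (S : D.EnhancedState) (p : D.End) (b : Bool) : D.EnhancedState :=
  ⟨S.state, Function.update S.label (D.circle S.state p) b⟩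

@[simp] theorem set_state (S : D.EnhancedState) (p : D.End) (b : Bool) :
    (S.set p b).state = S.state := rfl

open Classical in
theorem set_lab (S : D.EnhancedState) (p q : D.End) (b : Bool) :
    (S.set p b).lab q = if D.circle S.state q = D.circle S.state p then b else S.lab q := by
  simp only [set, lab, Function.update_apply]

theorem set_lab_self (S : D.EnhancedState) (p : D.End) (b : Bool) : (S.set p b).lab p = b := by
  simp [set_lab]

theorem set_set (S : D.EnhancedState) (p : D.End) (b b' : Bool) :
    (S.set p b).set p b' = S.set p b' := by
  refine ext_lab rfl fun q => ?_
  simp only [set_lab, set_state]; split_ifs <;> simp_all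

theorem set_eq_self (S : D.EnhancedState) (p : D.End) : S.set p (S.lab p) = S := by
  refine ext_lab rfl fun q => ?_
  rw [set_lab]; split_ifs with h
  · exact (S.lab_congr h).symm
  · rfl

theorem set_congr (S : D.EnhancedState) {p q : D.End}
    (h : D.circle S.state p = D.circle S.state q) (b : Bool) : S.set p b = S.set q b := by
  unfold set; rw [h]

/-- The state in which all circles carry `v₊`. -/
def one (s : D.State) : D.EnhancedState := ⟨s, fun _ => true⟩

@[simp] theorem one_lab (s : D.State) (p : D.End) : (one s).lab p = true := rfl
@[simp] theorem one_state (s : D.State) : (one s).state = s := rfl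

end EnhancedState

open EnhancedState

theorem edgeCoeff_of_not {c : D.Crossing} {S T : D.EnhancedState} (h : ¬ IsEdge c S T) :
    edgeCoeff c S T = 0 := if_neg h

theorem edgeCoeff_of_split {c : D.Crossing} {S T : D.EnhancedState} (h : IsEdge c S T)
    (h' : D.circle S.state (corner c 0) = D.circle S.state (corner c 2)) :
    edgeCoeff c S T =
      comulCoeff (S.lab (corner c 0)) (T.lab (corner c 0)) (T.lab (corner c 2)) := by
  exact (if_pos h).trans (if_pos h')

theorem edgeCoeff_of_merge {c : D.Crossing} {S T : D.EnhancedState} (h : IsEdge c S T)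
    (h' : ¬ D.circle S.state (corner c 0) = D.circle S.state (corner c 2)) :
    edgeCoeff c S T =
      mulCoeff (S.lab (corner c 0)) (S.lab (corner c 2)) (T.lab (corner c 0)) := by
  exact (if_pos h).trans (if_neg h')

/-- How a sum over the circles changes when the smoothing of a crossing is changed. -/
theorem sum_circle (hD : D.IsCheckerboard) (v : Bool → ℤ) {c : D.Crossing}
    {S T : D.EnhancedState} (hc : S.state c = false) (hT : T.state = S.state.flip c)
    (hlab : ∀ p, ¬ Touches S.state c p → T.lab p = S.lab p) :
    (D.circle S.state (corner c 0) = D.circle S.state (corner c 2) →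
      ∑ k, v (T.label k) + v (S.lab (corner c 0))
        = ∑ k, v (S.label k) + v (T.lab (corner c 0)) + v (T.lab (corner c 2))) ∧
    (¬ D.circle S.state (corner c 0) = D.circle S.state (corner c 2) →
      ∑ k, v (T.label k) + v (S.lab (corner c 0)) + v (S.lab (corner c 2))
        = ∑ k, v (S.label k) + v (T.lab (corner c 0))) := by
  classical
  have hagree : ∀ x, x ≠ c → S.state x = T.state x := by rw [hT]; exact flip_agree _ _
  have hms : D.circle S.state (corner c 0) = D.circle S.state (corner c 2) ↔
      ¬ D.circle T.state (corner c 0) = D.circle T.state (corner c 2) := by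
    rw [hT]; exact merge_or_split hD hc
  have hout : ∀ (s : D.State) (k : D.Circle s), D.circle s (Quotient.out k) = k :=
    fun s k => Quotient.out_eq k
  have hsum : ∀ U : D.EnhancedState, ∑ k, v (U.label k)
      = ∑ k ∈ Finset.univ.filter (fun k : D.Circle U.state => ¬ Touches U.state c (Quotient.out k)),
          v (U.lab (Quotient.out k))
        + if D.circle U.state (corner c 0) = D.circle U.state (corner c 2) then
            v (U.lab (corner c 0)) else v (U.lab (corner c 0)) + v (U.lab (corner c 2)) := by
    intro U
    rw [← Finset.sum_filter_not_add_sum_filter Finset.univ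
      (fun k : D.Circle U.state => Touches U.state c (Quotient.out k))]
    congr 1
    · refine Finset.sum_congr rfl fun k _ => ?_
      simp only [lab, hout]
    · have hf : Finset.univ.filter (fun k : D.Circle U.state => Touches U.state c (Quotient.out k))
          = {D.circle U.state (corner c 0), D.circle U.state (corner c 2)} := by
        ext k
        simp [Touches, hout]
      rw [hf]
      split_ifs with h
      · rw [h]; simp [lab, h]
      · rw [Finset.sum_pair h]; rfl
  have hrest : ∑ k ∈ Finset.univ.filter (fun k : D.Circle S.state => ¬ Touches S.state c (Quotient.out k)),
          v (S.lab (Quotient.out k)) =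
      ∑ k ∈ Finset.univ.filter (fun k : D.Circle T.state => ¬ Touches T.state c (Quotient.out k)),
          v (T.lab (Quotient.out k)) := by
    refine Finset.sum_nbij' (fun k => D.circle T.state (Quotient.out k)) (fun k => D.circle S.state (Quotient.out k))
      ?_ ?_ ?_ ?_ ?_
    · intro k hk
      simp only [Finset.mem_filter, Finset.mem_univ, true_and] at hk ⊢
      rw [Touches.congr (hout T.state (D.circle T.state (Quotient.out k))), ← touches_iff hagree]
      exact hk
    · intro k hk
      simp only [Finset.mem_filter, Finset.mem_univ, true_and] at hk ⊢
      rw [Touches.congr (hout S.state (D.circle S.state (Quotient.out k))), touches_iff hagree]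
      exact hk
    · intro k hk
      simp only [Finset.mem_filter, Finset.mem_univ, true_and] at hk
      have h1 := hout T.state (D.circle T.state (Quotient.out k))
      rw [touches_iff hagree] at hk
      rw [← hout S.state k]
      simp only [hout]
      have := (circle_iff hagree (q := Quotient.out (D.circle T.state (Quotient.out k)))
        (by rw [touches_iff hagree]; exact hk)).2 h1.symm
      rw [← this, hout]
    · intro k hk
      simp only [Finset.mem_filter, Finset.mem_univ, true_and] at hk
      have h1 := hout S.state (D.circle S.state (Quotient.out k))
      rw [← touches_iff hagree] at hk
      have := (circle_iff hagree (q := Quotient.out (D.circle S.state (Quotient.out k))) hk).1 h1.symm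
      rw [← this, hout]
    · intro k hk
      simp only [Finset.mem_filter, Finset.mem_univ, true_and] at hk
      rw [← hlab _ hk]
      rw [T.lab_congr (hout T.state (D.circle T.state (Quotient.out k)))]
  rw [hsum T, hsum S, hrest]
  constructor
  · intro h
    rw [if_pos h, if_neg (hms.1 h)]; ring
  · intro h
    have h' : D.circle T.state (corner c 0) = D.circle T.state (corner c 2) := by
      by_contra h'; exact h (hms.2 h')
    rw [if_neg h, if_pos h']; ring

theorem edgeCoeff_degree (hD : D.IsCheckerboard) {c : D.Crossing} {S T : D.EnhancedState}
    (h : edgeCoeff c S T ≠ 0) :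
    T.homDegree = S.homDegree + 1 ∧ T.qDegree = S.qDegree := by
  classical
  unfold edgeCoeff at h
  split_ifs at h with hcond hsplit
  all_goals try exact absurd rfl h
  all_goals
    obtain ⟨hc, hT, hlab⟩ := hcond
    have hhom : T.homDegree = S.homDegree + 1 := by
      unfold homDegree
      have : Finset.univ.filter (fun x => T.state x = true)
          = insert c (Finset.univ.filter (fun x => S.state x = true)) := by
        ext x
        simp only [Finset.mem_filter, Finset.mem_univ, true_and, Finset.mem_insert]
        rw [hT]
        by_cases hx : x = c
        · simp [hx, flip_same]
        · simp [flip_ne _ hx, hx]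
      rw [Fintype.card_subtype, Fintype.card_subtype, this, Finset.card_insert_of_notMem]
      · push_cast; rfl
      · simp [hc]
    refine ⟨hhom, ?_⟩
    have hs := sum_circle hD (fun b => if b then 1 else -1) hc hT hlab
    unfold qDegree
    rw [hhom]
  · have := hs.1 hsplit
    revert h this
    cases S.lab (corner c 0) <;> cases T.lab (corner c 0) <;> cases T.lab (corner c 2) <;>
      simp [comulCoeff] <;> intros <;> linarith
  · have := hs.2 hsplit
    revert h this
    cases S.lab (corner c 0) <;> cases S.lab (corner c 2) <;> cases T.lab (corner c 0) <;>
      simp [mulCoeff] <;> intros <;> linarith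

theorem incidence_degree (hD : D.IsCheckerboard) {S T : D.EnhancedState}
    (h : incidence S T ≠ 0) :
    T.homDegree = S.homDegree + 1 ∧ T.qDegree = S.qDegree := by
  obtain ⟨c, -, hc⟩ := Finset.exists_ne_zero_of_sum_ne_zero h
  exact edgeCoeff_degree hD (right_ne_zero_of_mul hc)

/-- The maps of the cube commute with the multiplication by `v₋` at a point. -/
theorem edgeCoeff_set (hD : D.IsCheckerboard) (c : D.Crossing) (p : D.End)
    (S W : D.EnhancedState) :
    (if W.lab p = false then edgeCoeff c S (W.set p true) else 0)
      = if S.lab p = true then edgeCoeff c (S.set p false) W else 0 := by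
  classical
  by_cases hst : S.state c = false ∧ W.state = S.state.flip c
  swap
  · have h1 : edgeCoeff c S (W.set p true) = 0 :=
      edgeCoeff_of_not fun h => hst ⟨h.1, h.2.1⟩
    have h2 : edgeCoeff c (S.set p false) W = 0 :=
      edgeCoeff_of_not fun h => hst ⟨h.1, h.2.1⟩
    rw [h1, h2]; simp
  obtain ⟨hc, hW⟩ := hst
  have hagree : ∀ x, x ≠ c → S.state x = W.state x := by rw [hW]; exact flip_agree _ _
  have hms : D.circle S.state (corner c 0) = D.circle S.state (corner c 2) ↔
      ¬ D.circle W.state (corner c 0) = D.circle W.state (corner c 2) := by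
    rw [hW]; exact merge_or_split hD hc
  have i1 : IsEdge c S (W.set p true) ↔
      ∀ q, ¬ Touches S.state c q → (W.set p true).lab q = S.lab q :=
    ⟨fun h => h.2.2, fun h => ⟨hc, hW, h⟩⟩
  have i2 : IsEdge c (S.set p false) W ↔
      ∀ q, ¬ Touches S.state c q → W.lab q = (S.set p false).lab q :=
    ⟨fun h => h.2.2, fun h => ⟨hc, hW, h⟩⟩
  by_cases hp : Touches S.state c p
  · -- the circle through `p` passes by `c`
    have hp' : Touches W.state c p := (touches_iff hagree p).1 hp
    have e1 : (∀ q, ¬ Touches S.state c q → (W.set p true).lab q = S.lab q) ↔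
        ∀ q, ¬ Touches S.state c q → W.lab q = S.lab q := by
      refine forall_congr' fun q => imp_congr_right fun hq => ?_
      rw [set_lab, if_neg]
      intro h
      exact hq ((touches_iff hagree q).2 ((Touches.congr h).2 hp'))
    have e2 : (∀ q, ¬ Touches S.state c q → W.lab q = (S.set p false).lab q) ↔
        ∀ q, ¬ Touches S.state c q → W.lab q = S.lab q := by
      refine forall_congr' fun q => imp_congr_right fun hq => ?_
      rw [set_lab, if_neg]
      intro h
      exact hq ((Touches.congr h).2 hp)
    rw [e1] at i1
    rw [e2] at i2
    by_cases hl : ∀ q, ¬ Touches S.state c q → W.lab q = S.lab q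
    swap
    · rw [edgeCoeff_of_not (mt i1.1 hl), edgeCoeff_of_not (mt i2.1 hl)]; simp
    have j1 := i1.2 hl
    have j2 := i2.2 hl
    by_cases hsp : D.circle S.state (corner c 0) = D.circle S.state (corner c 2)
    · -- split
      have hsp' := hms.1 hsp
      have hpS : D.circle S.state p = D.circle S.state (corner c 0) := by
        rcases hp with h | h
        · exact h
        · rw [h, hsp]
      rw [edgeCoeff_of_split j1 hsp, edgeCoeff_of_split j2 hsp]
      simp only [set_lab, hpS, hsp, if_true, S.lab_congr hpS]
      rcases hp' with h | h
      · simp only [h, W.lab_congr h, if_true, if_neg (Ne.symm hsp')]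
        cases S.lab (corner c 0) <;> cases W.lab (corner c 0) <;> cases W.lab (corner c 2) <;>
          simp [comulCoeff]
      · simp only [h, W.lab_congr h, if_true, if_neg hsp']
        cases S.lab (corner c 0) <;> cases W.lab (corner c 0) <;> cases W.lab (corner c 2) <;>
          simp [comulCoeff]
    · -- merge
      have hsp' : D.circle W.state (corner c 0) = D.circle W.state (corner c 2) := by
        by_contra h; exact hsp (hms.2 h)
      have hpW : D.circle W.state p = D.circle W.state (corner c 0) := by
        rcases hp' with h | h
        · exact h
        · rw [h, hsp']
      rw [edgeCoeff_of_merge j1 hsp, edgeCoeff_of_merge j2 hsp]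
      simp only [set_lab, hpW, if_true, W.lab_congr hpW]
      rcases hp with h | h
      · simp only [h, S.lab_congr h, if_true, if_neg (Ne.symm hsp)]
        cases S.lab (corner c 0) <;> cases S.lab (corner c 2) <;> cases W.lab (corner c 0) <;>
          simp [mulCoeff]
      · simp only [h, S.lab_congr h, if_true, if_neg hsp]
        cases S.lab (corner c 0) <;> cases S.lab (corner c 2) <;> cases W.lab (corner c 0) <;>
          simp [mulCoeff]
  · -- the circle through `p` does not pass by `c`
    have hne : ∀ i, ¬ D.circle S.state (corner c i) = D.circle S.state p := fun i h =>
      hp ((Touches.congr h).1 (touches_corner _ _ _))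
    have hne' : ∀ i, ¬ D.circle W.state (corner c i) = D.circle W.state p := fun i h =>
      hp ((touches_iff hagree p).2 ((Touches.congr h).1 (touches_corner _ _ _)))
    have hcirc : ∀ q, D.circle W.state q = D.circle W.state p ↔
        D.circle S.state q = D.circle S.state p := by
      intro q
      rw [eq_comm, ← circle_iff hagree hp, eq_comm]
    have key : (W.lab p = false ∧
        ∀ q, ¬ Touches S.state c q → (W.set p true).lab q = S.lab q) ↔
        (S.lab p = true ∧ ∀ q, ¬ Touches S.state c q → W.lab q = (S.set p false).lab q) := by
      constructor
      · rintro ⟨h1, h2⟩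
        refine ⟨?_, fun q hq => ?_⟩
        · rw [← h2 p hp, set_lab_self]
        · rw [set_lab]
          split_ifs with h
          · rw [W.lab_congr ((hcirc q).2 h), h1]
          · rw [← h2 q hq, set_lab, if_neg (mt (hcirc q).1 h)]
      · rintro ⟨h1, h2⟩
        refine ⟨?_, fun q hq => ?_⟩
        · rw [h2 p hp, set_lab_self]
        · rw [set_lab]
          split_ifs with h
          · rw [S.lab_congr ((hcirc q).1 h), h1]
          · rw [h2 q hq, set_lab, if_neg (mt (hcirc q).2 h)]
    rw [← i1, ← i2] at key
    by_cases hk : W.lab p = false ∧ IsEdge c S (W.set p true)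
    · obtain ⟨k1, k2⟩ := hk
      obtain ⟨k3, k4⟩ := key.1 ⟨k1, k2⟩
      rw [if_pos k1, if_pos k3]
      by_cases hsp : D.circle S.state (corner c 0) = D.circle S.state (corner c 2)
      · rw [edgeCoeff_of_split k2 hsp, edgeCoeff_of_split k4 hsp]
        simp only [set_lab, if_neg (hne _), if_neg (hne' _)]
      · rw [edgeCoeff_of_merge k2 hsp, edgeCoeff_of_merge k4 hsp]
        simp only [set_lab, if_neg (hne _), if_neg (hne' _)]
    · have hk' := mt key.2 hk
      have l1 : (if W.lab p = false then edgeCoeff c S (W.set p true) else 0) = 0 := by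
        split_ifs with h
        · exact edgeCoeff_of_not fun h' => hk ⟨h, h'⟩
        · rfl
      have l2 : (if S.lab p = true then edgeCoeff c (S.set p false) W else 0) = 0 := by
        split_ifs with h
        · exact edgeCoeff_of_not fun h' => hk' ⟨h, h'⟩
        · rfl
      rw [l1, l2]

open Classical in
/-- Multiplication by `v₋` at the point `p`, as a matrix. -/
noncomputable def pointMatrix (p : D.End) : Matrix D.EnhancedState D.EnhancedState ℤ :=
  fun S T => if S.lab p = true ∧ T = S.set p false then 1 else 0

/-- The map of an edge of the cube, as a matrix. -/
noncomputable def edgeMatrix (c : D.Crossing) : Matrix D.EnhancedState D.EnhancedState ℤ :=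
  fun S T => edgeCoeff c S T

theorem pointMatrix_mul (p : D.End) (N : Matrix D.EnhancedState D.EnhancedState ℤ)
    (S W : D.EnhancedState) :
    (pointMatrix p * N) S W = if S.lab p = true then N (S.set p false) W else 0 := by
  classical
  rw [Matrix.mul_apply]
  by_cases h : S.lab p = true
  · simp [pointMatrix, h]
  · simp [pointMatrix, h]

theorem mul_pointMatrix (p : D.End) (N : Matrix D.EnhancedState D.EnhancedState ℤ)
    (S W : D.EnhancedState) :
    (N * pointMatrix p) S W = if W.lab p = false then N S (W.set p true) else 0 := by
  classical
  have h : ∀ T : D.EnhancedState, (T.lab p = true ∧ W = T.set p false) ↔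
      (W.lab p = false ∧ T = W.set p true) := by
    intro T
    constructor
    · rintro ⟨h, rfl⟩
      refine ⟨set_lab_self _ _ _, ?_⟩
      rw [set_set, ← h, set_eq_self]
    · rintro ⟨h, rfl⟩
      refine ⟨set_lab_self _ _ _, ?_⟩
      rw [set_set, ← h, set_eq_self]
  rw [Matrix.mul_apply]
  simp only [pointMatrix, h]
  by_cases h : W.lab p = false
  · simp [h]
  · simp [h]

theorem edgeMatrix_comm_point (hD : D.IsCheckerboard) (c : D.Crossing) (p : D.End) :
    edgeMatrix c * pointMatrix p = pointMatrix p * edgeMatrix c := by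
  ext S W
  rw [mul_pointMatrix, pointMatrix_mul]
  exact edgeCoeff_set hD c p S W

/-- Matrices that commute with the multiplications by `v₋` are determined by the rows of the
states in which all signs are `v₊`. -/
theorem matrix_ext {A B : Matrix D.EnhancedState D.EnhancedState ℤ}
    (hA : ∀ p, A * pointMatrix p = pointMatrix p * A)
    (hB : ∀ p, B * pointMatrix p = pointMatrix p * B)
    (h : ∀ s W, A (one s) W = B (one s) W) : A = B := by
  classical
  have main : ∀ n, ∀ S : D.EnhancedState,
      (Finset.univ.filter fun p => S.lab p = false).card = n → ∀ W, A S W = B S W := by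
    intro n
    induction n using Nat.strong_induction_on with
    | _ n ih =>
      intro S hS W
      by_cases hall : ∀ p, S.lab p = true
      · have : S = one S.state := ext_lab rfl hall
        rw [this]; exact h _ _
      · push Not at hall
        obtain ⟨p, hp⟩ := hall
        have hp : S.lab p = false := by simpa using hp
        have hlt : (Finset.univ.filter fun q => (S.set p true).lab q = false).card < n := by
          rw [← hS]
          apply Finset.card_lt_card
          rw [Finset.ssubset_iff_of_subset]
          · exact ⟨p, by simp [hp], by simp [set_lab_self]⟩
          · intro q
            simp only [Finset.mem_filter, Finset.mem_univ, true_and, set_lab]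
            split_ifs <;> simp
        have hset : (S.set p true).set p false = S := by rw [set_set, ← hp, set_eq_self]
        have row : ∀ M : Matrix D.EnhancedState D.EnhancedState ℤ,
            M * pointMatrix p = pointMatrix p * M →
            M S W = if W.lab p = false then M (S.set p true) (W.set p true) else 0 := by
          intro M hM
          have := congrFun (congrFun hM (S.set p true)) W
          rw [mul_pointMatrix, pointMatrix_mul, hset, set_lab_self, if_pos rfl] at this
          exact this.symm
        rw [row A (hA p), row B (hB p), ih _ hlt (S.set p true) rfl]
  ext S W
  exact main _ S rfl W

open Classical in
/-- The matrix by which an edge map is described on the states with all signs `v₊`. -/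
noncomputable def edgeFactor (b : Prop) (c : D.Crossing) :
    Matrix D.EnhancedState D.EnhancedState ℤ :=
  if b then pointMatrix (corner c 0) + pointMatrix (corner c 2) else 1

theorem edgeMatrix_one (hD : D.IsCheckerboard) {c : D.Crossing} {s : D.State} (hs : s c = false)
    (W : D.EnhancedState) :
    edgeMatrix c (one s) W =
      edgeFactor (D.circle s (corner c 0) = D.circle s (corner c 2)) c (one (s.flip c)) W := by
  classical
  have hagree : ∀ x, x ≠ c → s x = s.flip c x := flip_agree _ _
  have hms := merge_or_split hD hs
  by_cases hW : W.state = s.flip c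
  swap
  · have h1 : edgeMatrix c (one s) W = 0 := edgeCoeff_of_not fun h => hW h.2.1
    have h2 : one (s.flip c) ≠ W := by rintro rfl; exact hW rfl
    have h3 : ∀ p, W ≠ (one (s.flip c)).set p false := by rintro p rfl; exact hW rfl
    rw [h1]
    unfold edgeFactor
    split_ifs
    · simp [pointMatrix, Matrix.add_apply, h3]
    · rw [Matrix.one_apply, if_neg h2]
  have hW1 : ∀ p, Touches s c p ↔ (D.circle W.state p = D.circle W.state (corner c 0) ∨
      D.circle W.state p = D.circle W.state (corner c 2)) := by
    intro p; rw [touches_iff hagree, hW]; rfl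
  have hedge : IsEdge c (one s) W ↔ ∀ p, ¬ Touches s c p → W.lab p = true :=
    ⟨fun h => h.2.2, fun h => ⟨hs, hW, h⟩⟩
  unfold edgeMatrix edgeFactor
  by_cases hsp : D.circle s (corner c 0) = D.circle s (corner c 2)
  · have hne : ¬ D.circle W.state (corner c 0) = D.circle W.state (corner c 2) := by
      rw [hW]; exact hms.1 hsp
    simp only [if_pos hsp, Matrix.add_apply, pointMatrix, one_lab, true_and]
    have hiff : ∀ i j : Fin 4, (i = 0 ∧ j = 2 ∨ i = 2 ∧ j = 0) →
        (W = (one (s.flip c)).set (corner c i) false ↔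
        ((∀ p, ¬ Touches s c p → W.lab p = true) ∧
          W.lab (corner c i) = false ∧ W.lab (corner c j) = true)) := by
      intro i j hij
      have hne' : ¬ D.circle W.state (corner c j) = D.circle W.state (corner c i) := by
        rcases hij with ⟨rfl, rfl⟩ | ⟨rfl, rfl⟩
        · exact fun h => hne h.symm
        · exact hne
      constructor
      · intro h
        have hl : ∀ p, W.lab p =
            if D.circle W.state p = D.circle W.state (corner c i) then false else true := by
          intro p
          conv_lhs => rw [h]
          rw [set_lab, one_lab, one_state, hW]
        refine ⟨fun p hp => ?_, ?_, ?_⟩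
        · rw [hl, if_neg]
          intro h'
          apply hp
          rw [hW1]
          rcases hij with ⟨rfl, rfl⟩ | ⟨rfl, rfl⟩
          · exact Or.inl h'
          · exact Or.inr h'
        · rw [hl, if_pos rfl]
        · rw [hl, if_neg hne']
      · rintro ⟨h1, h2, h3⟩
        refine ext_lab hW fun p => ?_
        rw [set_lab, one_lab, one_state, ← hW]
        split_ifs with h
        · rw [W.lab_congr h, h2]
        · by_cases hp : Touches s c p
          · have : D.circle W.state p = D.circle W.state (corner c j) := by
              rw [hW1] at hp
              rcases hij with ⟨rfl, rfl⟩ | ⟨rfl, rfl⟩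
              · exact hp.resolve_left h
              · exact hp.resolve_right h
            rw [W.lab_congr this, h3]
          · exact h1 p hp
    rw [if_congr (hiff 0 2 (by simp)) rfl rfl, if_congr (hiff 2 0 (by simp)) rfl rfl]
    by_cases hl : ∀ p, ¬ Touches s c p → W.lab p = true
    · rw [edgeCoeff_of_split (hedge.2 hl) hsp]
      simp only [eq_true hl, true_and, one_lab]
      cases W.lab (corner c 0) <;> cases W.lab (corner c 2) <;> simp [comulCoeff]
    · rw [edgeCoeff_of_not (mt hedge.1 hl)]
      simp only [eq_false hl, false_and, if_false, add_zero]
  · have heq : D.circle W.state (corner c 0) = D.circle W.state (corner c 2) := by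
      rw [hW]; by_contra h; exact hsp (hms.2 h)
    simp only [if_neg hsp, Matrix.one_apply]
    have hiff : one (s.flip c) = W ↔
        ((∀ p, ¬ Touches s c p → W.lab p = true) ∧ W.lab (corner c 0) = true) := by
      constructor
      · rintro rfl; simp
      · rintro ⟨h1, h2⟩
        refine ext_lab hW.symm fun p => ?_
        rw [one_lab]
        by_cases hp : Touches s c p
        · have : D.circle W.state p = D.circle W.state (corner c 0) := by
            rw [hW1, ← heq, or_self] at hp; exact hp
          rw [W.lab_congr this, h2]
        · exact (h1 p hp).symm
    rw [if_congr hiff rfl rfl]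
    by_cases hl : ∀ p, ¬ Touches s c p → W.lab p = true
    · rw [edgeCoeff_of_merge (hedge.2 hl) hsp]
      simp only [eq_true hl, true_and, one_lab]
      cases W.lab (corner c 0) <;> simp [mulCoeff]
    · rw [edgeCoeff_of_not (mt hedge.1 hl)]
      simp only [eq_false hl, false_and, if_false]

theorem edgeFactor_comm {b : Prop} {c : D.Crossing}
    {M : Matrix D.EnhancedState D.EnhancedState ℤ}
    (hM : ∀ p, M * pointMatrix p = pointMatrix p * M) :
    edgeFactor b c * M = M * edgeFactor b c := by
  unfold edgeFactor
  split_ifs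
  · rw [add_mul, mul_add, hM, hM]
  · simp

theorem pointMatrix_comm (p q : D.End) :
    (pointMatrix p * pointMatrix q : Matrix D.EnhancedState D.EnhancedState ℤ)
      = pointMatrix q * pointMatrix p := by
  classical
  ext S W
  rw [pointMatrix_mul, pointMatrix_mul]
  simp only [pointMatrix, set_lab]
  by_cases h : D.circle S.state p = D.circle S.state q
  · simp [h]
  · have hset : (S.set p false).set q false = (S.set q false).set p false := by
      refine ext_lab rfl fun r => ?_
      simp only [set_lab, set_state]
      split_ifs <;> rfl
    simp only [if_neg h, if_neg (Ne.symm h), hset, ← ite_and]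
    congr 1
    apply propext
    tauto

theorem pointMatrix_congr {S : D.EnhancedState} {p q : D.End}
    (h : D.circle S.state p = D.circle S.state q) (W : D.EnhancedState) :
    pointMatrix p S W = pointMatrix q S W := by
  unfold pointMatrix
  rw [S.lab_congr h, S.set_congr h]

theorem card_circle_flip (hD : D.IsCheckerboard) {c : D.Crossing} {s : D.State}
    (hs : s c = false) :
    (D.circle s (corner c 0) = D.circle s (corner c 2) →
      Fintype.card (D.Circle (s.flip c)) = Fintype.card (D.Circle s) + 1) ∧
    (¬ D.circle s (corner c 0) = D.circle s (corner c 2) →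
      Fintype.card (D.Circle (s.flip c)) + 1 = Fintype.card (D.Circle s)) := by
  have h := sum_circle hD (fun _ => 1) (S := one s) (T := one (s.flip c)) hs rfl
    (fun _ _ => rfl)
  have hone : ∀ t : D.State, ∑ _k : D.Circle (one t).state, (1 : ℤ) = Fintype.card (D.Circle t) := by
    intro t
    exact (by simp : ∑ _k : D.Circle t, (1 : ℤ) = Fintype.card (D.Circle t))
  rw [hone, hone] at h
  refine ⟨fun h' => ?_, fun h' => ?_⟩
  · have := h.1 h'
    omega
  · have := h.2 h'
    omega

/-- The faces of the cube commute (before the signs are introduced). -/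
theorem edgeMatrix_comm (hD : D.IsCheckerboard) (c d : D.Crossing) :
    (edgeMatrix c * edgeMatrix d : Matrix D.EnhancedState D.EnhancedState ℤ)
      = edgeMatrix d * edgeMatrix c := by
  classical
  by_cases hcd : c = d
  · rw [hcd]
  have hcomm : ∀ (x y : D.Crossing) (p : D.End),
      (edgeMatrix x * edgeMatrix y : Matrix D.EnhancedState D.EnhancedState ℤ) * pointMatrix p
        = pointMatrix p * (edgeMatrix x * edgeMatrix y) := by
    intro x y p
    rw [mul_assoc, edgeMatrix_comm_point hD, ← mul_assoc, edgeMatrix_comm_point hD, mul_assoc]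
  refine matrix_ext (hcomm c d) (hcomm d c) fun s W => ?_
  -- the row of `one s`
  have hrow : ∀ (x y : D.Crossing), x ≠ y → s x = false → s y = false →
      (edgeMatrix x * edgeMatrix y) (one s) W =
        (edgeFactor (D.circle (s.flip x) (corner y 0) = D.circle (s.flip x) (corner y 2)) y *
          edgeFactor (D.circle s (corner x 0) = D.circle s (corner x 2)) x)
            (one ((s.flip x).flip y)) W := by
    intro x y hxy hx hy
    have hy' : s.flip x y = false := by rw [flip_ne s (Ne.symm hxy), hy]
    rw [Matrix.mul_apply]
    simp only [edgeMatrix_one hD hx]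
    rw [← Matrix.mul_apply, edgeFactor_comm (edgeMatrix_comm_point hD y), Matrix.mul_apply]
    simp only [edgeMatrix_one hD hy']
    rw [← Matrix.mul_apply]
  have hzero : ∀ (x y : D.Crossing), x ≠ y → (s x = true ∨ s y = true) →
      (edgeMatrix x * edgeMatrix y) (one s) W = 0 := by
    intro x y hxy h
    rw [Matrix.mul_apply]
    refine Finset.sum_eq_zero fun T _ => ?_
    by_contra hne
    have h1 := left_ne_zero_of_mul hne
    have h2 := right_ne_zero_of_mul hne
    have h1' : IsEdge x (one s) T := by by_contra h'; exact h1 (edgeCoeff_of_not h')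
    have h2' : IsEdge y T W := by by_contra h'; exact h2 (edgeCoeff_of_not h')
    have e1 : s x = false := h1'.1
    have e2 : T.state = s.flip x := h1'.2.1
    have e3 : T.state y = false := h2'.1
    rw [e2, flip_ne s (Ne.symm hxy)] at e3
    simp [e1, e3] at h
  by_cases hs : s c = false ∧ s d = false
  swap
  · have : s c = true ∨ s d = true := by
      by_contra h; push Not at h; exact hs (by simpa using h)
    rw [hzero c d hcd this, hzero d c (Ne.symm hcd) this.symm]
  obtain ⟨hc, hd⟩ := hs
  have hc' : s.flip d c = false := by rw [flip_ne s hcd, hc]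
  have hd' : s.flip c d = false := by rw [flip_ne s (Ne.symm hcd), hd]
  rw [hrow c d hcd hc hd, hrow d c (Ne.symm hcd) hd hc, flip_comm s d c]
  have k1 := card_circle_flip hD hc
  have k2 := card_circle_flip hD hd'
  have k3 := card_circle_flip hD hd
  have k4 := card_circle_flip hD hc'
  rw [flip_comm s d c] at k4
  have m1 := merge_or_split hD hc
  have m2 := merge_or_split hD hd'
  have m3 := merge_or_split hD hd
  have m4 := merge_or_split hD hc'
  rw [flip_comm s d c] at m4
  have a1 := flip_agree s c
  have a2 := flip_agree (s.flip c) d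
  -- the facts on the circles through `d` which do not pass by `c`
  have t1 : ∀ p q, ¬ Touches s c p →
      (D.circle s p = D.circle s q ↔ D.circle (s.flip c) p = D.circle (s.flip c) q) :=
    fun p q hp => circle_iff a1 hp
  have t1' : ∀ p, Touches s c p → Touches (s.flip c) c p := fun p => touches_change a1
  have t2' : ∀ p, Touches (s.flip c) d p → Touches ((s.flip c).flip d) d p :=
    fun p => touches_change a2
  set u := (s.flip c).flip d with hu
  by_cases A : D.circle s (corner c 0) = D.circle s (corner c 2) <;>
  by_cases B : D.circle (s.flip c) (corner d 0) = D.circle (s.flip c) (corner d 2) <;>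
  by_cases A' : D.circle s (corner d 0) = D.circle s (corner d 2) <;>
  by_cases B' : D.circle (s.flip d) (corner c 0) = D.circle (s.flip d) (corner c 2) <;>
  simp only [A, B, A', B', edgeFactor, if_true, if_false, forall_const, not_true, not_false_iff,
    IsEmpty.forall_iff, true_and, and_true, true_iff, false_iff, not_not]
    at k1 k2 k3 k4 m1 m2 m3 m4 ⊢
  all_goals try omega
  · -- all four maps are splits
    rw [add_mul, mul_add, mul_add, add_mul, mul_add, mul_add]
    simp only [pointMatrix_comm (corner d _) (corner c _), Matrix.add_apply]
    ring
  · -- the first map splits, the second one merges, in both orders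
    have hd0 : Touches s c (corner d 0) := by
      by_contra h; exact B ((t1 _ _ h).1 A')
    have e : D.circle u (corner c 0) = D.circle u (corner d 0) := by
      rcases t1' _ hd0 with h | h
      · rcases t2' (corner c 0) (Or.inl h.symm) with h | h
        · exact h
        · rw [h, m2]
      · rw [m4]
        rcases t2' (corner c 2) (Or.inl h.symm) with h | h
        · exact h
        · rw [h, m2]
    rw [one_mul, one_mul, Matrix.add_apply, Matrix.add_apply,
      pointMatrix_congr (S := one u) (p := corner c 2) (q := corner c 0) m4.symm,
      pointMatrix_congr (S := one u) (p := corner d 2) (q := corner d 0) m2.symm,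
      pointMatrix_congr (S := one u) (p := corner c 0) (q := corner d 0) e]
  · rw [one_mul, mul_one]
  · rw [one_mul, mul_one]
  · -- the first map merges, the second one splits, in both orders
    have hd0 : Touches s c (corner d 0) := by
      by_contra h; exact A' ((t1 _ _ h).2 B)
    have h0 : D.circle (s.flip c) (corner c 0) = D.circle (s.flip c) (corner d 0) := by
      rcases t1' _ hd0 with h | h
      · exact h.symm
      · rw [m1, h]
    have e0 := t2' (corner c 0) (Or.inl h0)
    have e2 := t2' (corner c 2) (Or.inl (m1.symm.trans h0))
    rw [mul_one, mul_one, Matrix.add_apply, Matrix.add_apply]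
    rcases e0 with e0 | e0 <;> rcases e2 with e2 | e2
    · exact absurd (e0.trans e2.symm) m4
    · rw [pointMatrix_congr (S := one u) (p := corner c 0) (q := corner d 0) e0,
        pointMatrix_congr (S := one u) (p := corner c 2) (q := corner d 2) e2]
    · rw [pointMatrix_congr (S := one u) (p := corner c 0) (q := corner d 2) e0,
        pointMatrix_congr (S := one u) (p := corner c 2) (q := corner d 0) e2, add_comm]
    · exact absurd (e0.trans e2.symm) m4

theorem edgeSign_flip (s : D.State) {c d : D.Crossing} (hc : s c = false) :
    edgeSign d (s.flip c) = (if D.num c < D.num d then -1 else 1) * edgeSign d s := by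
  classical
  unfold edgeSign
  rw [Fintype.card_subtype, Fintype.card_subtype]
  split_ifs with h
  · have : Finset.univ.filter (fun x => D.num x < D.num d ∧ s.flip c x = true)
        = insert c (Finset.univ.filter (fun x => D.num x < D.num d ∧ s x = true)) := by
      ext x
      simp only [Finset.mem_filter, Finset.mem_univ, true_and, Finset.mem_insert]
      by_cases hx : x = c
      · simp [hx, flip_same, h]
      · simp [flip_ne _ hx, hx]
    rw [this, Finset.card_insert_of_notMem (by simp [hc]), pow_succ]
    ring
  · have : Finset.univ.filter (fun x => D.num x < D.num d ∧ s.flip c x = true)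
        = Finset.univ.filter (fun x => D.num x < D.num d ∧ s x = true) := by
      ext x
      simp only [Finset.mem_filter, Finset.mem_univ, true_and]
      by_cases hx : x = c
      · simp [hx, h]
      · simp [flip_ne _ hx]
    rw [this, one_mul]

/-- The differential has square zero. -/
theorem sum_incidence_mul (hD : D.IsCheckerboard) (S W : D.EnhancedState) :
    ∑ T, incidence S T * incidence T W = 0 := by
  classical
  let g : D.Crossing → D.Crossing → ℤ := fun c d =>
    ∑ T, (edgeSign c S.state * edgeCoeff c S T) * (edgeSign d T.state * edgeCoeff d T W)
  have hg : ∀ c d, g c d = if S.state c = false then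
      edgeSign c S.state * ((if D.num c < D.num d then -1 else 1) * edgeSign d S.state) *
        (edgeMatrix c * edgeMatrix d) S W else 0 := by
    intro c d
    by_cases hc : S.state c = false
    · rw [if_pos hc, Matrix.mul_apply, Finset.mul_sum]
      refine Finset.sum_congr rfl fun T _ => ?_
      by_cases h : IsEdge c S T
      · rw [h.2.1, edgeSign_flip _ hc]; simp only [edgeMatrix]; ring
      · simp only [edgeMatrix, edgeCoeff_of_not h]; ring
    · rw [if_neg hc]
      refine Finset.sum_eq_zero fun T _ => ?_
      rw [edgeCoeff_of_not fun h => hc h.1]; ring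
  have hdiag : ∀ c d : D.Crossing, S.state d = true →
      (edgeMatrix c * edgeMatrix d : Matrix D.EnhancedState D.EnhancedState ℤ) S W = 0 := by
    intro c d hd
    rw [edgeMatrix_comm hD, Matrix.mul_apply]
    refine Finset.sum_eq_zero fun T _ => ?_
    have : edgeMatrix d S T = 0 := edgeCoeff_of_not fun h => by
      have := h.1
      rw [hd] at this
      exact absurd this (by simp)
    rw [this, zero_mul]
  have hsame : ∀ c, (edgeMatrix c * edgeMatrix c) S W = 0 := by
    intro c
    rw [Matrix.mul_apply]
    refine Finset.sum_eq_zero fun T _ => ?_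
    by_cases h : IsEdge c S T
    · have : edgeMatrix c T W = 0 := edgeCoeff_of_not fun h' => by
        have := h'.1
        rw [h.2.1, flip_same] at this
        exact absurd this (by simp)
      rw [this, mul_zero]
    · have : edgeMatrix c S T = 0 := edgeCoeff_of_not h
      rw [this, zero_mul]
  have hanti : ∀ c d, g c d = - g d c := by
    intro c d
    rw [hg, hg, edgeMatrix_comm hD d c]
    by_cases hcd : c = d
    · subst hcd; simp [hsame]
    have hnum : D.num c ≠ D.num d := fun h => hcd (D.num_injective h)
    by_cases hc : S.state c = false <;> by_cases hd : S.state d = false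
    · rw [if_pos hc, if_pos hd]
      rcases lt_or_gt_of_ne hnum with h | h
      · rw [if_pos h, if_neg (by omega)]; ring
      · rw [if_neg (by omega), if_pos h]; ring
    · have hd : S.state d = true := by simpa using hd
      simp [hdiag c d hd, hd]
    · have hc : S.state c = true := by simpa using hc
      have := hdiag d c hc
      rw [edgeMatrix_comm hD] at this
      simp [this, hc]
    · simp [hc, hd]
  have htotal : ∑ T, incidence S T * incidence T W = ∑ c, ∑ d, g c d := by
    simp only [incidence, g, Finset.sum_mul_sum]
    rw [Finset.sum_comm]
    refine Finset.sum_congr rfl fun c _ => ?_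
    rw [Finset.sum_comm]
  have hneg : ∑ c, ∑ d, g c d = - ∑ c, ∑ d, g c d := by
    conv_lhs => rw [Finset.sum_comm]
    simp only [← Finset.sum_neg_distrib]
    exact Finset.sum_congr rfl fun c _ => Finset.sum_congr rfl fun d _ => hanti d c
  rw [htotal]
  omega

/-- The enhanced states of bidegree `(i, j)`. -/
abbrev GradedState (D : Diagram) (i j : ℤ) : Type :=
  {S : D.EnhancedState // S.homDegree = i ∧ S.qDegree = j}

noncomputable instance (i j : ℤ) : Fintype (D.GradedState i j) :=
  @Fintype.ofFinite _ (Subtype.finite)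

/-- The differential of the Khovanov complex: an enhanced state `S` is mapped to
`∑ T, incidence S T • T`. -/
noncomputable def differential (D : Diagram) (i i' j : ℤ) :
    (D.GradedState i j →₀ ℤ) →ₗ[ℤ] (D.GradedState i' j →₀ ℤ) :=
  Finsupp.linearCombination ℤ fun S : D.GradedState i j =>
    Finsupp.equivFunOnFinite.symm fun T : D.GradedState i' j => incidence S.1 T.1

theorem differential_single {i i' j : ℤ} (S : D.GradedState i j) (T : D.GradedState i' j) :
    D.differential i i' j (Finsupp.single S 1) T = incidence S.1 T.1 := by
  simp [differential]

theorem differential_shape (hD : D.IsCheckerboard) {i i' : ℤ} (j : ℤ) (h : i + 1 ≠ i') :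
    D.differential i i' j = 0 := by
  refine Finsupp.lhom_ext' fun S => LinearMap.ext_ring ?_
  ext T
  rw [LinearMap.comp_apply, Finsupp.lsingle_apply, differential_single]
  by_contra hne
  apply h
  rw [← S.2.1, ← T.2.1]
  exact (incidence_degree hD hne).1.symm

theorem differential_comp (hD : D.IsCheckerboard) {i i' i'' : ℤ} (j : ℤ) (h : i + 1 = i') :
    D.differential i' i'' j ∘ₗ D.differential i i' j = 0 := by
  classical
  refine Finsupp.lhom_ext' fun S => LinearMap.ext_ring ?_
  ext W
  rw [LinearMap.comp_apply, LinearMap.comp_apply, Finsupp.lsingle_apply]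
  have h1 : D.differential i i' j (Finsupp.single S 1) =
      ∑ T : D.GradedState i' j, incidence S.1 T.1 • Finsupp.single T (1 : ℤ) := by
    ext T
    rw [differential_single, Finsupp.finsetSum_apply]
    simp [Finsupp.single_apply]
  rw [h1, map_sum, Finsupp.finsetSum_apply]
  simp only [map_smul, Finsupp.smul_apply, differential_single, smul_eq_mul]
  rw [LinearMap.zero_comp, LinearMap.zero_apply, Finsupp.zero_apply,
    ← sum_incidence_mul hD S.1 W.1]
  have hmap : ∑ T : D.GradedState i' j, incidence S.1 T.1 * incidence T.1 W.1 =
      ∑ T ∈ (Finset.univ : Finset (D.GradedState i' j)).map (Function.Embedding.subtype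
        fun T : D.EnhancedState => T.homDegree = i' ∧ T.qDegree = j),
        incidence S.1 T * incidence T W.1 := by
    rw [Finset.sum_map]; rfl
  rw [hmap]
  refine Finset.sum_subset (Finset.subset_univ _) fun T _ hT => ?_
  by_contra hne
  have := incidence_degree hD (left_ne_zero_of_mul hne)
  apply hT
  rw [Finset.mem_map]
  exact ⟨⟨T, by rw [this.1, S.2.1, h], by rw [this.2, S.2.2]⟩, Finset.mem_univ _, rfl⟩

end Diagram

/-! ### Bigraded complexes -/

/-- A bigraded complex with a differential of bidegree `(1, 0)`: a cochain complex of abelian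
groups for each secondary degree. -/
abbrev BigradedComplex : Type 1 := ℤ → CochainComplex (ModuleCat.{0} ℤ) ℤ

/-- A bigraded abelian group. -/
abbrev BigradedModule : Type 1 := ℤ → ℤ → ModuleCat.{0} ℤ

namespace BigradedComplex

/-- `(C[m]{n})^{i,j} = C^{i-m,j-n}`. -/
def shift (C : BigradedComplex) (m n : ℤ) : BigradedComplex := fun j =>
  { X := fun i => (C (j - n)).X (i - m)
    d := fun i i' => (C (j - n)).d (i - m) (i' - m)
    shape := fun i i' h => (C (j - n)).shape _ _ fun h' => h (by
      simp only [ComplexShape.up_Rel] at h' ⊢; omega)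
    d_comp_d' := fun i i' i'' _ _ => (C (j - n)).d_comp_d _ _ _ }

/-- The direct sum. -/
noncomputable def directSum (C C' : BigradedComplex) : BigradedComplex := fun j => C j ⊞ C' j

/-- Chain equivalence by maps and homotopies that preserve the secondary grading. -/
def ChainEquivalent (C C' : BigradedComplex) : Prop :=
  ∀ j, Nonempty (HomotopyEquiv (C j) (C' j))

/-- The homology, with its two gradings. -/
noncomputable def homology (C : BigradedComplex) : BigradedModule := fun i j =>
  (C j).homology i

end BigradedComplex

namespace BigradedModule

/-- `(M[m]{n})^{i,j} = M^{i-m,j-n}`. -/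
def shift (M : BigradedModule) (m n : ℤ) : BigradedModule := fun i j => M (i - m) (j - n)

/-- The direct sum. -/
noncomputable def directSum (M M' : BigradedModule) : BigradedModule := fun i j =>
  M i j ⊞ M' i j

/-- Isomorphism of bigraded abelian groups, preserving both gradings. -/
def Isomorphic (M M' : BigradedModule) : Prop := ∀ i j, Nonempty (M i j ≅ M' i j)

end BigradedModule

namespace Diagram

/-- The Khovanov complex of a diagram with a chessboard colouring. -/
noncomputable def khovanovComplex (D : Diagram) (hD : D.IsCheckerboard) : BigradedComplex :=
  fun j =>
    { X := fun i => ModuleCat.of ℤ (D.GradedState i j →₀ ℤ)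
      d := fun i i' => ModuleCat.ofHom (D.differential i i' j)
      shape := fun i i' h => by
        rw [differential_shape hD j h]; rfl
      d_comp_d' := fun i i' i'' h _ => by
        rw [← ModuleCat.ofHom_comp, differential_comp hD j h]; rfl }

/-- Khovanov homology. -/
noncomputable def khovanovHomology (D : Diagram) (hD : D.IsCheckerboard) : BigradedModule :=
  (D.khovanovComplex hD).homology

end Diagram

/-! ### Planar diagrams have chessboard colourings -/

/-- The functions with values in `ZMod 2` which are constant on the classes of a setoid. -/
def invariants {α : Type} (r : Setoid α) : Submodule (ZMod 2) (α → ZMod 2) :=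
  LinearMap.range (LinearMap.funLeft (ZMod 2) (ZMod 2) (Quotient.mk r))

theorem mem_invariants {α : Type} {r : Setoid α} {g : α → ZMod 2} :
    g ∈ invariants r ↔ ∀ p q, r p q → g p = g q := by
  constructor
  · rintro ⟨f, rfl⟩ p q h
    exact congrArg f (Quotient.sound h)
  · intro h
    exact ⟨fun k => Quotient.lift g h k, rfl⟩

theorem mem_invariants_eqvGen {α : Type} {r : α → α → Prop} {g : α → ZMod 2} :
    g ∈ invariants (Relation.EqvGen.setoid r) ↔ ∀ p q, r p q → g p = g q := by
  rw [mem_invariants]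
  constructor
  · exact fun h p q hpq => h p q (Relation.EqvGen.rel _ _ hpq)
  · intro h p q hpq
    have hpq' : Relation.EqvGen r p q := hpq
    induction hpq' with
    | rel a b hab => exact h a b hab
    | refl a => rfl
    | symm a b hab ih => exact (ih hab).symm
    | trans a b c hab hbc ih₁ ih₂ => exact (ih₁ hab).trans (ih₂ hbc)

theorem finrank_invariants {α : Type} [Finite α] (r : Setoid α) :
    Module.finrank (ZMod 2) (invariants r) = Nat.card (Quotient r) := by
  have : Finite (Quotient r) := Quotient.finite r
  have := Fintype.ofFinite (Quotient r)
  unfold invariants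
  rw [LinearMap.finrank_range_of_inj, Module.finrank_fintype_fun_eq_card, Nat.card_eq_fintype_card]
  exact LinearMap.funLeft_injective_of_surjective _ _ _ Quotient.exists_rep

namespace Diagram

variable {D : Diagram}

theorem rotate_bijective : Function.Bijective D.rotate := by
  apply Function.Injective.bijective_of_finite
  rintro (⟨c, i⟩ | ⟨c, i⟩) (⟨d, j⟩ | ⟨d, j⟩) h <;> simp_all [rotate]

theorem IsPlanar.isCheckerboard (hD : D.IsPlanar) : D.IsCheckerboard := by
  classical
  have hz : ∀ x y : ZMod 2, x + y = 0 → x = y := by decide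
  have hz2 : ∀ x : ZMod 2, x + x = 0 := by decide
  -- the coboundary of a function on the faces
  have hmem : ∀ f : D.End → ZMod 2, f + f ∘ D.edge ∈ invariants D.arcSetoid := by
    intro f
    refine mem_invariants_eqvGen.2 ?_
    rintro p q rfl
    simp only [Pi.add_apply, Function.comp_apply, D.edge_edge, add_comm]
  let δ : invariants D.faceSetoid →ₗ[ZMod 2] invariants D.arcSetoid :=
    { toFun := fun f => ⟨f.1 + f.1 ∘ D.edge, hmem f.1⟩
      map_add' := fun f g => by
        apply Subtype.ext; funext p
        simp only [Submodule.coe_add, Pi.add_apply, Function.comp_apply]; ring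
      map_smul' := fun a f => by
        apply Subtype.ext; funext p
        simp only [Submodule.coe_smul, Pi.add_apply, Function.comp_apply, Pi.smul_apply,
          smul_eq_mul, RingHom.id_apply]; ring }
  -- the pairing of functions on the arcs and functions on the vertices
  let Φ : invariants D.arcSetoid →ₗ[ZMod 2] Module.Dual (ZMod 2) (invariants D.vertexSetoid) :=
    LinearMap.mk₂ (ZMod 2) (fun g h => ∑ p, g.1 p * h.1 p)
      (fun a b h => by simp [add_mul, Finset.sum_add_distrib])
      (fun a b h => by simp only [Submodule.coe_smul, Pi.smul_apply, smul_eq_mul, mul_assoc,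
        Finset.mul_sum])
      (fun a b h => by simp [mul_add, Finset.sum_add_distrib])
      (fun a b h => by simp only [Submodule.coe_smul, Pi.smul_apply, smul_eq_mul, mul_left_comm,
        Finset.mul_sum])
  have hΦ : ∀ g h, Φ g h = ∑ p, g.1 p * h.1 p := fun g h => rfl
  have hface : ∀ f ∈ invariants D.faceSetoid, ∀ p, f (D.rotate (D.edge p)) = f p :=
    fun f hf p => (mem_invariants_eqvGen.1 hf p _ rfl).symm
  have hface' : ∀ f ∈ invariants D.faceSetoid, ∀ p, f (D.edge p) = f (D.rotate p) := by
    intro f hf p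
    rw [← hface f hf (D.edge p), D.edge_edge]
  have hvert : ∀ h ∈ invariants D.vertexSetoid, ∀ p, h (D.rotate p) = h p :=
    fun h hh p => (mem_invariants_eqvGen.1 hh p _ rfl).symm
  have hcomp : ∀ f : D.End → ZMod 2, (∀ p, f (D.edge p) = f p) → (∀ p, f (D.rotate p) = f p) →
      f ∈ invariants D.componentSetoid := by
    intro f h1 h2
    refine mem_invariants_eqvGen.2 ?_
    rintro p q (rfl | rfl)
    · exact (h1 p).symm
    · exact (h2 p).symm
  have hker : Module.finrank (ZMod 2) (LinearMap.ker δ) ≤ Nat.card (Quotient D.componentSetoid) := by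
    rw [← finrank_invariants, ← Submodule.finrank_map_subtype_eq]
    apply Submodule.finrank_mono
    rintro _ ⟨f, hf, rfl⟩
    have h1 : ∀ p, f.1 (D.edge p) = f.1 p := by
      intro p
      have := congrFun (congrArg Subtype.val (LinearMap.mem_ker.1 hf)) p
      exact (hz _ _ this).symm
    refine hcomp _ h1 fun p => ?_
    exact (hface' f.1 f.2 p).symm.trans (h1 p)
  have hrank := Subspace.finrank_add_finrank_dualCoannihilator_eq (LinearMap.range Φ)
  have hco : Module.finrank (ZMod 2) (LinearMap.range Φ).dualCoannihilator
      ≤ Nat.card (Quotient D.componentSetoid) := by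
    rw [← finrank_invariants, ← Submodule.finrank_map_subtype_eq]
    apply Submodule.finrank_mono
    rintro _ ⟨h, hh, rfl⟩
    refine hcomp _ (fun p => ?_) (hvert h.1 h.2)
    let e : D.End → ZMod 2 := Pi.single p 1
    have h1 := (Submodule.mem_dualCoannihilator _).1 hh (Φ ⟨_, hmem e⟩) ⟨_, rfl⟩
    rw [hΦ] at h1
    have h2 : ∀ x, (e + e ∘ D.edge) x * h.1 x
        = (if x = p then h.1 x else 0) + if x = D.edge p then h.1 x else 0 := by
      intro x
      have : D.edge x = p ↔ x = D.edge p :=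
        ⟨fun h => by rw [← h, D.edge_edge], fun h => by rw [h, D.edge_edge]⟩
      simp [e, Pi.single_apply, add_mul, this]
    simp only [h2, Finset.sum_add_distrib, Finset.sum_ite_eq', Finset.mem_univ, if_true] at h1
    exact (hz _ _ h1).symm
  have hle : LinearMap.range δ ≤ LinearMap.ker Φ := by
    rintro _ ⟨f, rfl⟩
    rw [LinearMap.mem_ker]
    ext h
    rw [hΦ, LinearMap.zero_apply]
    have h1 : ∀ p, (δ f).1 p * h.1 p
        = f.1 p * h.1 p + f.1 (D.rotate p) * h.1 (D.rotate p) := by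
      intro p
      rw [hvert h.1 h.2, ← hface' f.1 f.2, ← add_mul]; rfl
    have hrot : Function.Bijective D.rotate := rotate_bijective
    simp only [h1, Finset.sum_add_distrib]
    rw [hrot.sum_comp (fun p => f.1 p * h.1 p)]
    exact hz2 _
  have hd1 := LinearMap.finrank_range_add_finrank_ker δ
  have hd2 := LinearMap.finrank_range_add_finrank_ker Φ
  rw [finrank_invariants] at hd1 hd2 hrank
  unfold IsPlanar at hD
  have heq : LinearMap.range δ = LinearMap.ker Φ :=
    Submodule.eq_of_le_of_finrank_le hle (by omega)
  have hone : (⟨fun _ => 1, mem_invariants.2 fun _ _ _ => rfl⟩ : invariants D.arcSetoid) ∈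
      LinearMap.ker Φ := by
    rw [LinearMap.mem_ker]
    ext h
    rw [hΦ, LinearMap.zero_apply]
    simp only [one_mul]
    rw [Fintype.sum_sum_type, Fintype.sum_prod_type, Fintype.sum_prod_type]
    have hc : ∀ c : D.Crossing, ∑ i : Fin 4, h.1 (Sum.inl (c, i)) = 0 := by
      intro c
      have h1 : h.1 (Sum.inl (c, 1)) = h.1 (Sum.inl (c, 0)) := hvert h.1 h.2 (Sum.inl (c, 0))
      have h2 : h.1 (Sum.inl (c, 2)) = h.1 (Sum.inl (c, 1)) := hvert h.1 h.2 (Sum.inl (c, 1))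
      have h3 : h.1 (Sum.inl (c, 3)) = h.1 (Sum.inl (c, 2)) := hvert h.1 h.2 (Sum.inl (c, 2))
      rw [Fin.sum_univ_four, h3, h2, h1, hz2, zero_add, hz2]
    have hm : ∀ m : D.Mark, ∑ b : Bool, h.1 (Sum.inr (m, b)) = 0 := by
      intro m
      have h1 : h.1 (Sum.inr (m, true)) = h.1 (Sum.inr (m, false)) :=
        hvert h.1 h.2 (Sum.inr (m, false))
      rw [Fintype.sum_bool, h1, hz2]
    simp only [hc, hm, Finset.sum_const_zero, add_zero]
  rw [← heq] at hone
  obtain ⟨f, hf⟩ := hone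
  have hf1 : ∀ p, f.1 p + f.1 (D.edge p) = 1 := fun p => congrFun (congrArg Subtype.val hf) p
  have hz3 : ∀ x y : ZMod 2, x + y = 1 → decide (y = 1) = !(decide (x = 1)) := by decide
  refine ⟨fun p => decide (f.1 p = 1), fun p => ⟨hz3 _ _ (hf1 p), ?_⟩⟩
  have h1 := hf1 p
  rw [hface' f.1 f.2 p] at h1
  exact hz3 _ _ h1

/-! ### Connected sums and the Hopf link -/

variable (D₁ D₂ : Diagram)

/-- The ends of the first diagram in a disjoint union. -/
def inlEnd : D₁.End → Ends (D₁.Crossing ⊕ D₂.Crossing) (D₁.Mark ⊕ D₂.Mark)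
  | Sum.inl (c, i) => Sum.inl (Sum.inl c, i)
  | Sum.inr (m, b) => Sum.inr (Sum.inl m, b)

/-- The ends of the second diagram in a disjoint union. -/
def inrEnd : D₂.End → Ends (D₁.Crossing ⊕ D₂.Crossing) (D₁.Mark ⊕ D₂.Mark)
  | Sum.inl (c, i) => Sum.inl (Sum.inr c, i)
  | Sum.inr (m, b) => Sum.inr (Sum.inr m, b)

/-- The arcs of a disjoint union. -/
def sumEdge : Ends (D₁.Crossing ⊕ D₂.Crossing) (D₁.Mark ⊕ D₂.Mark) →
    Ends (D₁.Crossing ⊕ D₂.Crossing) (D₁.Mark ⊕ D₂.Mark)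
  | Sum.inl (Sum.inl c, i) => inlEnd D₁ D₂ (D₁.edge (Sum.inl (c, i)))
  | Sum.inl (Sum.inr c, i) => inrEnd D₁ D₂ (D₂.edge (Sum.inl (c, i)))
  | Sum.inr (Sum.inl m, b) => inlEnd D₁ D₂ (D₁.edge (Sum.inr (m, b)))
  | Sum.inr (Sum.inr m, b) => inrEnd D₁ D₂ (D₂.edge (Sum.inr (m, b)))

variable {D₁ D₂}

theorem inlEnd_injective : Function.Injective (inlEnd D₁ D₂) := by
  rintro (⟨c, i⟩ | ⟨c, i⟩) (⟨d, j⟩ | ⟨d, j⟩) h <;> simp_all [inlEnd]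

theorem inrEnd_injective : Function.Injective (inrEnd D₁ D₂) := by
  rintro (⟨c, i⟩ | ⟨c, i⟩) (⟨d, j⟩ | ⟨d, j⟩) h <;> simp_all [inrEnd]

theorem end_cases (x : Ends (D₁.Crossing ⊕ D₂.Crossing) (D₁.Mark ⊕ D₂.Mark)) :
    (∃ p, x = inlEnd D₁ D₂ p) ∨ ∃ q, x = inrEnd D₁ D₂ q := by
  rcases x with ⟨c | c, i⟩ | ⟨m | m, b⟩
  · exact Or.inl ⟨Sum.inl (c, i), rfl⟩
  · exact Or.inr ⟨Sum.inl (c, i), rfl⟩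
  · exact Or.inl ⟨Sum.inr (m, b), rfl⟩
  · exact Or.inr ⟨Sum.inr (m, b), rfl⟩

theorem sumEdge_inl (p : D₁.End) :
    sumEdge D₁ D₂ (inlEnd D₁ D₂ p) = inlEnd D₁ D₂ (D₁.edge p) := by
  rcases p with ⟨c, i⟩ | ⟨m, b⟩ <;> rfl

theorem sumEdge_inr (q : D₂.End) :
    sumEdge D₁ D₂ (inrEnd D₁ D₂ q) = inrEnd D₁ D₂ (D₂.edge q) := by
  rcases q with ⟨c, i⟩ | ⟨m, b⟩ <;> rfl

theorem sumEdge_sumEdge (x) : sumEdge D₁ D₂ (sumEdge D₁ D₂ x) = x := by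
  rcases end_cases x with ⟨p, rfl⟩ | ⟨q, rfl⟩
  · rw [sumEdge_inl, sumEdge_inl, D₁.edge_edge]
  · rw [sumEdge_inr, sumEdge_inr, D₂.edge_edge]

theorem sumEdge_ne (x) : sumEdge D₁ D₂ x ≠ x := by
  rcases end_cases x with ⟨p, rfl⟩ | ⟨q, rfl⟩
  · rw [sumEdge_inl]; exact fun h => D₁.edge_ne p (inlEnd_injective h)
  · rw [sumEdge_inr]; exact fun h => D₂.edge_ne q (inrEnd_injective h)

open Classical in
/-- The connected sum of `D₁` and `D₂` along the arc of `D₁` with the ends `p, edge p` and the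
arc of `D₂` with the ends `q, edge q`: these arcs are replaced by an arc which joins `p` and `q`
and an arc which joins `edge p` and `edge q`.  (In the disjoint union, the ends `p` and `edge q`
are exchanged.)  The crossings of `D₁` precede those of `D₂`. -/
noncomputable def connectedSum (D₁ D₂ : Diagram) (p : D₁.End) (q : D₂.End) : Diagram where
  Crossing := D₁.Crossing ⊕ D₂.Crossing
  Mark := D₁.Mark ⊕ D₂.Mark
  num := Sum.elim D₁.num fun c => Finset.univ.sup D₁.num + 1 + D₂.num c
  num_injective := by
    have hlt : ∀ c : D₁.Crossing, D₁.num c < Finset.univ.sup D₁.num + 1 := fun c =>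
      Nat.lt_succ_of_le (Finset.le_sup (f := D₁.num) (Finset.mem_univ c))
    rintro (c | c) (d | d) h
    · exact congrArg Sum.inl (D₁.num_injective h)
    · have := hlt c
      simp only [Sum.elim_inl, Sum.elim_inr] at h
      omega
    · have := hlt d
      simp only [Sum.elim_inl, Sum.elim_inr] at h
      omega
    · simp only [Sum.elim_inr, Nat.add_left_cancel_iff] at h
      exact congrArg Sum.inr (D₂.num_injective h)
  edge x := Equiv.swap (inlEnd D₁ D₂ p) (inrEnd D₁ D₂ (D₂.edge q))
    (sumEdge D₁ D₂ (Equiv.swap (inlEnd D₁ D₂ p) (inrEnd D₁ D₂ (D₂.edge q)) x))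
  edge_edge x := by rw [Equiv.swap_apply_self, sumEdge_sumEdge, Equiv.swap_apply_self]
  edge_ne x h := by
    apply sumEdge_ne (Equiv.swap (inlEnd D₁ D₂ p) (inrEnd D₁ D₂ (D₂.edge q)) x)
    have h' := congrArg (Equiv.swap (inlEnd D₁ D₂ p) (inrEnd D₁ D₂ (D₂.edge q))) h
    rwa [Equiv.swap_apply_self] at h'

theorem IsCheckerboard.connectedSum (h₁ : D₁.IsCheckerboard) (h₂ : D₂.IsCheckerboard)
    (p : D₁.End) (q : D₂.End) : (connectedSum D₁ D₂ p q).IsCheckerboard := by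
  classical
  obtain ⟨o₁, ho₁⟩ := h₁
  obtain ⟨o₂, ho₂, hpq⟩ : ∃ o₂ : D₂.End → Bool,
      (∀ x, o₂ (D₂.edge x) = !(o₂ x) ∧ o₂ (D₂.rotate x) = !(o₂ x)) ∧ o₂ q = !(o₁ p) := by
    obtain ⟨o, ho⟩ := h₂
    by_cases h : o q = !(o₁ p)
    · exact ⟨o, ho, h⟩
    · refine ⟨fun x => !(o x), fun x => ⟨by simp [(ho x).1], by simp [(ho x).2]⟩, ?_⟩
      simpa using h
  let o : Ends (D₁.Crossing ⊕ D₂.Crossing) (D₁.Mark ⊕ D₂.Mark) → Bool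
    | Sum.inl (Sum.inl c, i) => o₁ (Sum.inl (c, i))
    | Sum.inl (Sum.inr c, i) => o₂ (Sum.inl (c, i))
    | Sum.inr (Sum.inl m, b) => o₁ (Sum.inr (m, b))
    | Sum.inr (Sum.inr m, b) => o₂ (Sum.inr (m, b))
  have hl : ∀ x, o (inlEnd D₁ D₂ x) = o₁ x := by
    rintro (⟨c, i⟩ | ⟨m, b⟩) <;> rfl
  have hr : ∀ x, o (inrEnd D₁ D₂ x) = o₂ x := by
    rintro (⟨c, i⟩ | ⟨m, b⟩) <;> rfl
  have hswap : ∀ x, o (Equiv.swap (inlEnd D₁ D₂ p) (inrEnd D₁ D₂ (D₂.edge q)) x) = o x := by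
    intro x
    have : o (inlEnd D₁ D₂ p) = o (inrEnd D₁ D₂ (D₂.edge q)) := by
      rw [hl, hr, (ho₂ q).1, hpq, Bool.not_not]
    rw [Equiv.swap_apply_def]
    split_ifs with h h
    · rw [h, this]
    · rw [h, this]
    · rfl
  refine ⟨o, fun x => ⟨?_, ?_⟩⟩
  · have hs : ∀ y, o (sumEdge D₁ D₂ y) = !(o y) := by
      intro y
      rcases end_cases y with ⟨z, rfl⟩ | ⟨z, rfl⟩
      · rw [sumEdge_inl, hl, hl, (ho₁ z).1]
      · rw [sumEdge_inr, hr, hr, (ho₂ z).1]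
    exact (hswap _).trans ((hs _).trans (congrArg not (hswap x)))
  · rcases x with ⟨c | c, i⟩ | ⟨m | m, b⟩
    · exact (ho₁ (Sum.inl (c, i))).2
    · exact (ho₂ (Sum.inl (c, i))).2
    · exact (ho₁ (Sum.inr (m, b))).2
    · exact (ho₂ (Sum.inr (m, b))).2

/-- The standard diagram of the Hopf link with two crossings, with the planar diagram code
`X[4,1,3,2] X[2,3,1,4]`. -/
def hopf : Diagram where
  Crossing := Fin 2
  Mark := Empty
  num := Fin.val
  num_injective := Fin.val_injective
  edge
    | Sum.inl (c, i) => Sum.inl (c.rev, i.rev)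
    | Sum.inr (m, _) => m.elim
  edge_edge := by
    rintro (⟨c, i⟩ | ⟨m, _⟩)
    · simp
    · exact m.elim
  edge_ne := by
    rintro (⟨c, i⟩ | ⟨m, _⟩)
    · fin_cases c <;> simp [Fin.rev]
    · exact m.elim

theorem hopf_isCheckerboard : hopf.IsCheckerboard := by
  refine ⟨fun x => match x with
    | Sum.inl (_, i) => ![true, false, true, false] i
    | Sum.inr (m, _) => m.elim, ?_⟩
  rintro (⟨c, i⟩ | ⟨m, _⟩)
  · constructor
    · fin_cases i <;> rfl
    · fin_cases i <;> rfl
  · exact m.elim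

end Diagram
end Khovanov

/-! Let `C` be the complex of `D₁` with differential `d`, let `X` be multiplication by `v₋` at the
end `p` (`pointMatrix p`), and let `σ` be the sign `(-1)^r` (`signMatrix`). In each of the four
smoothings of the Hopf crossings, the Hopf circle through `q` is joined to the circle of `D₁`
through `p`. The two constant smoothings leave one further circle, the two mixed ones leave none. So
the complex of the connected sum is the total complex of a square `C ⊗ 𝒜 → C ⊕ C → C ⊗ 𝒜`. Up to
sign, both components of the first arrow are the multiplication `x ⊗ v₊ ↦ x`, `x ⊗ v₋ ↦ X x`, and
both components of the second are the comultiplication `x ↦ x ⊗ v₋ + X x ⊗ v₊`.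

This square contains two entries that are identities up to sign: from `C ⊗ v₊` to one middle copy of
`C`, and from the other middle copy to `C ⊗ v₋`. Cancelling them (Gaussian elimination) leaves the
kernel of the multiplication, formed by the elements `x ⊗ v₋ - X x ⊗ v₊`, which is `C` moved by `(0,
-1)`, and the cokernel of the comultiplication, represented by `C ⊗ v₊`, which is `C` moved by `(2,
3)`. The cancellation is written down as explicit inclusions, projections and a homotopy; they work
because `X` commutes with `d` and with `σ`, while `σ` anticommutes with `d` and has square one.

The circles of the connected sum are found in `connectedSum_circle_inl`, `connectedSum_circle_inr`
and `connectedSum_circle_inl_inr`; `extend` then indexes the enhanced states by a Hopf label and an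
enhanced state of `D₁`. The blocks of the differential come from `edgeCoeff_inl`, `edgeCoeff_bot`
and `edgeCoeff_side_top`. The algebraic core is `contraction_identity`, which
`nonempty_homotopyEquiv_biprod` turns into a homotopy equivalence. Throughout, a matrix entry `M S
T` is the coefficient of `T` in the image of `S`, so `M * N` means `M` followed by `N`. Planarity
enters only through the chessboard colouring, which makes every change of a smoothing a merge or a
split. -/

/-- Two involutions without fixed points on a finite set: if one pair `{p, e p}` is removed from
the orbits of `e`, then `p` and `e p` are still connected. -/
theorem Khovanov.mem_of_involutions {α : Type} [Fintype α] {e f : α → α}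
    (he : ∀ x, e (e x) = x) (he' : ∀ x, e x ≠ x) (hf : ∀ x, f (f x) = x) (hf' : ∀ x, f x ≠ x)
    (P : α → Prop) {p : α} (hp : P p) (hPf : ∀ x, P x → P (f x))
    (hPe : ∀ x, x ≠ p → x ≠ e p → P x → P (e x)) : P (e p) := by
  classical
  by_contra hep
  -- Parity count: `P` is a union of `f`-orbits, hence even. If `e p` is missing, then `P` without
  -- `p` is a union of `e`-orbits, hence even as well.
  have h1 : ∑ _x ∈ Finset.univ.filter P, (1 : ZMod 2) = 0 := by
    refine Finset.sum_involution (fun x _ => f x) (fun _ _ => by decide) (fun x _ _ => hf' x)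
      (fun x hx => ?_) (fun x _ => hf x)
    simp only [Finset.mem_filter, Finset.mem_univ, true_and] at hx ⊢
    exact hPf x hx
  have h2 : ∑ _x ∈ (Finset.univ.filter P).erase p, (1 : ZMod 2) = 0 := by
    refine Finset.sum_involution (fun x _ => e x) (fun _ _ => by decide) (fun x _ _ => he' x)
      (fun x hx => ?_) (fun x _ => he x)
    simp only [Finset.mem_erase, Finset.mem_filter, Finset.mem_univ, true_and] at hx ⊢
    have hne : x ≠ e p := by rintro rfl; exact hep hx.2
    refine ⟨fun h => hne ?_, hPe x hx.1 hne hx.2⟩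
    rw [← h, he]
  rw [← Finset.add_sum_erase _ _ (Finset.mem_filter.2 ⟨Finset.mem_univ p, hp⟩), h2] at h1
  exact absurd h1 (by decide)

namespace Khovanov
namespace Diagram

/-! ### The circles of a connected sum -/

section Sum

variable {D₁ D₂ : Diagram} {p : D₁.End} {q : D₂.End} {s : D₁.State} {t : D₂.State}

theorem smooth_ne {D : Diagram} (s : D.State) (x : D.End) : D.smooth s x ≠ x := by
  rcases x with ⟨c, i⟩ | ⟨m, b⟩
  · cases h : s c <;> fin_cases i <;> simp [smooth, h]
  · simp [smooth]

theorem inlEnd_ne_inrEnd (x : D₁.End) (y : D₂.End) : inlEnd D₁ D₂ x ≠ inrEnd D₁ D₂ y := by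
  rcases x with ⟨c, i⟩ | ⟨m, b⟩ <;> rcases y with ⟨d, j⟩ | ⟨n, b'⟩ <;> simp [inlEnd, inrEnd]

variable (p q) in
/-- The ends of the first diagram in a connected sum. -/
def leftEnd (x : D₁.End) : (connectedSum D₁ D₂ p q).End := inlEnd D₁ D₂ x

variable (p q) in
/-- The ends of the second diagram in a connected sum. -/
def rightEnd (y : D₂.End) : (connectedSum D₁ D₂ p q).End := inrEnd D₁ D₂ y

variable (p q) in
/-- The Kauffman state of a connected sum which is given by states of the summands. -/
def sumState (s : D₁.State) (t : D₂.State) : (connectedSum D₁ D₂ p q).State := Sum.elim s t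

theorem connectedSum_end_cases (x : (connectedSum D₁ D₂ p q).End) :
    (∃ y, x = leftEnd p q y) ∨ ∃ z, x = rightEnd p q z := end_cases x

theorem connectedSum_smooth_inl (x : D₁.End) :
    (connectedSum D₁ D₂ p q).smooth (sumState p q s t) (leftEnd p q x)
      = leftEnd p q (D₁.smooth s x) := by
  rcases x with ⟨c, i⟩ | ⟨m, b⟩ <;> rfl

theorem connectedSum_smooth_inr (y : D₂.End) :
    (connectedSum D₁ D₂ p q).smooth (sumState p q s t) (rightEnd p q y)
      = rightEnd p q (D₂.smooth t y) := by
  rcases y with ⟨c, i⟩ | ⟨m, b⟩ <;> rfl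

open Classical in
theorem connectedSum_edge (x : Ends (D₁.Crossing ⊕ D₂.Crossing) (D₁.Mark ⊕ D₂.Mark)) :
    (connectedSum D₁ D₂ p q).edge x = Equiv.swap (inlEnd D₁ D₂ p) (inrEnd D₁ D₂ (D₂.edge q))
      (sumEdge D₁ D₂ (Equiv.swap (inlEnd D₁ D₂ p) (inrEnd D₁ D₂ (D₂.edge q)) x)) := rfl

open Classical in
theorem connectedSum_edge_inl {x : D₁.End} (h : x ≠ p) (h' : x ≠ D₁.edge p) :
    (connectedSum D₁ D₂ p q).edge (leftEnd p q x) = leftEnd p q (D₁.edge x) := by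
  have h'' : D₁.edge x ≠ p := fun h => h' (by rw [← h, D₁.edge_edge])
  refine (connectedSum_edge (inlEnd D₁ D₂ x)).trans ?_
  rw [Equiv.swap_apply_of_ne_of_ne (inlEnd_injective.ne h) (inlEnd_ne_inrEnd _ _), sumEdge_inl,
    Equiv.swap_apply_of_ne_of_ne (inlEnd_injective.ne h'') (inlEnd_ne_inrEnd _ _)]
  rfl

open Classical in
theorem connectedSum_edge_inr {y : D₂.End} (h : y ≠ q) (h' : y ≠ D₂.edge q) :
    (connectedSum D₁ D₂ p q).edge (rightEnd p q y) = rightEnd p q (D₂.edge y) := by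
  have h'' : D₂.edge y ≠ D₂.edge q := fun e => h (by rw [← D₂.edge_edge y, e, D₂.edge_edge])
  refine (connectedSum_edge (inrEnd D₁ D₂ y)).trans ?_
  rw [Equiv.swap_apply_of_ne_of_ne (inlEnd_ne_inrEnd _ _).symm (inrEnd_injective.ne h'),
    sumEdge_inr,
    Equiv.swap_apply_of_ne_of_ne (inlEnd_ne_inrEnd _ _).symm (inrEnd_injective.ne h'')]
  rfl

open Classical in
theorem connectedSum_edge_left :
    (connectedSum D₁ D₂ p q).edge (leftEnd p q p) = rightEnd p q q := by
  refine (connectedSum_edge (inlEnd D₁ D₂ p)).trans ?_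
  rw [Equiv.swap_apply_left, sumEdge_inr, D₂.edge_edge,
    Equiv.swap_apply_of_ne_of_ne (inlEnd_ne_inrEnd _ _).symm
      (inrEnd_injective.ne (D₂.edge_ne q).symm)]
  rfl

open Classical in
theorem connectedSum_edge_left' :
    (connectedSum D₁ D₂ p q).edge (leftEnd p q (D₁.edge p)) = rightEnd p q (D₂.edge q) := by
  refine (connectedSum_edge (inlEnd D₁ D₂ (D₁.edge p))).trans ?_
  rw [Equiv.swap_apply_of_ne_of_ne (inlEnd_injective.ne (D₁.edge_ne p)) (inlEnd_ne_inrEnd _ _),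
    sumEdge_inl, D₁.edge_edge, Equiv.swap_apply_left]
  rfl

theorem connectedSum_edge_right :
    (connectedSum D₁ D₂ p q).edge (rightEnd p q q) = leftEnd p q p := by
  rw [← connectedSum_edge_left (p := p) (q := q), edge_edge]

theorem connectedSum_edge_right' :
    (connectedSum D₁ D₂ p q).edge (rightEnd p q (D₂.edge q)) = leftEnd p q (D₁.edge p) := by
  rw [← connectedSum_edge_left' (p := p) (q := q), edge_edge]

/-- A function on the ends of a connected sum which is given on the two summands. -/
theorem connectedSum_circle_ind {α : Type} (f : D₁.End → α) (g : D₂.End → α)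
    (hf₁ : ∀ x, f (D₁.edge x) = f x) (hf₂ : ∀ x, f (D₁.smooth s x) = f x)
    (hg₁ : ∀ y, g (D₂.edge y) = g y) (hg₂ : ∀ y, g (D₂.smooth t y) = g y) (hpq : f p = g q) :
    ∃ F : (connectedSum D₁ D₂ p q).End → α,
      (∀ x, F (leftEnd p q x) = f x) ∧ (∀ y, F (rightEnd p q y) = g y) ∧
      ∀ a b, (connectedSum D₁ D₂ p q).circle (sumState p q s t) a
        = (connectedSum D₁ D₂ p q).circle (sumState p q s t) b → F a = F b := by
  let F : (connectedSum D₁ D₂ p q).End → α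
    | Sum.inl (Sum.inl c, i) => f (Sum.inl (c, i))
    | Sum.inl (Sum.inr c, i) => g (Sum.inl (c, i))
    | Sum.inr (Sum.inl m, b) => f (Sum.inr (m, b))
    | Sum.inr (Sum.inr m, b) => g (Sum.inr (m, b))
  have hl : ∀ x, F (leftEnd p q x) = f x := by rintro (⟨c, i⟩ | ⟨m, b⟩) <;> rfl
  have hr : ∀ y, F (rightEnd p q y) = g y := by rintro (⟨c, i⟩ | ⟨m, b⟩) <;> rfl
  -- Away from the two new arcs the invariance of `F` is that of `f` and `g`. On the arc from `p` to
  -- `q` it is `hpq`, and on the other new arc it follows from `hpq` by `hf₁` and `hg₁`.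
  refine ⟨F, hl, hr, fun a b => circle_ind F ?_ ?_⟩
  · intro x
    rcases connectedSum_end_cases x with ⟨x, rfl⟩ | ⟨y, rfl⟩
    · by_cases h : x = p
      · rw [h, connectedSum_edge_left, hl, hr, hpq]
      by_cases h' : x = D₁.edge p
      · rw [h', connectedSum_edge_left', hl, hr, hf₁, hg₁, hpq]
      rw [connectedSum_edge_inl h h', hl, hl, hf₁]
    · by_cases h : y = q
      · rw [h, connectedSum_edge_right, hl, hr, hpq]
      by_cases h' : y = D₂.edge q
      · rw [h', connectedSum_edge_right', hl, hr, hf₁, hg₁, hpq]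
      rw [connectedSum_edge_inr h h', hr, hr, hg₁]
  · intro x
    rcases connectedSum_end_cases x with ⟨x, rfl⟩ | ⟨y, rfl⟩
    · rw [connectedSum_smooth_inl, hl, hl, hf₂]
    · rw [connectedSum_smooth_inr, hr, hr, hg₂]

variable (p q s t)

theorem connectedSum_circle_points :
    (connectedSum D₁ D₂ p q).circle (sumState p q s t) (leftEnd p q p)
      = (connectedSum D₁ D₂ p q).circle (sumState p q s t) (rightEnd p q q) := by
  rw [← connectedSum_edge_left (p := p) (q := q), circle_edge]

variable {p q s t}

/-- Left to right: the circle of `D₁` is an invariant that extends to `D₂`, with the value of `p` on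
the circle through `q` and `none` on all other circles. Right to left: only the arc at `p` has been
cut, and by `mem_of_involutions` its two ends stay connected around the rest of their circle. -/
theorem connectedSum_circle_inl {x y : D₁.End} :
    (connectedSum D₁ D₂ p q).circle (sumState p q s t) (leftEnd p q x)
      = (connectedSum D₁ D₂ p q).circle (sumState p q s t) (leftEnd p q y)
      ↔ D₁.circle s x = D₁.circle s y := by
  classical
  constructor
  · intro h
    obtain ⟨F, hl, -, hF⟩ := connectedSum_circle_ind (p := p) (q := q) (s := s) (t := t)
      (fun x => some (D₁.circle s x))
      (fun y => if D₂.circle t y = D₂.circle t q then some (D₁.circle s p) else none)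
      (fun x => by rw [circle_edge]) (fun x => by rw [circle_smooth])
      (fun x => by rw [circle_edge]) (fun x => by rw [circle_smooth]) (by simp)
    have := hF _ _ h
    rw [hl, hl] at this
    exact Option.some_injective _ this
  · refine circle_ind (fun x => (connectedSum D₁ D₂ p q).circle (sumState p q s t) (leftEnd p q x))
      (fun x => ?_) (fun x => ?_)
    · have key := mem_of_involutions D₁.edge_edge D₁.edge_ne (smooth_smooth s) (smooth_ne s)
        (fun x => (connectedSum D₁ D₂ p q).circle (sumState p q s t) (leftEnd p q x)
          = (connectedSum D₁ D₂ p q).circle (sumState p q s t) (leftEnd p q p)) (p := p) rfl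
        (fun x hx => by rw [← hx, ← connectedSum_smooth_inl, circle_smooth])
        (fun x h h' hx => by rw [← hx, ← connectedSum_edge_inl h h', circle_edge])
      by_cases h : x = p
      · rw [h]; exact key
      by_cases h' : x = D₁.edge p
      · rw [h', D₁.edge_edge]; exact key.symm
      rw [← connectedSum_edge_inl h h', circle_edge]
    · rw [← connectedSum_smooth_inl, circle_smooth]

theorem connectedSum_circle_inr {x y : D₂.End} :
    (connectedSum D₁ D₂ p q).circle (sumState p q s t) (rightEnd p q x)
      = (connectedSum D₁ D₂ p q).circle (sumState p q s t) (rightEnd p q y)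
      ↔ D₂.circle t x = D₂.circle t y := by
  classical
  constructor
  · intro h
    obtain ⟨F, -, hr, hF⟩ := connectedSum_circle_ind (p := p) (q := q) (s := s) (t := t)
      (fun x => if D₁.circle s x = D₁.circle s p then some (D₂.circle t q) else none)
      (fun y => some (D₂.circle t y))
      (fun x => by rw [circle_edge]) (fun x => by rw [circle_smooth])
      (fun x => by rw [circle_edge]) (fun x => by rw [circle_smooth]) (by simp)
    have := hF _ _ h
    rw [hr, hr] at this
    exact Option.some_injective _ this
  · refine circle_ind (fun x => (connectedSum D₁ D₂ p q).circle (sumState p q s t) (rightEnd p q x))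
      (fun x => ?_) (fun x => ?_)
    · have key := mem_of_involutions D₂.edge_edge D₂.edge_ne (smooth_smooth t) (smooth_ne t)
        (fun x => (connectedSum D₁ D₂ p q).circle (sumState p q s t) (rightEnd p q x)
          = (connectedSum D₁ D₂ p q).circle (sumState p q s t) (rightEnd p q q)) (p := q) rfl
        (fun x hx => by rw [← hx, ← connectedSum_smooth_inr, circle_smooth])
        (fun x h h' hx => by rw [← hx, ← connectedSum_edge_inr h h', circle_edge])
      by_cases h : x = q
      · rw [h]; exact key
      by_cases h' : x = D₂.edge q
      · rw [h', D₂.edge_edge]; exact key.symm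
      rw [← connectedSum_edge_inr h h', circle_edge]
    · rw [← connectedSum_smooth_inr, circle_smooth]

/-- The circles through `p` and `q` are the only ones that are cut, and they become a single circle.
The same `Option`-valued invariant as before detects this: `none` separates the other circles of
`D₂` from `D₁`. -/
theorem connectedSum_circle_inl_inr {x : D₁.End} {y : D₂.End} :
    (connectedSum D₁ D₂ p q).circle (sumState p q s t) (leftEnd p q x)
      = (connectedSum D₁ D₂ p q).circle (sumState p q s t) (rightEnd p q y)
      ↔ D₁.circle s x = D₁.circle s p ∧ D₂.circle t y = D₂.circle t q := by
  classical
  constructor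
  · intro h
    obtain ⟨F, hl, hr, hF⟩ := connectedSum_circle_ind (p := p) (q := q) (s := s) (t := t)
      (fun x => some (D₁.circle s x))
      (fun y => if D₂.circle t y = D₂.circle t q then some (D₁.circle s p) else none)
      (fun x => by rw [circle_edge]) (fun x => by rw [circle_smooth])
      (fun x => by rw [circle_edge]) (fun x => by rw [circle_smooth]) (by simp)
    have := hF _ _ h
    rw [hl, hr] at this
    split_ifs at this with hy
    exact ⟨Option.some_injective _ this, hy⟩
  · rintro ⟨h₁, h₂⟩
    rw [connectedSum_circle_inl.2 h₁, connectedSum_circle_inr.2 h₂, connectedSum_circle_points]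

end Sum

/-! ### The circles of the Hopf link -/

/-- The circles of the `0`-smoothing and of the `1`-smoothing of the Hopf link are distinguished
by this function. -/
def hopfSide (b : Bool) : hopf.End → Bool
  | Sum.inl (c, i) => if b then ![false, true, true, false] i
      else ![![true, true, false, false] i, ![false, false, true, true] i] c
  | Sum.inr (m, _) => m.elim

/-- Every arc of the Hopf diagram has one end at each crossing, so `e0` to `e3` are all the arcs.
With one `0`-smoothing and one `1`-smoothing they chain the eight ends into one circle. -/
theorem hopf_circle_of_ne {t : hopf.State} (ht : t (0 : Fin 2) ≠ t (1 : Fin 2)) (x y : hopf.End) :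
    hopf.circle t x = hopf.circle t y := by
  suffices h : ∀ x, hopf.circle t x = hopf.circle t (Sum.inl ((0 : Fin 2), (0 : Fin 4))) by
    rw [h x, h y]
  have he : ∀ (c : Fin 2) (i : Fin 4), hopf.circle t (Sum.inl (c.rev, i.rev))
      = hopf.circle t (Sum.inl (c, i)) := fun c i => circle_edge (D := hopf) t (Sum.inl (c, i))
  have e0 := he 0 0
  have e1 := he 0 1
  have e2 := he 0 2
  have e3 := he 0 3
  simp only [Fin.rev, Fin.isValue] at e0 e1 e2 e3
  have hs0 : ∀ c : Fin 2, t c = false → _ := fun c h => circle_corner_false (D := hopf) (c := c) h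
  have hs1 : ∀ c : Fin 2, t c = true → _ := fun c h => circle_corner_true (D := hopf) (c := c) h
  unfold corner at hs0 hs1
  rintro (⟨c, i⟩ | ⟨m, _⟩)
  swap
  · exact m.elim
  cases h0 : t (0 : Fin 2) <;> cases h1 : t (1 : Fin 2)
  · exact absurd (h0.trans h1.symm) ht
  · have a := hs0 _ h0
    have b := hs1 _ h1
    fin_cases c <;> fin_cases i <;> simp_all
  · have a := hs1 _ h0
    have b := hs0 _ h1
    fin_cases c <;> fin_cases i <;> simp_all
  · exact absurd (h0.trans h1.symm) ht

theorem hopf_circle_const {b : Bool} {x y : hopf.End} :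
    hopf.circle (fun _ => b) x = hopf.circle (fun _ => b) y ↔ hopfSide b x = hopfSide b y := by
  constructor
  · refine circle_ind _ (fun x => ?_) (fun x => ?_)
    · rcases x with ⟨c, i⟩ | ⟨m, _⟩
      · revert c i b; decide
      · exact m.elim
    · rcases x with ⟨c, i⟩ | ⟨m, _⟩
      · revert c i b; decide
      · exact m.elim
  -- The ends `1` and `3` of the first crossing lie on different sides for both values of `b`, so
  -- they represent the two circles.
  · suffices h : ∀ x, hopf.circle (fun _ => b) x = hopf.circle (fun _ => b)
        (Sum.inl ((0 : Fin 2), if hopfSide b x then (1 : Fin 4) else (3 : Fin 4))) by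
      intro hxy
      rw [h x, h y, hxy]
    have he : ∀ (c : Fin 2) (i : Fin 4), hopf.circle (fun _ => b) (Sum.inl (c.rev, i.rev))
        = hopf.circle (fun _ => b) (Sum.inl (c, i)) := fun c i =>
      circle_edge (D := hopf) (fun _ => b) (Sum.inl (c, i))
    have e0 := he 0 0
    have e1 := he 0 1
    have e2 := he 0 2
    have e3 := he 0 3
    simp only [Fin.rev, Fin.isValue] at e0 e1 e2 e3
    rintro (⟨c, i⟩ | ⟨m, _⟩)
    swap
    · exact m.elim
    cases b
    · have a := fun c : Fin 2 => circle_corner_false (D := hopf) (s := fun _ => false) (c := c) rfl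
      have a0 := a 0
      have a1 := a 1
      unfold corner at a0 a1
      fin_cases c <;> fin_cases i <;> simp_all [hopfSide]
    · have a := fun c : Fin 2 => circle_corner_true (D := hopf) (s := fun _ => true) (c := c) rfl
      have a0 := a 0
      have a1 := a 1
      unfold corner at a0 a1
      fin_cases c <;> fin_cases i <;> simp_all [hopfSide]

open EnhancedState

noncomputable instance {D : Diagram} : DecidableEq D.EnhancedState := Classical.decEq _

section Coefficients

variable {D₁ D₂ : Diagram} {p : D₁.End} {q : D₂.End}

/-! ### Touching circles, flips and signs in a connected sum -/

theorem sumState_flip_inl (s : D₁.State) (t : D₂.State) (c : D₁.Crossing) :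
    State.flip (D := connectedSum D₁ D₂ p q) (sumState p q s t) (Sum.inl c)
      = sumState p q (s.flip c) t := by
  classical
  funext x
  rcases x with x | x
  · by_cases h : x = c
    · subst h
      exact (flip_same _ _).trans (flip_same s x).symm
    · exact (flip_ne (D := connectedSum D₁ D₂ p q) _ (fun h' => h (Sum.inl_injective h'))).trans
        (flip_ne s h).symm
  · exact flip_ne (D := connectedSum D₁ D₂ p q) _ Sum.inr_ne_inl

theorem sumState_flip_inr (s : D₁.State) (t : D₂.State) (c : D₂.Crossing) :
    State.flip (D := connectedSum D₁ D₂ p q) (sumState p q s t) (Sum.inr c)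
      = sumState p q s (t.flip c) := by
  classical
  funext x
  rcases x with x | x
  · exact flip_ne (D := connectedSum D₁ D₂ p q) _ Sum.inl_ne_inr
  · by_cases h : x = c
    · subst h
      exact (flip_same _ _).trans (flip_same t x).symm
    · exact (flip_ne (D := connectedSum D₁ D₂ p q) _ (fun h' => h (Sum.inr_injective h'))).trans
        (flip_ne t h).symm

theorem sumState_inj {s s' : D₁.State} {t t' : D₂.State} :
    sumState p q s t = sumState p q s' t' ↔ s = s' ∧ t = t' := by
  constructor
  · intro h
    exact ⟨funext fun c => congrFun h (Sum.inl c), funext fun c => congrFun h (Sum.inr c)⟩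
  · rintro ⟨rfl, rfl⟩; rfl

theorem exists_sumState (u : (connectedSum D₁ D₂ p q).State) : ∃ s t, u = sumState p q s t :=
  ⟨fun c => u (Sum.inl c), fun c => u (Sum.inr c), by funext x; rcases x with x | x <;> rfl⟩

theorem corner_inl (c : D₁.Crossing) (i : Fin 4) :
    corner (D := connectedSum D₁ D₂ p q) (Sum.inl c) i = leftEnd p q (corner c i) := rfl

theorem corner_inr (c : D₂.Crossing) (i : Fin 4) :
    corner (D := connectedSum D₁ D₂ p q) (Sum.inr c) i = rightEnd p q (corner c i) := rfl

theorem touches_inl_leftEnd {s : D₁.State} {t : D₂.State} {c : D₁.Crossing} {x : D₁.End} :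
    Touches (sumState p q s t) (Sum.inl c) (leftEnd p q x) ↔ Touches s c x := by
  unfold Touches
  rw [corner_inl, corner_inl, connectedSum_circle_inl, connectedSum_circle_inl]

/-- From the side of `D₂`, a crossing of `D₁` can be reached only along the joined circle. -/
theorem touches_inl_rightEnd {s : D₁.State} {t : D₂.State} {c : D₁.Crossing} {y : D₂.End} :
    Touches (sumState p q s t) (Sum.inl c) (rightEnd p q y) ↔
      D₂.circle t y = D₂.circle t q ∧ Touches s c p := by
  unfold Touches
  rw [corner_inl, corner_inl, eq_comm, connectedSum_circle_inl_inr,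
    eq_comm (b := circle _ _ (leftEnd p q (corner c 2))),
    connectedSum_circle_inl_inr, eq_comm (a := D₁.circle s p), eq_comm (a := D₁.circle s p)]
  tauto

theorem touches_inr_rightEnd {s : D₁.State} {t : D₂.State} {c : D₂.Crossing} {y : D₂.End} :
    Touches (sumState p q s t) (Sum.inr c) (rightEnd p q y) ↔ Touches t c y := by
  unfold Touches
  rw [corner_inr, corner_inr, connectedSum_circle_inr, connectedSum_circle_inr]

theorem touches_inr_leftEnd {s : D₁.State} {t : D₂.State} {c : D₂.Crossing} {x : D₁.End} :
    Touches (sumState p q s t) (Sum.inr c) (leftEnd p q x) ↔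
      D₁.circle s x = D₁.circle s p ∧ Touches t c q := by
  unfold Touches
  rw [corner_inr, corner_inr, connectedSum_circle_inl_inr, connectedSum_circle_inl_inr,
    eq_comm (a := D₂.circle t q), eq_comm (a := D₂.circle t q)]
  tauto

/-- The sign `(-1)^k`, where `k` is the number of `1`-smoothings. -/
def stateSign {D : Diagram} (s : D.State) : ℤ :=
  (-1) ^ Fintype.card {c : D.Crossing // s c = true}

theorem edgeSign_inl (s : D₁.State) (t : D₂.State) (c : D₁.Crossing) :
    edgeSign (D := connectedSum D₁ D₂ p q) (Sum.inl c) (sumState p q s t) = edgeSign c s := by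
  unfold edgeSign
  congr 1
  rw [← Nat.card_eq_fintype_card, ← Nat.card_eq_fintype_card]
  refine (Nat.card_congr Equiv.subtypeSum).trans ?_
  have : IsEmpty {y : D₂.Crossing // (connectedSum D₁ D₂ p q).num (Sum.inr y) <
      (connectedSum D₁ D₂ p q).num (Sum.inl c) ∧ sumState p q s t (Sum.inr y) = true} := by
    refine ⟨fun y => ?_⟩
    have h1 : Finset.univ.sup D₁.num + 1 + D₂.num y.1 < D₁.num c := y.2.1
    have h2 := Finset.le_sup (f := D₁.num) (Finset.mem_univ c)
    omega
  rw [Nat.card_sum, Nat.card_of_isEmpty (α := {y : D₂.Crossing // _}), add_zero]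
  rfl

/-- All crossings of `D₁` precede those of `D₂`, so each `1`-smoothing of `s` contributes a sign.
This factor is what makes the Hopf edge maps anticommute with the differential of `D₁`. -/
theorem edgeSign_inr (s : D₁.State) (t : D₂.State) (c : D₂.Crossing) :
    edgeSign (D := connectedSum D₁ D₂ p q) (Sum.inr c) (sumState p q s t)
      = stateSign s * edgeSign c t := by
  unfold edgeSign stateSign
  rw [← pow_add]
  congr 1
  rw [← Nat.card_eq_fintype_card, ← Nat.card_eq_fintype_card, ← Nat.card_eq_fintype_card]
  refine (Nat.card_congr Equiv.subtypeSum).trans ?_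
  rw [Nat.card_sum]
  congr 1
  · refine Nat.card_congr (Equiv.subtypeEquivRight fun x => ⟨fun h => h.2, fun h => ⟨?_, h⟩⟩)
    change D₁.num x < Finset.univ.sup D₁.num + 1 + D₂.num c
    have h2 := Finset.le_sup (f := D₁.num) (Finset.mem_univ x)
    omega
  · refine Nat.card_congr (Equiv.subtypeEquivRight fun y => and_congr_left fun _ => ?_)
    change Finset.univ.sup D₁.num + 1 + D₂.num y < Finset.univ.sup D₁.num + 1 + D₂.num c ↔ _
    omega

end Coefficients

/-! ### The enhanced states of the connected sum with the Hopf link -/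

instance : DecidableEq hopf.Crossing := inferInstanceAs (DecidableEq (Fin 2))

/-- The first crossing of the Hopf link. -/
def hopfZero : hopf.Crossing := (0 : Fin 2)

/-- The second crossing of the Hopf link. -/
def hopfOne : hopf.Crossing := (1 : Fin 2)

theorem hopf_crossing_cases (c : hopf.Crossing) : c = hopfZero ∨ c = hopfOne := by
  revert c
  change ∀ c : Fin 2, c = 0 ∨ c = 1
  decide

@[simp] theorem hopfOne_ne_hopfZero : hopfOne ≠ hopfZero := by decide

@[simp] theorem hopfZero_ne_hopfOne : hopfZero ≠ hopfOne := by decide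

theorem hopf_sum (f : hopf.Crossing → ℤ) : ∑ c, f c = f hopfZero + f hopfOne :=
  Fin.sum_univ_two f

theorem hopf_state_ext {t u : hopf.State} (h₀ : t hopfZero = u hopfZero)
    (h₁ : t hopfOne = u hopfOne) : t = u := by
  funext c
  rcases hopf_crossing_cases c with rfl | rfl
  · exact h₀
  · exact h₁

/-- The enhanced states of the Hopf link, up to the sign of the circle through a given end:
`bot e` and `top e` are the `0`-smoothing and the `1`-smoothing, with the sign `e` of the other
circle, and in `side c` only the crossing `c` has the `1`-smoothing. -/
inductive HopfLabel : Type
  | bot (e : Bool)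
  | side (c : hopf.Crossing)
  | top (e : Bool)
  deriving DecidableEq

namespace HopfLabel

/-- The underlying Kauffman state. -/
def state : HopfLabel → hopf.State
  | bot _ => fun _ => false
  | side c => fun x => decide (x = c)
  | top _ => fun _ => true

/-- The sign of the other circle. -/
def sign : HopfLabel → Bool
  | bot e => e
  -- A default value: a mixed state has one circle, the one through `q`, so this sign labels
  -- nothing.
  | side _ => true
  | top e => e

end HopfLabel

open HopfLabel

theorem hopf_circle_side (c : hopf.Crossing) (x y : hopf.End) :
    hopf.circle (side c).state x = hopf.circle (side c).state y :=
  hopf_circle_of_ne (show (side c).state hopfZero ≠ (side c).state hopfOne by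
    rcases hopf_crossing_cases c with rfl | rfl <;> simp [HopfLabel.state]) x y

theorem hopfSide_corner (b : Bool) (c : hopf.Crossing) :
    hopfSide b (corner c 0) = !hopfSide b (corner c 2) := by
  change Fin 2 at c
  revert b c
  decide

/-- Consequently an edge map at a Hopf crossing leaves no Hopf circle fixed, and only the circles of
`D₁` away from `p` constrain it. -/
theorem hopf_touches (k : HopfLabel) (c : hopf.Crossing) (y : hopf.End) :
    Touches k.state c y := by
  have h : ∀ b, Touches (D := hopf) (fun _ => b) c y := by
    intro b
    unfold Touches
    rw [hopf_circle_const, hopf_circle_const, hopfSide_corner]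
    cases hopfSide b y <;> cases hopfSide b (corner c 2) <;> simp
  rcases k with e | c' | e
  · exact h false
  · exact Or.inl (hopf_circle_side _ _ _)
  · exact h true

theorem exists_hopf_circle_ne (b : Bool) (q : hopf.End) :
    ∃ y, ¬ hopf.circle (fun _ => b) y = hopf.circle (fun _ => b) q := by
  simp only [hopf_circle_const]
  have h := hopfSide_corner b hopfZero
  by_cases h' : hopfSide b (corner (D := hopf) hopfZero 0) = hopfSide b q
  · exact ⟨_, fun h'' => by rw [h', ← h''] at h; exact (Bool.eq_not_self _).1 h⟩
  · exact ⟨_, h'⟩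

/-- The signs are compared only if some end lies off the circle through `q`. For a mixed state there
is none and the smoothings determine the label; for a constant state `exists_hopf_circle_ne`
supplies one. -/
theorem HopfLabel.eq_of_state {q : hopf.End} {k l : HopfLabel} (h : k.state = l.state)
    (h' : ∀ y, ¬ hopf.circle k.state y = hopf.circle k.state q → k.sign = l.sign) : k = l := by
  have h0 := congrFun h hopfZero
  have h1 := congrFun h hopfOne
  rcases k with e | c | e <;> rcases l with e' | c' | e'
  · obtain ⟨y, hy⟩ := exists_hopf_circle_ne false q
    exact congrArg bot (h' y hy)
  · rcases hopf_crossing_cases c' with rfl | rfl <;> simp [HopfLabel.state] at h0 h1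
  · simp [HopfLabel.state] at h0
  · rcases hopf_crossing_cases c with rfl | rfl <;> simp [HopfLabel.state] at h0 h1
  · rcases hopf_crossing_cases c with rfl | rfl <;>
      rcases hopf_crossing_cases c' with rfl | rfl <;> simp [HopfLabel.state] at h0 h1 ⊢
  · rcases hopf_crossing_cases c with rfl | rfl <;> simp [HopfLabel.state] at h0 h1
  · simp [HopfLabel.state] at h0
  · rcases hopf_crossing_cases c' with rfl | rfl <;> simp [HopfLabel.state] at h0 h1
  · obtain ⟨y, hy⟩ := exists_hopf_circle_ne true q
    exact congrArg top (h' y hy)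

section Extend

variable {D₁ : Diagram} (p : D₁.End) (q : hopf.End)

-- The joined circle takes its sign from `D₁`, and the remaining Hopf circle, if any, takes the sign
-- of the label. These two functions agree at `p` and `q`, so they glue by
-- `connectedSum_circle_ind`.
open Classical in
theorem exists_extend (k : HopfLabel) (S : D₁.EnhancedState) :
    ∃ W : (connectedSum D₁ hopf p q).EnhancedState, W.state = sumState p q S.state k.state ∧
      (∀ x, W.lab (leftEnd p q x) = S.lab x) ∧
      ∀ y, W.lab (rightEnd p q y)
        = if hopf.circle k.state y = hopf.circle k.state q then S.lab p else k.sign := by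
  obtain ⟨F, hl, hr, hF⟩ := connectedSum_circle_ind (p := p) (q := q) (s := S.state) (t := k.state)
    S.lab (fun y => if hopf.circle k.state y = hopf.circle k.state q then S.lab p else k.sign)
    (fun x => S.lab_congr (circle_edge _ _)) (fun x => S.lab_congr (circle_smooth _ _))
    (fun y => by rw [circle_edge]) (fun y => by rw [circle_smooth]) (by simp)
  exact ⟨⟨sumState p q S.state k.state, Quotient.lift F fun a b hab => hF a b (Quotient.sound hab)⟩,
    rfl, hl, hr⟩

/-- The enhanced state of the connected sum which is given by an enhanced state of `D₁` and an
enhanced state of the Hopf link. -/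
noncomputable def extend (k : HopfLabel) (S : D₁.EnhancedState) :
    (connectedSum D₁ hopf p q).EnhancedState :=
  (exists_extend p q k S).choose

theorem extend_state (k : HopfLabel) (S : D₁.EnhancedState) :
    (extend p q k S).state = sumState p q S.state k.state :=
  (exists_extend p q k S).choose_spec.1

theorem extend_lab_left (k : HopfLabel) (S : D₁.EnhancedState) (x : D₁.End) :
    (extend p q k S).lab (leftEnd p q x) = S.lab x :=
  (exists_extend p q k S).choose_spec.2.1 x

open Classical in
theorem extend_lab_right (k : HopfLabel) (S : D₁.EnhancedState) (y : hopf.End) :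
    (extend p q k S).lab (rightEnd p q y)
      = if hopf.circle k.state y = hopf.circle k.state q then S.lab p else k.sign :=
  (exists_extend p q k S).choose_spec.2.2 y

variable {p q}

theorem extend_injective {k l : HopfLabel} {S T : D₁.EnhancedState} :
    extend p q k S = extend p q l T ↔ k = l ∧ S = T := by
  constructor
  · intro h
    have h1 := congrArg EnhancedState.state h
    rw [extend_state, extend_state, sumState_inj] at h1
    refine ⟨HopfLabel.eq_of_state (q := q) h1.2 fun y hy => ?_, ext_lab h1.1 fun x => ?_⟩
    · have h2 := extend_lab_right p q k S y
      rw [h, extend_lab_right, ← h1.2, if_neg hy, if_neg hy] at h2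
      exact h2.symm
    · rw [← extend_lab_left p q k S, h, extend_lab_left]
  · rintro ⟨rfl, rfl⟩; rfl

/-- Together with `extend_injective` this decomposes the basis of the complex into six copies of the
basis of `D₁`, one for each Hopf label. The state of `D₁` is read off on the ends of `D₁`, the label
from the Hopf smoothings and from the sign away from `q`. -/
theorem extend_surjective (W : (connectedSum D₁ hopf p q).EnhancedState) :
    ∃ k S, W = extend p q k S := by
  obtain ⟨s, t, hst⟩ := exists_sumState W.state
  let S : D₁.EnhancedState := ⟨s, Quotient.lift (fun x => W.lab (leftEnd p q x)) fun a b hab =>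
    W.lab_congr (by rw [hst]; exact connectedSum_circle_inl.2 (Quotient.sound hab))⟩
  have hS : ∀ x, S.lab x = W.lab (leftEnd p q x) := fun _ => rfl
  have main : ∀ k : HopfLabel, t = k.state →
      (∀ y, ¬ hopf.circle t y = hopf.circle t q → W.lab (rightEnd p q y) = k.sign) →
      W = extend p q k S := by
    rintro k rfl hk
    refine ext_lab (hst.trans (extend_state p q k S).symm) fun x => ?_
    rcases connectedSum_end_cases x with ⟨x, rfl⟩ | ⟨y, rfl⟩
    · rw [extend_lab_left, hS]
    · rw [extend_lab_right, hS]
      split_ifs with h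
      · refine W.lab_congr ?_
        rw [hst, eq_comm, connectedSum_circle_inl_inr]
        exact ⟨rfl, h⟩
      · exact hk y h
  -- A constant state has just two circles, so all ends off the circle through `q` share one circle,
  -- and hence one sign.
  have hconst : ∀ b, (∃ x, ∀ y, ¬ hopf.circle (fun _ => b) y = hopf.circle (fun _ => b) q →
      hopf.circle (fun _ => b) y = hopf.circle (fun _ => b) x) := by
    intro b
    obtain ⟨x, hx⟩ := exists_hopf_circle_ne b q
    refine ⟨x, fun y hy => ?_⟩
    rw [hopf_circle_const] at *
    revert hx hy
    cases hopfSide b x <;> cases hopfSide b y <;> cases hopfSide b q <;> simp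
  have hlab : ∀ b, t = (fun _ => b) → ∃ e, ∀ y,
      ¬ hopf.circle t y = hopf.circle t q → W.lab (rightEnd p q y) = e := by
    rintro b rfl
    obtain ⟨x, hx⟩ := hconst b
    refine ⟨W.lab (rightEnd p q x), fun y hy => W.lab_congr ?_⟩
    rw [hst, connectedSum_circle_inr]
    exact hx y hy
  cases h0 : t hopfZero <;> cases h1 : t hopfOne
  · have h := hopf_state_ext (u := fun _ => false) h0 h1
    obtain ⟨e, he⟩ := hlab false h
    exact ⟨bot e, S, main _ h he⟩
  · have h := hopf_state_ext (u := (side hopfOne).state) h0 h1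
    exact ⟨side hopfOne, S, main _ h fun y hy => absurd (by rw [h]; exact hopf_circle_side _ _ _) hy⟩
  · have h := hopf_state_ext (u := (side hopfZero).state) h0 h1
    exact ⟨side hopfZero, S, main _ h fun y hy => absurd (by rw [h]; exact hopf_circle_side _ _ _) hy⟩
  · have h := hopf_state_ext (u := fun _ => true) h0 h1
    obtain ⟨e, he⟩ := hlab true h
    exact ⟨top e, S, main _ h he⟩

/-! ### The coefficients of the differential -/

/-- A Hopf circle that avoids `q` does not pass by a crossing of `D₁` and keeps its sign. Hence the
edges of `D₁` act inside each block, by the same coefficients as in `D₁` itself. -/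
theorem isEdge_inl {c : D₁.Crossing} {k l : HopfLabel} {S T : D₁.EnhancedState} :
    IsEdge (D := connectedSum D₁ hopf p q) (Sum.inl c) (extend p q k S) (extend p q l T) ↔
      k = l ∧ IsEdge c S T := by
  unfold IsEdge
  rw [extend_state, extend_state, sumState_flip_inl, sumState_inj]
  constructor
  · rintro ⟨h1, ⟨h2, h3⟩, h4⟩
    refine ⟨HopfLabel.eq_of_state (q := q) h3.symm fun y hy => ?_, h1, h2, fun x hx => ?_⟩
    · have h5 := h4 (rightEnd p q y) (by rw [touches_inl_rightEnd]; exact fun h => hy h.1)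
      rw [extend_lab_right, extend_lab_right, h3, if_neg hy, if_neg hy] at h5
      exact h5.symm
    · rw [← extend_lab_left p q k S, ← extend_lab_left p q l T]
      exact h4 _ (by rwa [touches_inl_leftEnd])
  · rintro ⟨rfl, h1, h2, h3⟩
    refine ⟨h1, ⟨h2, rfl⟩, fun x hx => ?_⟩
    rcases connectedSum_end_cases x with ⟨x, rfl⟩ | ⟨y, rfl⟩
    · rw [touches_inl_leftEnd] at hx
      rw [extend_lab_left, extend_lab_left, h3 x hx]
    · rw [touches_inl_rightEnd] at hx
      rw [extend_lab_right, extend_lab_right]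
      split_ifs with h
      · exact h3 p fun h' => hx ⟨h, h'⟩
      · rfl

theorem edgeCoeff_inl (c : D₁.Crossing) (k l : HopfLabel) (S T : D₁.EnhancedState) :
    edgeCoeff (D := connectedSum D₁ hopf p q) (Sum.inl c) (extend p q k S) (extend p q l T)
      = if k = l then edgeCoeff c S T else 0 := by
  have hs : Splits (D := connectedSum D₁ hopf p q) (extend p q k S).state (Sum.inl c) ↔
      Splits S.state c := by
    unfold Splits
    rw [extend_state, corner_inl, corner_inl, connectedSum_circle_inl]
  by_cases hE : k = l ∧ IsEdge c S T
  · rw [if_pos hE.1]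
    by_cases h : Splits S.state c
    · exact (edgeCoeff_of_split (isEdge_inl.2 hE) (hs.2 h)).trans (by
        rw [edgeCoeff_of_split hE.2 h, corner_inl, corner_inl]
        simp only [extend_lab_left])
    · exact (edgeCoeff_of_merge (isEdge_inl.2 hE) (mt hs.1 h)).trans (by
        rw [edgeCoeff_of_merge hE.2 h, corner_inl, corner_inl]
        simp only [extend_lab_left])
  · refine (edgeCoeff_of_not (mt isEdge_inl.1 hE)).trans ?_
    split_ifs with hkl
    · exact (edgeCoeff_of_not fun h => hE ⟨hkl, h⟩).symm
    · rfl

/-- The enhanced states differ at most in the sign of the circle through `p`. -/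
def AgreeAway (p : D₁.End) (S T : D₁.EnhancedState) : Prop :=
  T.state = S.state ∧ ∀ x, ¬ D₁.circle S.state x = D₁.circle S.state p → T.lab x = S.lab x

theorem AgreeAway.eq_set {S T : D₁.EnhancedState} (h : AgreeAway p S T) :
    T = S.set p (T.lab p) := by
  refine ext_lab h.1 fun x => ?_
  rw [set_lab]
  split_ifs with hx
  · exact T.lab_congr (by rw [h.1]; exact hx)
  · exact h.2 x hx

theorem agreeAway_set (S : D₁.EnhancedState) (b : Bool) : AgreeAway p S (S.set p b) :=
  ⟨rfl, fun x hx => by rw [set_lab, if_neg hx]⟩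

theorem agreeAway_refl (S : D₁.EnhancedState) : AgreeAway p S S :=
  ⟨rfl, fun _ _ => rfl⟩

-- This form and `one_eq` put `X` and the identity in terms of the signs at `p` alone, ready to be
-- compared with the tables `mulCoeff` and `comulCoeff`.
open Classical in
theorem pointMatrix_eq (S T : D₁.EnhancedState) :
    pointMatrix p S T = if AgreeAway p S T ∧ S.lab p = true ∧ T.lab p = false then 1 else 0 := by
  unfold pointMatrix
  refine if_congr ⟨?_, ?_⟩ rfl rfl
  · rintro ⟨h, rfl⟩
    exact ⟨agreeAway_set S _, h, set_lab_self _ _ _⟩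
  · rintro ⟨h1, h2, h3⟩
    exact ⟨h2, by rw [← h3]; exact h1.eq_set⟩

open Classical in
theorem one_eq (S T : D₁.EnhancedState) :
    (1 : Matrix D₁.EnhancedState D₁.EnhancedState ℤ) S T
      = if AgreeAway p S T ∧ S.lab p = T.lab p then 1 else 0 := by
  rw [Matrix.one_apply]
  refine if_congr ⟨?_, ?_⟩ rfl rfl
  · rintro rfl
    exact ⟨agreeAway_refl S, rfl⟩
  · rintro ⟨h1, h2⟩
    rw [h1.eq_set, ← h2, set_eq_self]

/-- By `hopf_touches` the circle through `p` always passes by a Hopf crossing, so its sign is free;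
all other circles of `D₁` are out of reach. -/
theorem isEdge_inr {c : hopf.Crossing} {k l : HopfLabel} {S T : D₁.EnhancedState} :
    IsEdge (D := connectedSum D₁ hopf p q) (Sum.inr c) (extend p q k S) (extend p q l T) ↔
      k.state c = false ∧ l.state = k.state.flip c ∧ AgreeAway p S T := by
  unfold IsEdge AgreeAway
  rw [extend_state, extend_state, sumState_flip_inr, sumState_inj]
  constructor
  · rintro ⟨h1, ⟨h2, h3⟩, h4⟩
    refine ⟨h1, h3, h2, fun x hx => ?_⟩
    rw [← extend_lab_left p q k S, ← extend_lab_left p q l T]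
    exact h4 _ (by rw [touches_inr_leftEnd]; exact fun h => hx h.1)
  · rintro ⟨h1, h2, h3, h4⟩
    refine ⟨h1, ⟨h3, h2⟩, fun x hx => ?_⟩
    rcases connectedSum_end_cases x with ⟨x, rfl⟩ | ⟨y, rfl⟩
    · rw [touches_inr_leftEnd] at hx
      rw [extend_lab_left, extend_lab_left]
      exact h4 x fun h => hx ⟨h, hopf_touches _ _ _⟩
    · exact absurd (touches_inr_rightEnd.2 (hopf_touches _ _ _)) hx

theorem bot_flip (e : Bool) (c : hopf.Crossing) : (bot e).state.flip c = (side c).state := by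
  funext x
  by_cases h : x = c
  · rw [h, flip_same]; simp [HopfLabel.state]
  · rw [flip_ne _ h]; simp [HopfLabel.state, h]

theorem side_flip (e : Bool) {c c' : hopf.Crossing} (h : c' ≠ c) :
    (side c').state.flip c = (top e).state := by
  funext x
  by_cases hx : x = c
  · rw [hx, flip_same]; rfl
  · rw [flip_ne _ hx]
    have : x = c' := by
      rcases hopf_crossing_cases x with rfl | rfl <;> rcases hopf_crossing_cases c with rfl | rfl <;>
        rcases hopf_crossing_cases c' with rfl | rfl <;> simp_all
    simp [HopfLabel.state, this]

/-- The two Hopf circles meet at `c` and are merged: multiplying by the other circle is the identity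
if it carries `v₊`, and `X` if it carries `v₋`. -/
theorem edgeCoeff_bot (c : hopf.Crossing) (e : Bool) (l : HopfLabel) (S T : D₁.EnhancedState) :
    edgeCoeff (D := connectedSum D₁ hopf p q) (Sum.inr c) (extend p q (bot e) S) (extend p q l T)
      = if l = side c then (if e then 1 else pointMatrix p : Matrix _ _ ℤ) S T else 0 := by
  classical
  by_cases hl : l = side c
  swap
  · rw [if_neg hl]
    refine edgeCoeff_of_not ?_
    rw [isEdge_inr, bot_flip]
    exact fun h => hl (HopfLabel.eq_of_state (q := q) h.2.1 fun y hy =>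
      absurd (by rw [h.2.1]; exact hopf_circle_side _ _ _) hy)
  subst hl
  rw [if_pos rfl]
  have hE : IsEdge (D := connectedSum D₁ hopf p q) (Sum.inr c) (extend p q (bot e) S)
      (extend p q (side c) T) ↔ AgreeAway p S T := by
    rw [isEdge_inr, bot_flip]
    exact ⟨fun h => h.2.2, fun h => ⟨rfl, rfl, h⟩⟩
  have hX : (if e then 1 else pointMatrix p : Matrix D₁.EnhancedState D₁.EnhancedState ℤ) S T
      = if AgreeAway p S T then mulCoeff (S.lab p) e (T.lab p) else 0 := by
    cases e
    · simp only [Bool.false_eq_true, if_false, pointMatrix_eq, ite_and]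
      cases S.lab p <;> cases T.lab p <;> simp [mulCoeff]
    · simp only [if_true, one_eq (p := p), ite_and]
      cases S.lab p <;> cases T.lab p <;> simp [mulCoeff]
  rw [hX]
  by_cases hA : AgreeAway p S T
  swap
  · rw [if_neg hA, edgeCoeff_of_not (mt hE.1 hA)]
  rw [if_pos hA, edgeCoeff_of_merge (hE.2 hA)]
  · rw [corner_inr, corner_inr, extend_lab_right, extend_lab_right, extend_lab_right,
      if_pos (hopf_circle_side _ _ _)]
    have h1 : ∀ x, hopf.circle (bot e).state x = hopf.circle (bot e).state q ↔
        hopfSide false x = hopfSide false q := fun x => hopf_circle_const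
    have h2 := hopfSide_corner false c
    -- Which of the ends `0` and `2` of `c` lies on the circle through `q` depends on `c` and `q`;
    -- commutativity of `𝒜` makes both cases agree.
    have hcomm : ∀ a b d, mulCoeff a b d = mulCoeff b a d := by decide
    rw [h1, h1, h2]
    have h3 : (bot e).sign = e := rfl
    rw [h3]
    cases hopfSide false (corner (D := hopf) c 2) <;> cases hopfSide false q <;>
      simp [hcomm e]
  · rw [extend_state, corner_inr, corner_inr, connectedSum_circle_inr]
    have h2 := hopfSide_corner false c
    have h1 := hopf_circle_const (b := false) (x := corner (D := hopf) c 0) (y := corner c 2)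
    rw [h2] at h1
    exact fun h => absurd (h1.1 h) (by simp)

/-- The circle at `p` splits off a new circle, and the coproduct is `x ↦ x ⊗ v₋ + X x ⊗ v₊`: the
component with `v₊` on the new circle is `X`, the one with `v₋` is the identity. -/
theorem edgeCoeff_side_top (c c' : hopf.Crossing) (h : c' ≠ c) (e : Bool) (S T : D₁.EnhancedState) :
    edgeCoeff (D := connectedSum D₁ hopf p q) (Sum.inr c) (extend p q (side c') S)
        (extend p q (top e) T)
      = (if e then pointMatrix p else 1 : Matrix _ _ ℤ) S T := by
  classical
  have hE : IsEdge (D := connectedSum D₁ hopf p q) (Sum.inr c) (extend p q (side c') S)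
      (extend p q (top e) T) ↔ AgreeAway p S T := by
    rw [isEdge_inr, side_flip e h]
    exact ⟨fun h => h.2.2, fun h' => ⟨decide_eq_false h.symm, rfl, h'⟩⟩
  have hX : (if e then pointMatrix p else 1 : Matrix D₁.EnhancedState D₁.EnhancedState ℤ) S T
      = if AgreeAway p S T then comulCoeff (S.lab p) (T.lab p) e else 0 := by
    cases e
    · simp only [Bool.false_eq_true, if_false, one_eq (p := p), ite_and]
      cases S.lab p <;> cases T.lab p <;> simp [comulCoeff]
    · simp only [if_true, pointMatrix_eq, ite_and]
      cases S.lab p <;> cases T.lab p <;> simp [comulCoeff]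
  rw [hX]
  by_cases hA : AgreeAway p S T
  swap
  · rw [if_neg hA, edgeCoeff_of_not (mt hE.1 hA)]
  rw [if_pos hA, edgeCoeff_of_split (hE.2 hA)]
  · rw [corner_inr, corner_inr, extend_lab_right, extend_lab_right, extend_lab_right,
      if_pos (hopf_circle_side _ _ _)]
    have h1 : ∀ x, hopf.circle (top e).state x = hopf.circle (top e).state q ↔
        hopfSide true x = hopfSide true q := fun x => hopf_circle_const
    have h2 := hopfSide_corner true c
    -- Cocommutativity, for the same reason as in the merge: either of the two ends may lie on the
    -- circle through `q`.
    have hcomm : ∀ a b d, comulCoeff a b d = comulCoeff a d b := by decide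
    rw [h1, h1, h2]
    have h3 : (top e).sign = e := rfl
    rw [h3]
    cases hopfSide true (corner (D := hopf) c 2) <;> cases hopfSide true q <;>
      simp [hcomm _ e]
  · rw [extend_state, corner_inr, corner_inr, connectedSum_circle_inr]
    exact hopf_circle_side _ _ _

theorem edgeCoeff_side_of_ne (c c' : hopf.Crossing) {l : HopfLabel} (hl : ∀ e, l ≠ top e)
    (S T : D₁.EnhancedState) :
    edgeCoeff (D := connectedSum D₁ hopf p q) (Sum.inr c) (extend p q (side c') S)
        (extend p q l T) = 0 := by
  refine edgeCoeff_of_not ?_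
  rw [isEdge_inr]
  rintro ⟨h1, h2, -⟩
  have h : c' ≠ c := by rintro rfl; simp [HopfLabel.state] at h1
  rw [side_flip l.sign h] at h2
  exact hl _ (HopfLabel.eq_of_state (q := q) h2 fun _ _ => rfl)

theorem edgeCoeff_side_self (c : hopf.Crossing) (l : HopfLabel) (S T : D₁.EnhancedState) :
    edgeCoeff (D := connectedSum D₁ hopf p q) (Sum.inr c) (extend p q (side c) S)
        (extend p q l T) = 0 := by
  refine edgeCoeff_of_not ?_
  rw [isEdge_inr]
  rintro ⟨h1, -⟩
  simp [HopfLabel.state] at h1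

theorem edgeCoeff_top (c : hopf.Crossing) (e : Bool) (l : HopfLabel) (S T : D₁.EnhancedState) :
    edgeCoeff (D := connectedSum D₁ hopf p q) (Sum.inr c) (extend p q (top e) S)
        (extend p q l T) = 0 := by
  refine edgeCoeff_of_not ?_
  rw [isEdge_inr]
  rintro ⟨h1, -⟩
  simp [HopfLabel.state] at h1

theorem edgeSign_bot (c : hopf.Crossing) (e : Bool) : edgeSign (D := hopf) c (bot e).state = 1 := by
  simp [edgeSign, HopfLabel.state]

/-- The only negative edge of the Hopf square; it makes the two paths through the square cancel. -/
theorem edgeSign_side_one : edgeSign (D := hopf) hopfOne (side hopfZero).state = -1 := by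
  unfold edgeSign
  have : Fintype.card {x : hopf.Crossing // hopf.num x < hopf.num hopfOne ∧
      (side hopfZero).state x = true} = 1 := by
    decide
  rw [this, pow_one]

theorem edgeSign_side_zero : edgeSign (D := hopf) hopfZero (side hopfOne).state = 1 := by
  unfold edgeSign
  have : Fintype.card {x : hopf.Crossing // hopf.num x < hopf.num hopfZero ∧
      (side hopfOne).state x = true} = 0 := by
    decide
  rw [this, pow_zero]

/-- The crossings of `D₁` contribute the differential of `D₁` on the diagonal blocks, those of the
Hopf link contribute the edges of the square, twisted by `(-1)^r`. -/
theorem incidence_extend (k l : HopfLabel) (S T : D₁.EnhancedState) :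
    incidence (extend p q k S) (extend p q l T) = (if k = l then incidence S T else 0)
      + stateSign S.state * ∑ c : hopf.Crossing, edgeSign (D := hopf) c k.state *
        edgeCoeff (D := connectedSum D₁ hopf p q) (Sum.inr c) (extend p q k S)
          (extend p q l T) := by
  refine (Fintype.sum_sum_type _).trans ?_
  congr 1
  · simp only [extend_state, edgeSign_inl, edgeCoeff_inl]
    split_ifs
    · rfl
    · simp
  · simp only [extend_state, edgeSign_inr, Finset.mul_sum, mul_assoc]

end Extend

/-! ### Homogeneous matrices -/

/-- The matrix describes a map of bidegree `(a, b)`. -/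
def IsHomogeneous {D D' : Diagram} (M : Matrix D.EnhancedState D'.EnhancedState ℤ) (a b : ℤ) :
    Prop :=
  ∀ S T, M S T ≠ 0 → T.homDegree = S.homDegree + a ∧ T.qDegree = S.qDegree + b

namespace IsHomogeneous

variable {D D' D'' : Diagram} {M M' : Matrix D.EnhancedState D'.EnhancedState ℤ}
  {N : Matrix D'.EnhancedState D''.EnhancedState ℤ} {a b a' b' : ℤ}

theorem add (h : IsHomogeneous M a b) (h' : IsHomogeneous M' a b) :
    IsHomogeneous (M + M') a b := by
  intro S T hne
  by_cases h0 : M S T = 0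
  · refine h' S T fun h1 => hne ?_
    rw [Matrix.add_apply, h0, h1, add_zero]
  · exact h S T h0

theorem neg (h : IsHomogeneous M a b) : IsHomogeneous (-M) a b := fun S T hne =>
  h S T fun h0 => hne (by rw [Matrix.neg_apply, h0, neg_zero])

theorem sub (h : IsHomogeneous M a b) (h' : IsHomogeneous M' a b) :
    IsHomogeneous (M - M') a b := by
  rw [sub_eq_add_neg]
  exact h.add h'.neg

theorem mul (h : IsHomogeneous M a b) (h' : IsHomogeneous N a' b') :
    IsHomogeneous (M * N) (a + a') (b + b') := by
  intro S W hne
  rw [Matrix.mul_apply] at hne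
  obtain ⟨T, -, hT⟩ := Finset.exists_ne_zero_of_sum_ne_zero hne
  have h1 := h S T (left_ne_zero_of_mul hT)
  have h2 := h' T W (right_ne_zero_of_mul hT)
  constructor
  · rw [h2.1, h1.1, add_assoc]
  · rw [h2.2, h1.2, add_assoc]

theorem cast (h : IsHomogeneous M a b) (ha : a = a') (hb : b = b') : IsHomogeneous M a' b' :=
  ha ▸ hb ▸ h

end IsHomogeneous

/-! ### The differential, the signs and multiplication by `v₋` as matrices -/

variable {D : Diagram}

/-- The differential as a matrix. -/
noncomputable def differentialMatrix (D : Diagram) :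
    Matrix D.EnhancedState D.EnhancedState ℤ := fun S T => incidence S T

theorem isHomogeneous_differentialMatrix (hD : D.IsCheckerboard) :
    IsHomogeneous D.differentialMatrix 1 0 := fun S T h => by
  have := incidence_degree hD (S := S) (T := T) h
  rwa [add_zero]

/-- The diagonal matrix of the signs `(-1)^r`. -/
noncomputable def signMatrix (D : Diagram) : Matrix D.EnhancedState D.EnhancedState ℤ :=
  Matrix.diagonal fun S => stateSign S.state

theorem isHomogeneous_signMatrix : IsHomogeneous D.signMatrix 0 0 := by
  intro S T h
  by_cases hST : S = T
  · subst hST; simp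
  · exact absurd (Matrix.diagonal_apply_ne _ hST) h

theorem signMatrix_mul_self : D.signMatrix * D.signMatrix = 1 := by
  unfold signMatrix
  rw [Matrix.diagonal_mul_diagonal, ← Matrix.diagonal_one]
  congr 1
  funext S
  unfold stateSign
  rw [← pow_add, ← two_mul, pow_mul]
  simp

/-- A nonzero entry of the differential raises the number of `1`-smoothings by one and so reverses
the sign `(-1)^r`. -/
theorem signMatrix_mul_differentialMatrix (hD : D.IsCheckerboard) :
    D.signMatrix * D.differentialMatrix = -(D.differentialMatrix * D.signMatrix) := by
  ext S T
  unfold signMatrix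
  rw [Matrix.neg_apply, Matrix.diagonal_mul, Matrix.mul_diagonal]
  by_cases h : D.differentialMatrix S T = 0
  · rw [h]; ring
  · have h1 : T.homDegree = S.homDegree + 1 := (incidence_degree hD h).1
    unfold homDegree at h1
    have h2 : stateSign T.state = - stateSign S.state := by
      have : Fintype.card {c : D.Crossing // T.state c = true}
          = Fintype.card {c : D.Crossing // S.state c = true} + 1 := by exact_mod_cast h1
      unfold stateSign
      rw [this, pow_succ]
      ring
    rw [h2]
    ring

theorem pointMatrix_mul_signMatrix (p : D.End) :
    pointMatrix p * D.signMatrix = D.signMatrix * pointMatrix p := by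
  ext S T
  unfold signMatrix
  rw [Matrix.diagonal_mul, Matrix.mul_diagonal]
  unfold pointMatrix
  split_ifs with h
  · rw [h.2, set_state]; ring
  · ring

/-- Each edge map commutes with `X` by `edgeCoeff_set`, and the edge signs depend only on the
smoothings, which `X` does not change. -/
theorem pointMatrix_mul_differentialMatrix (hD : D.IsCheckerboard) (p : D.End) :
    pointMatrix p * D.differentialMatrix = D.differentialMatrix * pointMatrix p := by
  ext S W
  rw [pointMatrix_mul, mul_pointMatrix]
  have h := fun c => edgeCoeff_set hD c p S W
  unfold differentialMatrix incidence
  -- The value `0` of each case distinction is written as a sum of zeros, so that the comparison can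
  -- be made crossing by crossing.
  rw [← Finset.sum_const_zero (s := Finset.univ) (ι := D.Crossing), ← Finset.sum_ite_irrel,
    ← Finset.sum_ite_irrel]
  refine Finset.sum_congr rfl fun c _ => ?_
  rw [set_state, ← mul_zero (edgeSign c S.state), ← mul_ite, ← mul_ite, h c]

theorem qDegree_set (S : D.EnhancedState) (p : D.End) (b : Bool) :
    (S.set p b).qDegree = S.qDegree + (if b then 1 else -1) - (if S.lab p then 1 else -1) := by
  classical
  have h1 : (S.set p b).homDegree = S.homDegree := rfl
  have h2 : ∑ k : D.Circle S.state, (if (S.set p b).label k then (1 : ℤ) else -1)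
      = (∑ k : D.Circle S.state, if S.label k then (1 : ℤ) else -1)
        + (if b then 1 else -1) - (if S.lab p then 1 else -1) := by
    rw [← Finset.add_sum_erase _ _ (Finset.mem_univ (D.circle S.state p)),
      ← Finset.add_sum_erase _ (fun k => if S.label k then (1 : ℤ) else -1)
        (Finset.mem_univ (D.circle S.state p))]
    have h3 : (S.set p b).label (D.circle S.state p) = b := set_lab_self S p b
    have h4 : ∀ k ∈ Finset.univ.erase (D.circle S.state p),
        (if (S.set p b).label k then (1 : ℤ) else -1) = if S.label k then (1 : ℤ) else -1 := by
      intro k hk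
      have : (S.set p b).label k = S.label k := by
        unfold EnhancedState.set
        exact Function.update_of_ne (Finset.ne_of_mem_erase hk) _ _
      rw [this]
    rw [h3, Finset.sum_congr rfl h4]
    unfold lab
    ring
  unfold qDegree
  rw [h1]
  refine (congrArg _ h2).trans ?_
  ring

theorem isHomogeneous_pointMatrix (p : D.End) : IsHomogeneous (pointMatrix p) 0 (-2) := by
  intro S T h
  unfold pointMatrix at h
  split_ifs at h with hc
  · rw [hc.2]
    refine ⟨(add_zero _).symm, ?_⟩
    rw [qDegree_set, hc.1]
    norm_num
    ring
  · exact absurd rfl h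

/-! ### The degrees of the enhanced states of the connected sum -/

section Extend

variable {D₁ : Diagram} {p : D₁.End} {q : hopf.End}

/-- The number of `1`-smoothings of an enhanced state of the Hopf link. -/
def HopfLabel.homDegree : HopfLabel → ℤ
  | bot _ => 0
  | side _ => 1
  | top _ => 2

/-- The change of the secondary degree by a connected sum with an enhanced state of the Hopf
link. -/
def HopfLabel.qDegree : HopfLabel → ℤ
  -- In all three cases: the number of Hopf `1`-smoothings, plus `1` or `-1` for the other circle if
  -- there is one.
  | bot e => if e then 1 else -1
  | side _ => 1
  | top e => if e then 3 else 1

theorem homDegree_extend (k : HopfLabel) (S : D₁.EnhancedState) :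
    (extend p q k S).homDegree = S.homDegree + k.homDegree := by
  have h : ((Fintype.card {c : hopf.Crossing // k.state c = true} : ℕ) : ℤ) = k.homDegree := by
    rcases k with e | c | e
    · simp [HopfLabel.state, HopfLabel.homDegree]
    · simp [HopfLabel.state, HopfLabel.homDegree]
    · simp only [HopfLabel.state, HopfLabel.homDegree]
      decide
  rw [← h]
  unfold EnhancedState.homDegree
  rw [extend_state, ← Nat.cast_add]
  congr 1
  rw [← Nat.card_eq_fintype_card, ← Nat.card_eq_fintype_card, ← Nat.card_eq_fintype_card,
    ← Nat.card_sum]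
  exact Nat.card_congr Equiv.subtypeSum

/-- The single Hopf circle is absorbed by the circle through `p`. The circles thus correspond to
those of `S`, with the same signs, and only the additional `1`-smoothing changes the degree. -/
theorem qDegree_extend_side (c : hopf.Crossing) (S : D₁.EnhancedState) :
    (extend p q (side c) S).qDegree = S.qDegree + 1 := by
  unfold EnhancedState.qDegree
  rw [homDegree_extend]
  suffices h : ∑ k : (connectedSum D₁ hopf p q).Circle (extend p q (side c) S).state,
      (if (extend p q (side c) S).label k then (1 : ℤ) else -1)
        = ∑ k : D₁.Circle S.state, if S.label k then (1 : ℤ) else -1 by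
    rw [h]
    simp only [HopfLabel.homDegree]
    ring
  have hst := extend_state p q (side c) S
  let f : D₁.Circle S.state → (connectedSum D₁ hopf p q).Circle (extend p q (side c) S).state :=
    Quotient.lift (fun x => circle _ _ (leftEnd p q x)) fun a b hab => by
      rw [hst]; exact connectedSum_circle_inl.2 (Quotient.sound hab)
  have hf : ∀ x, f (D₁.circle S.state x) = circle _ _ (leftEnd p q x) := fun _ => rfl
  have hbij : Function.Bijective f := by
    constructor
    · intro a b hab
      obtain ⟨x, rfl⟩ := Quotient.exists_rep a
      obtain ⟨y, rfl⟩ := Quotient.exists_rep b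
      have hab' : circle _ (extend p q (side c) S).state (leftEnd p q x)
        = circle _ _ (leftEnd p q y) := hab
      rw [hst] at hab'
      exact connectedSum_circle_inl.1 hab'
    · intro b
      obtain ⟨x, rfl⟩ := Quotient.exists_rep b
      rcases connectedSum_end_cases x with ⟨x, rfl⟩ | ⟨y, rfl⟩
      · exact ⟨D₁.circle S.state x, rfl⟩
      · refine ⟨D₁.circle S.state p, (hf p).trans ?_⟩
        change circle _ (extend p q (side c) S).state (leftEnd p q p)
          = circle _ _ (rightEnd p q y)
        rw [hst, connectedSum_circle_inl_inr]
        exact ⟨rfl, hopf_circle_side _ _ _⟩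
  refine (Fintype.sum_bijective f hbij _ _ fun k => ?_).symm
  obtain ⟨x, rfl⟩ := Quotient.exists_rep k
  have : S.label (D₁.circle S.state x) = (extend p q (side c) S).label (circle _ _ (leftEnd p q x))
    := (extend_lab_left p q (side c) S x).symm
  change (if S.label (D₁.circle S.state x) = true then (1 : ℤ) else -1) = _
  rw [this]
  rfl

/-- Meant for `k = bot` and `k = top`: the two labels differ only in the sign of the circle through
an end `y` off the circle of `q`, so `qDegree_set` compares their degrees. -/
theorem extend_set_right {b : Bool} {k : Bool → HopfLabel} (hk : ∀ e, (k e).state = fun _ => b)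
    (hk' : ∀ e, (k e).sign = e) (S : D₁.EnhancedState) :
    ∃ y, (extend p q (k true) S).lab (rightEnd p q y) = true ∧
      extend p q (k false) S = (extend p q (k true) S).set (rightEnd p q y) false := by
  obtain ⟨y, hy⟩ := exists_hopf_circle_ne b q
  refine ⟨y, ?_, ?_⟩
  · rw [extend_lab_right, hk, if_neg hy, hk']
  · refine ext_lab ?_ fun x => ?_
    · rw [set_state, extend_state, extend_state, hk, hk]
    · rw [set_lab, extend_state]
      rcases connectedSum_end_cases x with ⟨x, rfl⟩ | ⟨z, rfl⟩
      · rw [extend_lab_left, extend_lab_left, if_neg]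
        rw [connectedSum_circle_inl_inr, hk]
        exact fun h => hy h.2
      · rw [connectedSum_circle_inr, extend_lab_right, extend_lab_right, hk, hk, hk', hk']
        simp only [hopf_circle_const] at hy ⊢
        revert hy
        cases hopfSide b y <;> cases hopfSide b z <;> cases hopfSide b q <;> simp

/-- No circles need counting for the constant smoothings. Edge maps preserve the secondary degree,
and `bot true → side → top false` has the nonzero coefficient `1` over a fixed `S`; the other two
labels then follow by changing one sign. -/
theorem qDegree_extend (hD : D₁.IsCheckerboard) (k : HopfLabel) (S : D₁.EnhancedState) :
    (extend p q k S).qDegree = S.qDegree + k.qDegree := by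
  have hD' := hD.connectedSum hopf_isCheckerboard p q
  have hbot : (extend p q (bot true) S).qDegree = S.qDegree + 1 := by
    rw [← qDegree_extend_side (p := p) (q := q) hopfZero S]
    refine (edgeCoeff_degree hD' (c := Sum.inr hopfZero) (S := extend p q (bot true) S)
      (T := extend p q (side hopfZero) S) ?_).2.symm
    rw [edgeCoeff_bot, if_pos rfl, if_pos rfl, Matrix.one_apply_eq]
    exact one_ne_zero
  have htop : (extend p q (top false) S).qDegree = S.qDegree + 1 := by
    rw [← qDegree_extend_side (p := p) (q := q) hopfZero S]
    refine (edgeCoeff_degree hD' (c := Sum.inr hopfOne) (S := extend p q (side hopfZero) S)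
      (T := extend p q (top false) S) ?_).2
    rw [edgeCoeff_side_top _ _ (by simp), if_neg (by simp), Matrix.one_apply_eq]
    exact one_ne_zero
  rcases k with e | c | e
  · cases e
    · obtain ⟨y, h1, h2⟩ := extend_set_right (p := p) (q := q) (k := bot) (b := false)
        (fun _ => rfl) (fun _ => rfl) S
      rw [h2, qDegree_set, h1, hbot]
      simp [HopfLabel.qDegree]
      ring
    · exact hbot
  · exact qDegree_extend_side c S
  · cases e
    · exact htop
    · obtain ⟨y, h1, h2⟩ := extend_set_right (p := p) (q := q) (k := top) (b := true)
        (fun _ => rfl) (fun _ => rfl) S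
      rw [h2, qDegree_set, h1] at htop
      simp [HopfLabel.qDegree] at htop ⊢
      linarith

/-! ### The differential of the connected sum in block form -/

variable (p q) in
/-- The matrix of the inclusion of the summand which belongs to an enhanced state of the Hopf
link. -/
noncomputable def inclusion (k : HopfLabel) :
    Matrix D₁.EnhancedState (connectedSum D₁ hopf p q).EnhancedState ℤ :=
  fun S W => if W = extend p q k S then 1 else 0

variable (p q) in
/-- The matrix of the projection to the summand which belongs to an enhanced state of the Hopf
link. -/
noncomputable def projection (k : HopfLabel) :
    Matrix (connectedSum D₁ hopf p q).EnhancedState D₁.EnhancedState ℤ :=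
  fun W S => if W = extend p q k S then 1 else 0

theorem isHomogeneous_inclusion (hD : D₁.IsCheckerboard) (k : HopfLabel) :
    IsHomogeneous (inclusion p q k) k.homDegree k.qDegree := by
  intro S W h
  unfold inclusion at h
  split_ifs at h with hW
  · rw [hW, homDegree_extend, qDegree_extend hD]
    exact ⟨rfl, rfl⟩
  · exact absurd rfl h

theorem isHomogeneous_projection (hD : D₁.IsCheckerboard) (k : HopfLabel) :
    IsHomogeneous (projection p q k) (-k.homDegree) (-k.qDegree) := by
  intro W S h
  unfold projection at h
  split_ifs at h with hW
  · rw [hW, homDegree_extend, qDegree_extend hD]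
    constructor <;> ring
  · exact absurd rfl h

/-- With matrices acting on rows, left multiplication by an inclusion selects the rows of one block.
-/
theorem inclusion_mul {α : Type} (k : HopfLabel)
    (M : Matrix (connectedSum D₁ hopf p q).EnhancedState α ℤ) (S : D₁.EnhancedState) (a : α) :
    (inclusion p q k * M) S a = M (extend p q k S) a := by
  simp [Matrix.mul_apply, inclusion]

theorem mul_inclusion {α : Type} (k l : HopfLabel) (M : Matrix α D₁.EnhancedState ℤ) (a : α)
    (T : D₁.EnhancedState) :
    (M * inclusion p q k) a (extend p q l T) = if k = l then M a T else 0 := by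
  by_cases h : k = l
  · subst h
    simp [Matrix.mul_apply, inclusion, extend_injective]
  · simp [Matrix.mul_apply, inclusion, extend_injective, h, Ne.symm h]

theorem inclusion_mul_projection (k l : HopfLabel) :
    inclusion p q k * projection p q l = if k = l then 1 else 0 := by
  ext S T
  rw [inclusion_mul]
  unfold projection
  simp only [extend_injective]
  by_cases h : k = l
  · simp [h, Matrix.one_apply]
  · simp [h]

theorem inclusion_mul_projection_mul {α : Type} (k l : HopfLabel)
    (M : Matrix D₁.EnhancedState α ℤ) :
    inclusion p q k * (projection p q l * M) = if k = l then M else 0 := by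
  rw [← Matrix.mul_assoc, inclusion_mul_projection]
  split_ifs
  · rw [Matrix.one_mul]
  · rw [Matrix.zero_mul]

/-- By `extend_surjective` the six blocks contain all rows, so matrix identities may be checked
block by block. -/
theorem matrix_ext_rows {α : Type}
    {M N : Matrix (connectedSum D₁ hopf p q).EnhancedState α ℤ}
    (h : ∀ k, inclusion p q k * M = inclusion p q k * N) : M = N := by
  ext W a
  obtain ⟨k, S, rfl⟩ := extend_surjective W
  rw [← inclusion_mul k M S a, h, inclusion_mul]

theorem matrix_ext_cols {α : Type}
    {M N : Matrix α (connectedSum D₁ hopf p q).EnhancedState ℤ}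
    (h : ∀ a k S, M a (extend p q k S) = N a (extend p q k S)) : M = N := by
  ext a W
  obtain ⟨k, S, rfl⟩ := extend_surjective W
  exact h a k S

theorem signMatrix_mul_apply {α : Type} (M : Matrix D₁.EnhancedState α ℤ)
    (S : D₁.EnhancedState) (a : α) :
    (D₁.signMatrix * M) S a = stateSign S.state * M S a :=
  Matrix.diagonal_mul _ _ _ _

theorem inclusion_mul_differentialMatrix_apply (k l : HopfLabel) (S T : D₁.EnhancedState) :
    (inclusion p q k * (connectedSum D₁ hopf p q).differentialMatrix) S (extend p q l T)
      = (if k = l then D₁.differentialMatrix S T else 0)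
      + stateSign S.state * (edgeSign (D := hopf) hopfZero k.state *
        edgeCoeff (D := connectedSum D₁ hopf p q) (Sum.inr hopfZero) (extend p q k S)
          (extend p q l T) + edgeSign (D := hopf) hopfOne k.state *
        edgeCoeff (D := connectedSum D₁ hopf p q) (Sum.inr hopfOne) (extend p q k S)
          (extend p q l T)) := by
  rw [inclusion_mul]
  refine (incidence_extend k l S T).trans ?_
  rw [hopf_sum]
  rfl

/-- The internal differential plus the merge into both mixed states, each with Hopf sign `+1`. -/
theorem inclusion_bot_mul (e : Bool) :
    inclusion p q (bot e) * (connectedSum D₁ hopf p q).differentialMatrix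
      = D₁.differentialMatrix * inclusion p q (bot e)
        + D₁.signMatrix * ((if e then 1 else pointMatrix p) *
          (inclusion p q (side hopfZero) + inclusion p q (side hopfOne))) := by
  refine matrix_ext_cols fun S l T => ?_
  rw [inclusion_mul_differentialMatrix_apply, edgeSign_bot, edgeSign_bot, edgeCoeff_bot,
    edgeCoeff_bot, Matrix.add_apply, signMatrix_mul_apply, mul_inclusion, Matrix.mul_add,
    Matrix.add_apply, mul_inclusion, mul_inclusion, one_mul, one_mul]
  simp only [eq_comm (a := l)]

/-- The internal differential plus the coproduct; the minus sign is `edgeSign_side_one`, and the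
other mixed state has a plus instead. -/
theorem inclusion_side_zero_mul :
    inclusion p q (side hopfZero) * (connectedSum D₁ hopf p q).differentialMatrix
      = D₁.differentialMatrix * inclusion p q (side hopfZero)
        - D₁.signMatrix * (inclusion p q (top false) + pointMatrix p * inclusion p q (top true))
    := by
  refine matrix_ext_cols fun S l T => ?_
  rw [inclusion_mul_differentialMatrix_apply, edgeSign_side_one, edgeCoeff_side_self,
    Matrix.sub_apply, signMatrix_mul_apply, mul_inclusion, Matrix.add_apply, mul_inclusion,
    ← Matrix.one_mul (inclusion p q (top false)), mul_inclusion]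
  by_cases hl : ∃ e, l = top e
  · obtain ⟨e, rfl⟩ := hl
    rw [edgeCoeff_side_top _ _ (by simp)]
    cases e <;> simp
  · push Not at hl
    rw [edgeCoeff_side_of_ne _ _ hl, if_neg (hl _).symm, if_neg (hl _).symm]
    simp

theorem inclusion_side_one_mul :
    inclusion p q (side hopfOne) * (connectedSum D₁ hopf p q).differentialMatrix
      = D₁.differentialMatrix * inclusion p q (side hopfOne)
        + D₁.signMatrix * (inclusion p q (top false) + pointMatrix p * inclusion p q (top true))
    := by
  refine matrix_ext_cols fun S l T => ?_
  rw [inclusion_mul_differentialMatrix_apply, edgeSign_side_zero, edgeCoeff_side_self,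
    Matrix.add_apply, signMatrix_mul_apply, mul_inclusion, Matrix.add_apply, mul_inclusion,
    ← Matrix.one_mul (inclusion p q (top false)), mul_inclusion]
  by_cases hl : ∃ e, l = top e
  · obtain ⟨e, rfl⟩ := hl
    rw [edgeCoeff_side_top _ _ (by simp)]
    cases e <;> simp
  · push Not at hl
    rw [edgeCoeff_side_of_ne _ _ hl, if_neg (hl _).symm, if_neg (hl _).symm]
    simp

theorem inclusion_top_mul (e : Bool) :
    inclusion p q (top e) * (connectedSum D₁ hopf p q).differentialMatrix
      = D₁.differentialMatrix * inclusion p q (top e) := by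
  refine matrix_ext_cols fun S l T => ?_
  rw [inclusion_mul_differentialMatrix_apply, edgeCoeff_top, edgeCoeff_top, mul_inclusion]
  simp

/-! ### The maps and the homotopy -/

variable (p q)

/-- The embedding of the lower copy of the complex of `D₁`. -/
noncomputable def lowerInclusion :
    Matrix D₁.EnhancedState (connectedSum D₁ hopf p q).EnhancedState ℤ :=
  -- The element `x ⊗ v₋ - X x ⊗ v₊`: the correction term places it in the kernel of the
  -- multiplication.
  inclusion p q (bot false) - pointMatrix p * inclusion p q (bot true)

/-- The embedding of the upper copy of the complex of `D₁`. -/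
noncomputable def upperInclusion :
    Matrix D₁.EnhancedState (connectedSum D₁ hopf p q).EnhancedState ℤ :=
  inclusion p q (top true)

/-- The projection to the lower copy of the complex of `D₁`. -/
noncomputable def lowerProjection :
    Matrix (connectedSum D₁ hopf p q).EnhancedState D₁.EnhancedState ℤ :=
  projection p q (bot false)

/-- The projection to the upper copy of the complex of `D₁`. -/
noncomputable def upperProjection :
    Matrix (connectedSum D₁ hopf p q).EnhancedState D₁.EnhancedState ℤ :=
  -- Sending `x ⊗ v₊` to `x` and `x ⊗ v₋` to `-X x` kills every coproduct `x ⊗ v₋ + X x ⊗ v₊`.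
  projection p q (top true) - projection p q (top false) * pointMatrix p

/-- The homotopy which contracts the complement of the two copies. -/
noncomputable def contraction : Matrix (connectedSum D₁ hopf p q).EnhancedState
    (connectedSum D₁ hopf p q).EnhancedState ℤ :=
  -- The two summands reverse the entries `bot true → side hopfZero` and `side hopfOne → top false`
  -- of the differential. Both entries equal `σ`, with a plus sign, and `σ` is its own inverse.
  projection p q (side hopfZero) * (D₁.signMatrix * inclusion p q (bot true))
    + projection p q (top false) * (D₁.signMatrix * inclusion p q (side hopfOne))

theorem isHomogeneous_lowerInclusion (hD : D₁.IsCheckerboard) :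
    IsHomogeneous (lowerInclusion p q) 0 (-1) :=
  (isHomogeneous_inclusion hD _).sub
    (((isHomogeneous_pointMatrix p).mul (isHomogeneous_inclusion hD (bot true))).cast rfl rfl)

theorem isHomogeneous_upperInclusion (hD : D₁.IsCheckerboard) :
    IsHomogeneous (upperInclusion p q) 2 3 := isHomogeneous_inclusion hD _

theorem isHomogeneous_lowerProjection (hD : D₁.IsCheckerboard) :
    IsHomogeneous (lowerProjection p q) 0 1 := isHomogeneous_projection hD _

theorem isHomogeneous_upperProjection (hD : D₁.IsCheckerboard) :
    IsHomogeneous (upperProjection p q) (-2) (-3) :=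
  (isHomogeneous_projection hD _).sub
    (((isHomogeneous_projection hD (top false)).mul (isHomogeneous_pointMatrix p)).cast rfl rfl)

theorem isHomogeneous_contraction (hD : D₁.IsCheckerboard) :
    IsHomogeneous (contraction p q) (-1) 0 :=
  (((isHomogeneous_projection hD _).mul
    (isHomogeneous_signMatrix.mul (isHomogeneous_inclusion hD _))).cast rfl rfl).add
  (((isHomogeneous_projection hD _).mul
    (isHomogeneous_signMatrix.mul (isHomogeneous_inclusion hD _))).cast rfl rfl)

/-! ### The inclusions and projections as a direct sum decomposition -/

theorem lowerInclusion_mul_lowerProjection :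
    lowerInclusion p q * lowerProjection p q = 1 := by
  simp [lowerInclusion, lowerProjection, Matrix.sub_mul, Matrix.mul_assoc,
    inclusion_mul_projection]

theorem upperInclusion_mul_upperProjection :
    upperInclusion p q * upperProjection p q = 1 := by
  simp [upperInclusion, upperProjection, Matrix.mul_sub, inclusion_mul_projection_mul,
    inclusion_mul_projection]

theorem lowerInclusion_mul_upperProjection :
    lowerInclusion p q * upperProjection p q = 0 := by
  simp [lowerInclusion, upperProjection, Matrix.mul_sub, Matrix.sub_mul, Matrix.mul_assoc,
    inclusion_mul_projection_mul, inclusion_mul_projection]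

theorem upperInclusion_mul_lowerProjection :
    upperInclusion p q * lowerProjection p q = 0 := by
  simp [upperInclusion, lowerProjection, inclusion_mul_projection]

/-! ### Commutation rules inside longer products -/

variable {p}

theorem pointMatrix_mul_signMatrix_mul {α : Type} (M : Matrix D₁.EnhancedState α ℤ) :
    pointMatrix p * (D₁.signMatrix * M) = D₁.signMatrix * (pointMatrix p * M) := by
  rw [← Matrix.mul_assoc, pointMatrix_mul_signMatrix, Matrix.mul_assoc]

theorem pointMatrix_mul_differentialMatrix_mul (hD : D₁.IsCheckerboard) {α : Type}
    (M : Matrix D₁.EnhancedState α ℤ) :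
    pointMatrix p * (D₁.differentialMatrix * M) = D₁.differentialMatrix * (pointMatrix p * M) := by
  rw [← Matrix.mul_assoc, pointMatrix_mul_differentialMatrix hD, Matrix.mul_assoc]

theorem signMatrix_mul_differentialMatrix_mul (hD : D₁.IsCheckerboard) {α : Type}
    (M : Matrix D₁.EnhancedState α ℤ) :
    D₁.signMatrix * (D₁.differentialMatrix * M)
      = -(D₁.differentialMatrix * (D₁.signMatrix * M)) := by
  rw [← Matrix.mul_assoc, signMatrix_mul_differentialMatrix hD, Matrix.neg_mul, Matrix.mul_assoc]

theorem signMatrix_mul_signMatrix_mul {α : Type} (M : Matrix D₁.EnhancedState α ℤ) :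
    D₁.signMatrix * (D₁.signMatrix * M) = M := by
  rw [← Matrix.mul_assoc, signMatrix_mul_self, Matrix.one_mul]

/-! ### Chain map identities and the contraction -/

variable {q}

/-- Both terms of the inclusion map to the mixed states by `σ X`, with opposite signs. Moving `X`
past `d` and `σ` makes them cancel. -/
theorem lowerInclusion_mul_differentialMatrix (hD : D₁.IsCheckerboard) :
    lowerInclusion p q * (connectedSum D₁ hopf p q).differentialMatrix
      = D₁.differentialMatrix * lowerInclusion p q := by
  simp only [lowerInclusion, Matrix.sub_mul, Matrix.mul_sub, Matrix.mul_assoc, inclusion_bot_mul,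
    Matrix.mul_add, pointMatrix_mul_differentialMatrix_mul hD, pointMatrix_mul_signMatrix_mul,
    Matrix.one_mul, if_true, Bool.false_eq_true, if_false]
  abel

theorem upperInclusion_mul_differentialMatrix :
    upperInclusion p q * (connectedSum D₁ hopf p q).differentialMatrix
      = D₁.differentialMatrix * upperInclusion p q :=
  inclusion_top_mul true

/-- No Hopf edge ends in the `0`-smoothing, so only the internal differential reaches `bot false`.
-/
theorem differentialMatrix_mul_lowerProjection :
    (connectedSum D₁ hopf p q).differentialMatrix * lowerProjection p q
      = lowerProjection p q * D₁.differentialMatrix := by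
  refine matrix_ext_rows fun k => ?_
  rw [← Matrix.mul_assoc, ← Matrix.mul_assoc]
  unfold lowerProjection
  rcases k with e | c | e
  · cases e <;> simp [inclusion_bot_mul, Matrix.add_mul, Matrix.mul_assoc,
      inclusion_mul_projection, Matrix.mul_add]
  · rcases hopf_crossing_cases c with rfl | rfl <;>
      simp [inclusion_side_zero_mul, inclusion_side_one_mul, Matrix.add_mul, Matrix.sub_mul,
        Matrix.mul_assoc, inclusion_mul_projection]
  · simp [inclusion_top_mul, Matrix.mul_assoc, inclusion_mul_projection]

/-- On the mixed states the two components of the coproduct contribute `-X` and `X`; on the top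
states `X` commutes with `d`. -/
theorem differentialMatrix_mul_upperProjection (hD : D₁.IsCheckerboard) :
    (connectedSum D₁ hopf p q).differentialMatrix * upperProjection p q
      = upperProjection p q * D₁.differentialMatrix := by
  refine matrix_ext_rows fun k => ?_
  rw [← Matrix.mul_assoc, ← Matrix.mul_assoc]
  unfold upperProjection
  rcases k with e | c | e
  · cases e <;> simp [inclusion_bot_mul, Matrix.add_mul, Matrix.mul_assoc, Matrix.mul_sub,
      inclusion_mul_projection, inclusion_mul_projection_mul, Matrix.mul_add]
  · rcases hopf_crossing_cases c with rfl | rfl <;>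
      simp [inclusion_side_zero_mul, inclusion_side_one_mul, Matrix.add_mul, Matrix.sub_mul,
        Matrix.mul_sub, Matrix.mul_assoc, inclusion_mul_projection, inclusion_mul_projection_mul]
  · cases e <;> simp [inclusion_top_mul, Matrix.mul_sub, Matrix.mul_assoc,
      inclusion_mul_projection, inclusion_mul_projection_mul,
      pointMatrix_mul_differentialMatrix hD]

/-- On `bot true` and `side hopfOne` the differential followed by the contraction is already the
identity. On `bot false` and `top false` the homotopy terms also cancel the corrections by `X` in
the lower inclusion and the upper projection, and `top true` is fixed by the upper summand. -/
theorem contraction_identity (hD : D₁.IsCheckerboard) :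
    lowerProjection p q * lowerInclusion p q + upperProjection p q * upperInclusion p q
      + ((connectedSum D₁ hopf p q).differentialMatrix * contraction p q
        + contraction p q * (connectedSum D₁ hopf p q).differentialMatrix) = 1 := by
  refine matrix_ext_rows fun k => ?_
  rw [Matrix.mul_one]
  simp only [Matrix.mul_add, ← Matrix.mul_assoc (inclusion p q k)]
  unfold lowerProjection lowerInclusion upperProjection upperInclusion contraction
  rcases k with e | c | e
  · cases e <;> simp [inclusion_bot_mul, Matrix.add_mul, Matrix.mul_assoc, Matrix.mul_sub,
      inclusion_mul_projection, inclusion_mul_projection_mul, Matrix.mul_add,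
      signMatrix_mul_signMatrix_mul, pointMatrix_mul_signMatrix_mul]
  · rcases hopf_crossing_cases c with rfl | rfl
    · simp [inclusion_bot_mul, inclusion_side_zero_mul, Matrix.sub_mul, Matrix.mul_sub,
        Matrix.add_mul, Matrix.mul_add, Matrix.mul_assoc, inclusion_mul_projection,
        inclusion_mul_projection_mul, signMatrix_mul_signMatrix_mul,
        signMatrix_mul_differentialMatrix_mul hD]
      -- The two paths through `d` to `bot true` cancel since `σ` anticommutes with `d`. The
      -- unwanted component in `side hopfOne` cancels because the two mixed states have opposite
      -- Hopf signs.
      abel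
    · simp [inclusion_side_one_mul, Matrix.add_mul, Matrix.mul_add, Matrix.mul_sub,
        Matrix.mul_assoc, inclusion_mul_projection, inclusion_mul_projection_mul,
        signMatrix_mul_signMatrix_mul]
  · cases e <;> simp [inclusion_top_mul, inclusion_side_one_mul, Matrix.mul_add,
      Matrix.mul_sub, Matrix.mul_assoc, inclusion_mul_projection,
      inclusion_mul_projection_mul, signMatrix_mul_signMatrix_mul,
      signMatrix_mul_differentialMatrix_mul hD]

end Extend

end Diagram

/-! ### Maps of bigraded modules which are given by matrices -/

namespace Diagram

variable {D D' D'' : Diagram}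

/-- The component of the map which is given by a matrix, with values in one bidegree. -/
noncomputable def gradedMap (M : Matrix D.EnhancedState D'.EnhancedState ℤ) (i j i' j' : ℤ) :
    (D.GradedState i j →₀ ℤ) →ₗ[ℤ] (D'.GradedState i' j' →₀ ℤ) :=
  Finsupp.linearCombination ℤ fun S : D.GradedState i j =>
    Finsupp.equivFunOnFinite.symm fun T : D'.GradedState i' j' => M S.1 T.1

theorem differential_eq_gradedMap (i i' j : ℤ) :
    D.differential i i' j = gradedMap D.differentialMatrix i j i' j := rfl

theorem gradedMap_single (M : Matrix D.EnhancedState D'.EnhancedState ℤ) {i j i' j' : ℤ}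
    (S : D.GradedState i j) (T : D'.GradedState i' j') :
    gradedMap M i j i' j' (Finsupp.single S 1) T = M S.1 T.1 := by
  simp [gradedMap]

theorem gradedMap_ext {i j i' j' : ℤ}
    {f g : (D.GradedState i j →₀ ℤ) →ₗ[ℤ] (D'.GradedState i' j' →₀ ℤ)}
    (h : ∀ S T, f (Finsupp.single S 1) T = g (Finsupp.single S 1) T) : f = g := by
  refine Finsupp.lhom_ext' fun S => LinearMap.ext_ring ?_
  ext T
  exact h S T

theorem gradedMap_add (M N : Matrix D.EnhancedState D'.EnhancedState ℤ) (i j i' j' : ℤ) :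
    gradedMap (M + N) i j i' j' = gradedMap M i j i' j' + gradedMap N i j i' j' := by
  refine gradedMap_ext fun S T => ?_
  rw [LinearMap.add_apply, Finsupp.add_apply, gradedMap_single, gradedMap_single,
    gradedMap_single, Matrix.add_apply]

theorem gradedMap_one (i j : ℤ) :
    gradedMap (1 : Matrix D.EnhancedState D.EnhancedState ℤ) i j i j = LinearMap.id := by
  classical
  refine gradedMap_ext fun S T => ?_
  rw [gradedMap_single, LinearMap.id_apply, Finsupp.single_apply, Matrix.one_apply]
  exact if_congr Subtype.ext_iff.symm rfl rfl

theorem gradedMap_zero (i j i' j' : ℤ) :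
    gradedMap (0 : Matrix D.EnhancedState D'.EnhancedState ℤ) i j i' j' = 0 := by
  refine gradedMap_ext fun S T => ?_
  rw [gradedMap_single]
  rfl

theorem gradedMap_of_ne {M : Matrix D.EnhancedState D'.EnhancedState ℤ} {a b i j i' j' : ℤ}
    (hM : IsHomogeneous M a b) (h : i' ≠ i + a) : gradedMap M i j i' j' = 0 := by
  refine gradedMap_ext fun S T => ?_
  rw [gradedMap_single]
  by_contra hne
  apply h
  rw [← S.2.1, ← T.2.1]
  exact (hM _ _ hne).1

/-- Homogeneity of `M` confines the intermediate states to one bidegree, so the sum over that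
bidegree is the full matrix product. The degrees are related by equations, so no transport between
graded pieces is needed. -/
theorem gradedMap_comp {M : Matrix D.EnhancedState D'.EnhancedState ℤ}
    (N : Matrix D'.EnhancedState D''.EnhancedState ℤ) {a b : ℤ} (hM : IsHomogeneous M a b)
    {i j i' j' : ℤ} (i'' j'' : ℤ) (hi : i' = i + a) (hj : j' = j + b) :
    gradedMap N i' j' i'' j'' ∘ₗ gradedMap M i j i' j' = gradedMap (M * N) i j i'' j'' := by
  classical
  refine gradedMap_ext fun S W => ?_
  have h1 : gradedMap M i j i' j' (Finsupp.single S 1) =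
      ∑ T : D'.GradedState i' j', M S.1 T.1 • Finsupp.single T (1 : ℤ) := by
    ext T
    rw [gradedMap_single, Finsupp.finsetSum_apply]
    simp [Finsupp.single_apply]
  rw [LinearMap.comp_apply, h1, map_sum, Finsupp.finsetSum_apply, gradedMap_single,
    Matrix.mul_apply]
  simp only [map_smul, Finsupp.smul_apply, gradedMap_single, smul_eq_mul]
  have hmap : ∑ T : D'.GradedState i' j', M S.1 T.1 * N T.1 W.1 =
      ∑ T ∈ (Finset.univ : Finset (D'.GradedState i' j')).map (Function.Embedding.subtype
        fun T : D'.EnhancedState => T.homDegree = i' ∧ T.qDegree = j'), M S.1 T * N T W.1 := by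
    rw [Finset.sum_map]; rfl
  rw [hmap]
  refine Finset.sum_subset (Finset.subset_univ _) fun T _ hT => ?_
  by_contra hne
  have := hM _ _ (left_ne_zero_of_mul hne)
  apply hT
  rw [Finset.mem_map]
  exact ⟨⟨T, by rw [this.1, S.2.1, hi], by rw [this.2, S.2.2, hj]⟩, Finset.mem_univ _, rfl⟩

end Diagram

/-! ### Shifts of complexes -/

open CategoryTheory CategoryTheory.Limits

/-- The translation by `-m` of the degrees of cochain complexes. -/
def translation (m : ℤ) : (ComplexShape.up ℤ).Embedding (ComplexShape.up ℤ) :=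
  ComplexShape.Embedding.mk' _ _ (fun i => i - m) (fun i j h => by simpa using h)
    fun i j => by simp only [ComplexShape.up_Rel]; omega

instance (m : ℤ) : (translation m).IsRelIff :=
  ⟨fun i j h => by
    have h' : i - m + 1 = j - m := h
    change i + 1 = j
    omega⟩

namespace BigradedComplex

/-- By definition a shifted complex is the restriction along `translation m` of the complex in
secondary degree `j - n`. Its homology in degree `i` is compared using the neighbours `i - 1` and `i
+ 1`, which are carried to those of `i - m`. -/
theorem nonempty_homology_shift_iso (C : BigradedComplex) (m n : ℤ) :
    (C.shift m n).homology.Isomorphic (C.homology.shift m n) := fun i j =>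
  ⟨HomologicalComplex.restrictionHomologyIso (C (j - n)) (translation m) (i - 1) i (i + 1)
    (by simp) (by simp) (i' := i - m - 1) (j' := i - m) (k' := i - m + 1)
    (by change i - 1 - m = _; ring) rfl (by change i + 1 - m = _; ring) (by simp) (by simp)⟩

theorem nonempty_homology_directSum_iso (C C' : BigradedComplex) :
    (C.directSum C').homology.Isomorphic (C.homology.directSum C'.homology) := fun i j =>
  have := preservesBinaryBiproducts_of_preservesBiproducts
    (HomologicalComplex.homologyFunctor (ModuleCat.{0} ℤ) (ComplexShape.up ℤ) i)
  ⟨(HomologicalComplex.homologyFunctor _ _ i).mapBiprod (C j) (C' j)⟩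

theorem ChainEquivalent.homology {C C' : BigradedComplex} (h : C.ChainEquivalent C') :
    C.homology.Isomorphic C'.homology := fun i j => (h j).map fun e => e.toHomologyIso i

end BigradedComplex

namespace BigradedModule

theorem Isomorphic.trans {M M' M'' : BigradedModule} (h : M.Isomorphic M')
    (h' : M'.Isomorphic M'') : M.Isomorphic M'' := fun i j =>
  ⟨(h i j).some ≪≫ (h' i j).some⟩

theorem Isomorphic.shift {M M' : BigradedModule} (h : M.Isomorphic M') (m n : ℤ) :
    (M.shift m n).Isomorphic (M'.shift m n) := fun i j => h (i - m) (j - n)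

theorem Isomorphic.directSum {M M' N N' : BigradedModule} (h : M.Isomorphic M')
    (h' : N.Isomorphic N') : (M.directSum N).Isomorphic (M'.directSum N') := fun i j =>
  ⟨biprod.mapIso (h i j).some (h' i j).some⟩

end BigradedModule

/-- A homotopy equivalence of a complex with the image of a biproduct under an additive functor,
from maps to and from the images of the summands. -/
theorem nonempty_homotopyEquiv_biprod {ι V W : Type*} [Category V] [Preadditive V]
    [Category W] [Preadditive W] {c : ComplexShape ι} [HasBinaryBiproducts W]
    (F : W ⥤ HomologicalComplex V c) [F.Additive] {K : HomologicalComplex V c} {A B : W}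
    (i₁ : F.obj A ⟶ K) (i₂ : F.obj B ⟶ K) (p₁ : K ⟶ F.obj A) (p₂ : K ⟶ F.obj B)
    (h₁₁ : i₁ ≫ p₁ = 𝟙 _) (h₁₂ : i₁ ≫ p₂ = 0) (h₂₁ : i₂ ≫ p₁ = 0) (h₂₂ : i₂ ≫ p₂ = 𝟙 _)
    (h : Homotopy (𝟙 K) (p₁ ≫ i₁ + p₂ ≫ i₂)) : Nonempty (HomotopyEquiv K (F.obj (A ⊞ B))) := by
  -- The biproduct is formed before `F` is applied; additivity of `F` preserves the biproduct
  -- relations, so `F.map` of its structure maps can be used directly.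
  let f : K ⟶ F.obj (A ⊞ B) := p₁ ≫ F.map biprod.inl + p₂ ≫ F.map biprod.inr
  let g : F.obj (A ⊞ B) ⟶ K := F.map biprod.fst ≫ i₁ + F.map biprod.snd ≫ i₂
  have hfg : f ≫ g = p₁ ≫ i₁ + p₂ ≫ i₂ := by
    have e : ∀ {X Y Z : W} (u : X ⟶ Y) (v : Y ⟶ Z) {L : HomologicalComplex V c}
        (w : F.obj Z ⟶ L), F.map u ≫ F.map v ≫ w = F.map (u ≫ v) ≫ w := by
      intros; rw [F.map_comp, Category.assoc]
    simp [f, g, e]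
  have hgf : g ≫ f = 𝟙 _ := by
    have e : ∀ {L M N : HomologicalComplex V c} {u : L ⟶ M} {v : M ⟶ L} (_ : u ≫ v = 𝟙 _)
      (w : L ⟶ N), u ≫ v ≫ w = w := by
      intro L M N u v huv w; rw [← Category.assoc, huv, Category.id_comp]
    have e' : ∀ {L M P N : HomologicalComplex V c} {u : L ⟶ M} {v : M ⟶ P} (_ : u ≫ v = 0)
      (w : P ⟶ N), u ≫ v ≫ w = 0 := by
      intro L M P N u v huv w; rw [← Category.assoc, huv, zero_comp]
    simp only [f, g, Preadditive.comp_add, Preadditive.add_comp, Category.assoc, e h₁₁, e h₂₂,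
      e' h₁₂, e' h₂₁, comp_zero, add_zero, zero_add]
    rw [← F.map_comp, ← F.map_comp, ← F.map_add, biprod.total, F.map_id]
  -- This is a deformation retraction: one composite equals the identity, only the other needs `h`.
  exact ⟨⟨f, g, (Homotopy.ofEq hfg).trans h.symm, Homotopy.ofEq hgf⟩⟩

/-! ### The chain equivalence -/

namespace Diagram

variable {D D' D'' : Diagram}

theorem differential_comp_gradedMap (hD : D.IsCheckerboard)
    {M : Matrix D.EnhancedState D'.EnhancedState ℤ} {a b : ℤ} (hM : IsHomogeneous M a b)
    (hcomm : M * D'.differentialMatrix = D.differentialMatrix * M) {i₁ i₂ j i₁' i₂' j' : ℤ}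
    (h₁ : i₁' = i₁ + a) (h₂ : i₂ = i₁ + 1) (hj : j' = j + b) :
    D'.differential i₁' i₂' j' ∘ₗ gradedMap M i₁ j i₁' j'
      = gradedMap M i₂ j i₂' j' ∘ₗ D.differential i₁ i₂ j := by
  rw [differential_eq_gradedMap, differential_eq_gradedMap, gradedMap_comp _ hM _ _ h₁ hj,
    gradedMap_comp _ (isHomogeneous_differentialMatrix hD) _ _ h₂ (add_zero j).symm, hcomm]

variable {D₁ : Diagram} (hD : D₁.IsCheckerboard) (p : D₁.End) (q : hopf.End)

/-- The Khovanov complex of the connected sum with the Hopf link. -/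
noncomputable abbrev hopfSumComplex : BigradedComplex :=
  (connectedSum D₁ hopf p q).khovanovComplex (hD.connectedSum hopf_isCheckerboard p q)

/-- The first copy of the Khovanov complex of `D₁`. -/
noncomputable abbrev lowerCopy (j : ℤ) : CochainComplex (ModuleCat.{0} ℤ) ℤ :=
  ((translation 1).restrictionFunctor _).obj
    (((D₁.khovanovComplex hD).shift (-1) (-2)) (j - 1))

/-- The second copy of the Khovanov complex of `D₁`. -/
noncomputable abbrev upperCopy (j : ℤ) : CochainComplex (ModuleCat.{0} ℤ) ℤ :=
  ((translation 1).restrictionFunctor _).obj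
    (((D₁.khovanovComplex hD).shift 1 2) (j - 1))

/-- The embedding of the first copy. -/
noncomputable def lowerInclusionMap (j : ℤ) : lowerCopy hD j ⟶ hopfSumComplex hD p q j where
  -- The source degrees keep the unreduced form given by the two successive shifts; they are `i` and
  -- `j + 1`, in accordance with the bidegree `(0, -1)` of the matrix.
  f i := ModuleCat.ofHom (gradedMap (lowerInclusion p q) (i - 1 - (-1)) (j - 1 - (-2)) i j)
  comm' i i' h := by
    have h' : i + 1 = i' := h
    refine (ModuleCat.ofHom_comp _ _).symm.trans (Eq.trans ?_ (ModuleCat.ofHom_comp _ _))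
    exact congrArg ModuleCat.ofHom (differential_comp_gradedMap hD
      (i₁ := i - 1 - (-1)) (i₂ := i' - 1 - (-1)) (isHomogeneous_lowerInclusion p q hD)
      (lowerInclusion_mul_differentialMatrix hD)
      (by omega) (by omega) (by omega))

/-- The embedding of the second copy. -/
noncomputable def upperInclusionMap (j : ℤ) : upperCopy hD j ⟶ hopfSumComplex hD p q j where
  f i := ModuleCat.ofHom (gradedMap (upperInclusion p q) (i - 1 - 1) (j - 1 - 2) i j)
  comm' i i' h := by
    have h' : i + 1 = i' := h
    refine (ModuleCat.ofHom_comp _ _).symm.trans (Eq.trans ?_ (ModuleCat.ofHom_comp _ _))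
    exact congrArg ModuleCat.ofHom (differential_comp_gradedMap hD
      (i₁ := i - 1 - 1) (i₂ := i' - 1 - 1) (isHomogeneous_upperInclusion p q hD)
      upperInclusion_mul_differentialMatrix
      (by omega) (by omega) (by omega))

/-- The projection to the first copy. -/
noncomputable def lowerProjectionMap (j : ℤ) : hopfSumComplex hD p q j ⟶ lowerCopy hD j where
  f i := ModuleCat.ofHom (gradedMap (lowerProjection p q) i j (i - 1 - (-1)) (j - 1 - (-2)))
  comm' i i' h := by
    have h' : i + 1 = i' := h
    refine (ModuleCat.ofHom_comp _ _).symm.trans (Eq.trans ?_ (ModuleCat.ofHom_comp _ _))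
    exact congrArg ModuleCat.ofHom (differential_comp_gradedMap
      (i₁' := i - 1 - (-1))
      (hD.connectedSum hopf_isCheckerboard p q) (isHomogeneous_lowerProjection p q hD)
      differentialMatrix_mul_lowerProjection.symm (by omega) (by omega) (by omega))

/-- The projection to the second copy. -/
noncomputable def upperProjectionMap (j : ℤ) : hopfSumComplex hD p q j ⟶ upperCopy hD j where
  f i := ModuleCat.ofHom (gradedMap (upperProjection p q) i j (i - 1 - 1) (j - 1 - 2))
  comm' i i' h := by
    have h' : i + 1 = i' := h
    refine (ModuleCat.ofHom_comp _ _).symm.trans (Eq.trans ?_ (ModuleCat.ofHom_comp _ _))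
    exact congrArg ModuleCat.ofHom (differential_comp_gradedMap
      (i₁' := i - 1 - 1)
      (hD.connectedSum hopf_isCheckerboard p q) (isHomogeneous_upperProjection p q hD)
      (differentialMatrix_mul_upperProjection hD).symm (by omega) (by omega) (by omega))

theorem ofHom_gradedMap_comp {M : Matrix D.EnhancedState D'.EnhancedState ℤ}
    (N : Matrix D'.EnhancedState D''.EnhancedState ℤ) {a b : ℤ} (hM : IsHomogeneous M a b)
    {i j i' j' : ℤ} (i'' j'' : ℤ) (hi : i' = i + a) (hj : j' = j + b) :
    ModuleCat.ofHom (gradedMap M i j i' j') ≫ ModuleCat.ofHom (gradedMap N i' j' i'' j'')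
      = ModuleCat.ofHom (gradedMap (M * N) i j i'' j'') := by
  rw [← ModuleCat.ofHom_comp, gradedMap_comp N hM _ _ hi hj]

theorem lowerInclusionMap_comp_lowerProjectionMap (j : ℤ) :
    lowerInclusionMap hD p q j ≫ lowerProjectionMap hD p q j = 𝟙 _ := by
  ext1 i
  refine (ofHom_gradedMap_comp (i := i - 1 - (-1)) (j := j - 1 - (-2)) _
    (isHomogeneous_lowerInclusion p q hD) _ _ (by omega) (by omega)).trans ?_
  rw [lowerInclusion_mul_lowerProjection]
  exact congrArg ModuleCat.ofHom (gradedMap_one _ _)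

theorem upperInclusionMap_comp_upperProjectionMap (j : ℤ) :
    upperInclusionMap hD p q j ≫ upperProjectionMap hD p q j = 𝟙 _ := by
  ext1 i
  refine (ofHom_gradedMap_comp (i := i - 1 - 1) (j := j - 1 - 2) _
    (isHomogeneous_upperInclusion p q hD) _ _ (by omega) (by omega)).trans ?_
  rw [upperInclusion_mul_upperProjection]
  exact congrArg ModuleCat.ofHom (gradedMap_one _ _)

theorem lowerInclusionMap_comp_upperProjectionMap (j : ℤ) :
    lowerInclusionMap hD p q j ≫ upperProjectionMap hD p q j = 0 := by
  ext1 i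
  refine (ofHom_gradedMap_comp (i := i - 1 - (-1)) (j := j - 1 - (-2)) _
    (isHomogeneous_lowerInclusion p q hD) _ _ (by omega) (by omega)).trans ?_
  rw [lowerInclusion_mul_upperProjection, gradedMap_zero]
  rfl

theorem upperInclusionMap_comp_lowerProjectionMap (j : ℤ) :
    upperInclusionMap hD p q j ≫ lowerProjectionMap hD p q j = 0 := by
  ext1 i
  refine (ofHom_gradedMap_comp (i := i - 1 - 1) (j := j - 1 - 2) _
    (isHomogeneous_upperInclusion p q hD) _ _ (by omega) (by omega)).trans ?_
  rw [upperInclusion_mul_lowerProjection, gradedMap_zero]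
  rfl

/-- The components of the contraction. -/
noncomputable def contractionMap (j i i' : ℤ) :
    (hopfSumComplex hD p q j).X i ⟶ (hopfSumComplex hD p q j).X i' :=
  ModuleCat.ofHom (gradedMap (contraction p q) i j i' j)

/-- The composition of the projections and the embeddings is homotopic to the identity. -/
noncomputable def contractionHomotopy (j : ℤ) : Homotopy (𝟙 (hopfSumComplex hD p q j))
    (lowerProjectionMap hD p q j ≫ lowerInclusionMap hD p q j
      + upperProjectionMap hD p q j ≫ upperInclusionMap hD p q j) where
  hom := contractionMap hD p q j
  zero i i' h := by
    unfold contractionMap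
    rw [gradedMap_of_ne (isHomogeneous_contraction p q hD)]
    · rfl
    · intro h'
      apply h
      change i' + 1 = i
      omega
  comm i := by
    have hD' := hD.connectedSum hopf_isCheckerboard p q
    rw [dNext_eq _ (show (ComplexShape.up ℤ).Rel i (i + 1) from rfl),
      prevD_eq _ (show (ComplexShape.up ℤ).Rel (i - 1) i from sub_add_cancel i 1)]
    have h₁ := ofHom_gradedMap_comp (contraction p q) (isHomogeneous_differentialMatrix hD')
      (i := i) (j := j) i j (rfl : i + 1 = _) (add_zero j).symm
    have h₂ := ofHom_gradedMap_comp (connectedSum D₁ hopf p q).differentialMatrix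
      (isHomogeneous_contraction p q hD) (i := i) (j := j) (i' := i - 1) i j rfl (add_zero j).symm
    have h₃ := ofHom_gradedMap_comp (lowerInclusion p q) (isHomogeneous_lowerProjection p q hD)
      (i := i) (j := j) (i' := i - 1 - (-1)) (j' := j - 1 - (-2)) i j (by omega) (by omega)
    have h₄ := ofHom_gradedMap_comp (upperInclusion p q) (isHomogeneous_upperProjection p q hD)
      (i := i) (j := j) (i' := i - 1 - 1) (j' := j - 1 - 2) i j (by omega) (by omega)
    have h := congrArg (fun M => ModuleCat.ofHom (gradedMap M i j i j))
      (contraction_identity (p := p) (q := q) hD)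
    simp only [gradedMap_add, gradedMap_one, ModuleCat.ofHom_add] at h
    -- The homotopy terms are moved in front of the retraction terms, which is the order demanded by
    -- `Homotopy.comm`.
    rw [← h₁, ← h₂, ← h₃, ← h₄, add_comm] at h
    exact h.symm

/-- The outer shift of a direct sum is, by definition, the restriction functor of `translation 1`
applied to a biproduct, and `lowerCopy` and `upperCopy` are its values on the two summands. -/
theorem chainEquivalent_hopfSum :
    (hopfSumComplex hD p q).ChainEquivalent
      ((((D₁.khovanovComplex hD).shift (-1) (-2)).directSum
        ((D₁.khovanovComplex hD).shift 1 2)).shift 1 1) := fun j =>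
  nonempty_homotopyEquiv_biprod ((translation 1).restrictionFunctor _)
    (lowerInclusionMap hD p q j) (upperInclusionMap hD p q j) (lowerProjectionMap hD p q j)
    (upperProjectionMap hD p q j) (lowerInclusionMap_comp_lowerProjectionMap hD p q j)
    (lowerInclusionMap_comp_upperProjectionMap hD p q j)
    (upperInclusionMap_comp_lowerProjectionMap hD p q j)
    (upperInclusionMap_comp_upperProjectionMap hD p q j) (contractionHomotopy hD p q j)

end Diagram
end Khovanov

/-! ### The theorem for complexes and its consequence for homology -/

theorem mainTheorem7 (D₁ : Khovanov.Diagram) (hD₁ : D₁.IsPlanar)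
    (p : D₁.End) (q : Khovanov.Diagram.hopf.End) :
    ((Khovanov.Diagram.connectedSum D₁ Khovanov.Diagram.hopf p q).khovanovComplex
        (hD₁.isCheckerboard.connectedSum Khovanov.Diagram.hopf_isCheckerboard p q)).ChainEquivalent
      ((((D₁.khovanovComplex hD₁.isCheckerboard).shift (-1) (-2)).directSum
        ((D₁.khovanovComplex hD₁.isCheckerboard).shift 1 2)).shift 1 1) ∧
    ((Khovanov.Diagram.connectedSum D₁ Khovanov.Diagram.hopf p q).khovanovHomology
        (hD₁.isCheckerboard.connectedSum Khovanov.Diagram.hopf_isCheckerboard p q)).Isomorphic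
      ((((D₁.khovanovHomology hD₁.isCheckerboard).shift (-1) (-2)).directSum
        ((D₁.khovanovHomology hD₁.isCheckerboard).shift 1 2)).shift 1 1) := by
  have h := Khovanov.Diagram.chainEquivalent_hopfSum hD₁.isCheckerboard p q
  refine ⟨h, h.homology.trans ?_⟩
  -- Homology commutes with the outer shift, then with the direct sum, and then with the shift of
  -- each summand.
  refine (Khovanov.BigradedComplex.nonempty_homology_shift_iso _ _ _).trans
    (Khovanov.BigradedModule.Isomorphic.shift ?_ 1 1)
  exact (Khovanov.BigradedComplex.nonempty_homology_directSum_iso _ _).trans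
    ((Khovanov.BigradedComplex.nonempty_homology_shift_iso _ _ _).directSum
      (Khovanov.BigradedComplex.nonempty_homology_shift_iso _ _ _))
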